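/- Let $d\ge 1$ be an integer, $\mathbb{T}^d=\mathbb{R}^d/\mathbb{Z}^d$ with Lebesgue measure of mass one, $\mathscr{S}=C^\infty(\mathbb{T}^d,\mathbb{R})$ with the seminorms $\|\phi\|_{j,\mathscr{S}}=\max_{|\mu|\le j}\sup_x|\partial^\mu\phi(x)|$, and $\mathscr{S}'$ the space of linear forms $f$ on $\mathscr{S}$ with $|f(\phi)|\le c\|\phi\|_{q,\mathscr{S}}$ for some $c\ge 0$, $q\in\mathbb{N}$ and all $\phi$. For $g\in\mathscr{S}$, $f\in\mathscr{S}'$ write $(g*f)(x)=f(g(x-\cdot))$. **Besov spaces.** Fix a dyadic partition of unity: non-negative radial functions $\rho_{-1},\rho_0\in C_c^\infty(\mathbb{R}^d,\mathbb{R})$ with supports in $\{|y|\le\frac43\}$ and $\{\frac34\le|y|\le\frac83\}$ respectively and $\rho_{-1}(x)+\sum_{q\in\mathbb{N}}\rho_0(2^{-q}x)=1$ for all $x$. Put $\rho_q=\rho_0(2^{-q}\cdot)$ for $q\in\mathbb{N}$, $K_q(x)=\sum_{m\in\mathbb{Z}^d}\rho_q(m)\cos(2\pi\langle x,m\rangle)$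 and $\Delta_qf=K_q*f$ for $q\ge-1$, and $$\|f\|_\alpha=\sup_{q\ge-1}2^{\alpha q}\|\Delta_qf\|_{L^\infty(\mathbb{T}^d)},\qquad \mathscr{C}^\alpha=\Big\{f\in\mathscr{S}' : \lim_{q\to\infty}2^{\alpha q}\|\Delta_qf\|_{L^\infty(\mathbb{T}^d)}=0\Big\},$$ where $\mathscr{C}^\alpha$ carries the topology of $\|\cdot\|_\alpha$ and its Borel $\sigma$-algebra. **Noise.** Let $(\Omega,\mathcal{F},\mathbb{P})$ be a complete probability space and $(\xi_h)_{h\in L^2(\mathbb{R}_+\times\mathbb{T}^d)}$ a space-time white noise: a family of real random variables such that $\xi_h$ is normally distributed with mean $0$ and variance $\int h^2$ for every $h$, and $\xi_{ag+bh}=a\xi_g+b\xi_h$ almost surely for all $g,h$ and $a,b\in\mathbb{R}$. Let $\mathcal{A}_r$ be the set of $h\in L^2(\mathbb{R}_+\times\mathbb{T}^d)$ that vanish on $]r,\infty[\times\mathbb{T}^d$, and let $$\mathcal{F}_r=\bigcap_{q>r}\sigma\big(\{J\in\mathcal{F}:\mathbb{P}(J)=0\}\cup\textstyle\bigcup_{h\in\mathcal{A}_q}\sigma(\xi_h)\big).$$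 **Stochastic convolution.** For $s>0$ let $\eta_s(x)=\sum_{m\in\mathbb{Z}^d}\cos(2\pi\langle x,m\rangle)e^{-s|2\pi m|^4}$, with the convention $\eta_0*\phi=\phi$, and let $$X_r(\phi)=\int_{[0,r]\times\mathbb{T}^d}(\eta_{r-q}*\phi)(x)\,\xi(dq,dx):=\xi_{h},\qquad h(q,x)=\mathbf 1_{[0,r]}(q)\,(\eta_{r-q}*\phi)(x).$$ **Theorem.** Let $\theta<2-\frac d2$. There exists a process $(\widetilde X_r)_{r\ge0}$ with values in $\mathscr{C}^\theta$, adapted to $(\mathcal{F}_r)_{r\ge 0}$, such that: 1. $r\mapsto\widetilde X_r(\omega)\in\mathscr{C}^\theta$ is continuous for every $\omega\in\Omega$, and for all $r\ge0$ and $\phi\in\mathscr{S}$, $\mathbb{P}(\widetilde X_r(\phi)=X_r(\phi))=1$. 2. For every $\zeta\in C_c^\infty(\mathbb{R}^d,\mathbb{R})$ with $\zeta(0)=1$ and $\zeta(-x)=\zeta(x)$ for all $x$, setting $\zeta_\epsilon(x)=\sum_{q\in\mathbb{Z}^d}\zeta(\epsilon q)\cos(2\pi\langle x,q\rangle)$ for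 $\epsilon>0$, one has for all $U\ge0$ and $\sigma>0$ $$\lim_{\epsilon\to0^+}\mathbb{P}\Big(\sup_{r\in[0,U]}\big\|\zeta_\epsilon*\widetilde X_r-\widetilde X_r\big\|_\theta>\sigma\Big)=0.$$ -/

import Mathlib

open MeasureTheory ProbabilityTheory Filter Topology
open scoped NNReal ENNReal

noncomputable section

namespace CahnHilliard

/-! ### The torus, smooth functions and distributions -/

/-- The `d`-dimensional torus `ℝ^d / ℤ^d`. -/
abbrev Torus (d : ℕ) : Type := UnitAddTorus (Fin d)

/-- Lebesgue measure on the torus, of total mass one. -/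
def torusMeasure (d : ℕ) : Measure (Torus d) :=
  Measure.pi fun _ => (AddCircle.haarAddCircle : Measure UnitAddCircle)

instance (d : ℕ) : IsProbabilityMeasure (torusMeasure d) := by
  unfold torusMeasure; infer_instance

/-- The quotient map `ℝ^d → ℝ^d / ℤ^d`. -/
def torusMk {d : ℕ} (y : Fin d → ℝ) : Torus d := fun i => (y i : UnitAddCircle)

/-- The periodic function on `ℝ^d` which corresponds to a function on the torus. -/
def periodicLift {d : ℕ} (φ : Torus d → ℝ) : (Fin d → ℝ) → ℝ := fun y => φ (torusMk y)

theorem torusMk_surjective {d : ℕ} : Function.Surjective (torusMk (d := d)) := by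
  intro x
  choose y hy using fun i => QuotientAddGroup.mk_surjective (x i)
  exact ⟨y, funext hy⟩

theorem isOpenQuotientMap_torusMk {d : ℕ} : IsOpenQuotientMap (torusMk (d := d)) :=
  IsOpenQuotientMap.piMap
    (f := fun (_ : Fin d) => ((↑) : ℝ → UnitAddCircle)) fun _ =>
      QuotientAddGroup.isOpenQuotientMap_mk

/-- The space `C^∞(𝕋^d, ℝ)` of smooth functions on the torus. -/
def TestFun (d : ℕ) : Submodule ℝ (Torus d → ℝ) where
  carrier := {φ | ContDiff ℝ (⊤ : ℕ∞) (periodicLift φ)}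
  add_mem' {φ ψ} hφ hψ := by
    change ContDiff ℝ (⊤ : ℕ∞) _ at hφ hψ ⊢
    exact hφ.add hψ
  zero_mem' := (contDiff_const : ContDiff ℝ (⊤ : ℕ∞) fun _ : Fin d → ℝ => (0 : ℝ))
  smul_mem' c φ hφ := by
    change ContDiff ℝ (⊤ : ℕ∞) _ at hφ ⊢
    exact contDiff_const.smul hφ

theorem testFun_contDiff {d : ℕ} (φ : TestFun d) :
    ContDiff ℝ (⊤ : ℕ∞) (periodicLift (φ : Torus d → ℝ)) := φ.2

theorem testFun_continuous {d : ℕ} (φ : TestFun d) :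
    Continuous (φ : Torus d → ℝ) :=
  isOpenQuotientMap_torusMk.isQuotientMap.continuous_iff.2 (testFun_contDiff φ).continuous

/-- The partial derivative `∂_{v 0} ⋯ ∂_{v (k-1)} φ`, as a periodic function on `ℝ^d`. -/
def iteratedPartial {d : ℕ} (k : ℕ) (v : Fin k → Fin d) (φ : Torus d → ℝ) (y : Fin d → ℝ) : ℝ :=
  iteratedFDeriv ℝ k (periodicLift φ) y fun i => Pi.single (v i) 1

/-- The seminorm `max_{|μ| ≤ j} sup_x |∂^μ φ(x)|` on test functions. -/
def testSeminorm {d : ℕ} (j : ℕ) (φ : Torus d → ℝ) : ℝ≥0∞ :=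
  ⨆ (k : ℕ) (_ : k ≤ j) (v : Fin k → Fin d) (y : Fin d → ℝ), ‖iteratedPartial k v φ y‖ₑ

theorem testSeminorm_mono {d : ℕ} {i j : ℕ} (h : i ≤ j) (φ : Torus d → ℝ) :
    testSeminorm i φ ≤ testSeminorm j φ :=
  iSup_mono fun _ => iSup_mono' fun hk => ⟨hk.trans h, le_rfl⟩

theorem enorm_le_testSeminorm {d : ℕ} (φ : Torus d → ℝ) (x : Torus d) :
    ‖φ x‖ₑ ≤ testSeminorm 0 φ := by
  obtain ⟨y, rfl⟩ := torusMk_surjective x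
  refine le_iSup_of_le 0 (le_iSup_of_le le_rfl (le_iSup_of_le Fin.elim0 (le_iSup_of_le y ?_)))
  simp [iteratedPartial, periodicLift]

/-- The space `𝒮'` of distributions on the torus: the linear forms on `C^∞(𝕋^d, ℝ)` which are
bounded by one of the seminorms. -/
def Dist (d : ℕ) : Submodule ℝ (TestFun d →ₗ[ℝ] ℝ) where
  carrier := {f | ∃ (c : ℝ≥0) (q : ℕ), ∀ φ : TestFun d, ‖f φ‖ₑ ≤ c * testSeminorm q (φ : Torus d → ℝ)}
  add_mem' := by
    rintro f g ⟨c, q, hf⟩ ⟨c', q', hg⟩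
    refine ⟨c + c', max q q', fun φ => ?_⟩
    calc ‖(f + g) φ‖ₑ ≤ ‖f φ‖ₑ + ‖g φ‖ₑ := enorm_add_le _ _
      _ ≤ c * testSeminorm (max q q') (φ : Torus d → ℝ)
          + c' * testSeminorm (max q q') (φ : Torus d → ℝ) := by
        refine add_le_add ((hf φ).trans ?_) ((hg φ).trans ?_)
        · exact mul_le_mul_right (testSeminorm_mono (le_max_left _ _) _) _
        · exact mul_le_mul_right (testSeminorm_mono (le_max_right _ _) _) _
      _ = _ := by rw [ENNReal.coe_add, add_mul]
  zero_mem' := ⟨0, 0, fun φ => by simp⟩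
  smul_mem' := by
    rintro a f ⟨c, q, hf⟩
    refine ⟨‖a‖₊ * c, q, fun φ => ?_⟩
    rw [LinearMap.smul_apply, enorm_smul, ENNReal.coe_mul, mul_assoc]
    exact mul_le_mul_right (hf φ) _

/-- The distribution `φ ↦ ∫ h(x) φ(x) dx` given by a continuous function `h`. -/
def ofContinuous {d : ℕ} (h : C(Torus d, ℝ)) : Dist d :=
  ⟨{  toFun := fun φ => ∫ x, h x * (φ : Torus d → ℝ) x ∂torusMeasure d
      map_add' := fun φ ψ => by
        have hi : ∀ χ : TestFun d,
            Integrable (fun x => h x * (χ : Torus d → ℝ) x) (torusMeasure d) := fun χ =>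
          (h.continuous.mul (testFun_continuous χ)).integrable_of_hasCompactSupport
            (HasCompactSupport.of_compactSpace _)
        rw [← integral_add (hi φ) (hi ψ)]
        simp [mul_add]
      map_smul' := fun a φ => by
        rw [RingHom.id_apply, smul_eq_mul, ← integral_const_mul]
        refine integral_congr_ae (ae_of_all _ fun x => ?_)
        simp only [Submodule.coe_smul, Pi.smul_apply, smul_eq_mul]
        ring }, by
    refine ⟨‖h‖₊, 0, fun φ => ?_⟩
    refine (enorm_integral_le_lintegral_enorm _).trans ?_
    calc ∫⁻ x, ‖h x * (φ : Torus d → ℝ) x‖ₑ ∂torusMeasure d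
        ≤ ∫⁻ _, (‖h‖₊ : ℝ≥0∞) * testSeminorm 0 (φ : Torus d → ℝ) ∂torusMeasure d := by
          refine lintegral_mono fun x => ?_
          rw [enorm_mul]
          refine mul_le_mul' ?_ (enorm_le_testSeminorm _ x)
          exact ENNReal.coe_le_coe.2 (h.norm_coe_le_norm x)
      _ = _ := by simp⟩

/-! ### Trigonometric functions and convolutions -/

/-- A point of `ℤ^d`, as a point of the Euclidean space `ℝ^d`. -/
def latticePt {d : ℕ} (m : Fin d → ℤ) : EuclideanSpace ℝ (Fin d) :=
  WithLp.toLp 2 fun i => (m i : ℝ)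

/-- The function `x ↦ cos(2π⟨x, m⟩)` on the torus. -/
def cosChar {d : ℕ} (m : Fin d → ℤ) (x : Torus d) : ℝ := (UnitAddTorus.mFourier m x).re

/-- The function `x ↦ sin(2π⟨x, m⟩)` on the torus. -/
def sinChar {d : ℕ} (m : Fin d → ℤ) (x : Torus d) : ℝ := (UnitAddTorus.mFourier m x).im

theorem mFourier_torusMk {d : ℕ} (m : Fin d → ℤ) (y : Fin d → ℝ) :
    UnitAddTorus.mFourier m (torusMk y)
      = Complex.exp (((2 * Real.pi * ∑ i, y i * m i : ℝ) : ℂ) * Complex.I) := by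
  simp only [UnitAddTorus.mFourier, torusMk, ContinuousMap.coe_mk, fourier_coe_apply]
  rw [← Complex.exp_sum]
  congr 1
  push_cast
  rw [Finset.mul_sum, Finset.sum_mul]
  refine Finset.sum_congr rfl fun i _ => ?_
  simp
  ring

theorem cosChar_torusMk {d : ℕ} (m : Fin d → ℤ) (y : Fin d → ℝ) :
    cosChar m (torusMk y) = Real.cos (2 * Real.pi * ∑ i, y i * m i) := by
  rw [cosChar, mFourier_torusMk, Complex.exp_ofReal_mul_I_re]

theorem sinChar_torusMk {d : ℕ} (m : Fin d → ℤ) (y : Fin d → ℝ) :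
    sinChar m (torusMk y) = Real.sin (2 * Real.pi * ∑ i, y i * m i) := by
  rw [sinChar, mFourier_torusMk, Complex.exp_ofReal_mul_I_im]

/-- `x ↦ cos(2π⟨x, m⟩)` as a test function. -/
def cosTest {d : ℕ} (m : Fin d → ℤ) : TestFun d :=
  ⟨cosChar m, by
    change ContDiff ℝ (⊤ : ℕ∞) (fun y : Fin d → ℝ => cosChar m (torusMk y))
    simp only [cosChar_torusMk]
    fun_prop⟩

/-- `x ↦ sin(2π⟨x, m⟩)` as a test function. -/
def sinTest {d : ℕ} (m : Fin d → ℤ) : TestFun d :=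
  ⟨sinChar m, by
    change ContDiff ℝ (⊤ : ℕ∞) (fun y : Fin d → ℝ => sinChar m (torusMk y))
    simp only [sinChar_torusMk]
    fun_prop⟩

/-- The function `x ↦ ∑_{m ∈ ℤ^d} h(m) cos(2π⟨x, m⟩)`. It is used for compactly supported `h`,
where the sum has finitely many non-zero terms. -/
def cosSeries {d : ℕ} (h : EuclideanSpace ℝ (Fin d) → ℝ) : TestFun d :=
  ∑ᶠ m : Fin d → ℤ, h (latticePt m) • cosTest m

/-- The test function `y ↦ g(x - y)`. -/
def reflectTranslate {d : ℕ} (x : Torus d) : TestFun d →ₗ[ℝ] TestFun d where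
  toFun g := ⟨fun y => (g : Torus d → ℝ) (x - y), by
    obtain ⟨a, rfl⟩ := torusMk_surjective x
    exact ContDiff.comp (g := periodicLift (g : Torus d → ℝ)) (testFun_contDiff g) (contDiff_const.sub contDiff_id :
      ContDiff ℝ (⊤ : ℕ∞) fun y : Fin d → ℝ => a - y)⟩
  map_add' _ _ := rfl
  map_smul' _ _ := rfl

/-- The convolution `g * f` of a test function and a distribution, `(g * f)(x) = f(g(x - ·))`. -/
def convolve {d : ℕ} (g : TestFun d) (f : Dist d) (x : Torus d) : ℝ :=
  (f : TestFun d →ₗ[ℝ] ℝ) (reflectTranslate x g)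

theorem reflectTranslate_cosTest {d : ℕ} (m : Fin d → ℤ) (x : Torus d) :
    reflectTranslate x (cosTest m) = cosChar m x • cosTest m + sinChar m x • sinTest m := by
  apply Subtype.ext
  funext z
  obtain ⟨a, rfl⟩ := torusMk_surjective x
  obtain ⟨b, rfl⟩ := torusMk_surjective z
  change cosChar m (torusMk (a - b)) = cosChar m (torusMk a) * cosChar m (torusMk b)
    + sinChar m (torusMk a) * sinChar m (torusMk b)
  simp only [cosChar_torusMk, sinChar_torusMk, Pi.sub_apply, sub_mul, Finset.sum_sub_distrib,
    mul_sub, Real.cos_sub]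

theorem continuous_convolve_cosSeries {d : ℕ} (h : EuclideanSpace ℝ (Fin d) → ℝ) (f : Dist d) :
    Continuous (convolve (cosSeries h) f) := by
  by_cases hs : (Function.support fun m : Fin d → ℤ => h (latticePt m) • cosTest m).Finite
  · have : convolve (cosSeries h) f = fun x => ∑ m ∈ hs.toFinset, h (latticePt m) *
        (cosChar m x * (f : TestFun d →ₗ[ℝ] ℝ) (cosTest m)
          + sinChar m x * (f : TestFun d →ₗ[ℝ] ℝ) (sinTest m)) := by
      funext x
      rw [convolve, cosSeries, finsum_eq_sum _ hs]
      simp only [map_sum, map_smul, reflectTranslate_cosTest, map_add, smul_eq_mul]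
    rw [this]
    refine continuous_finsetSum _ fun m _ => continuous_const.mul
      ((Continuous.mul ?_ continuous_const).add (Continuous.mul ?_ continuous_const))
    · exact testFun_continuous (cosTest m)
    · exact testFun_continuous (sinTest m)
  · have : convolve (cosSeries h) f = fun _ => 0 := by
      funext x
      rw [convolve, cosSeries, finsum_of_infinite_support hs]
      simp
    rw [this]
    exact continuous_const

/-! ### Littlewood-Paley blocks and Besov spaces -/

/-- A dyadic partition of unity `(ρ₋₁, ρ₀)` on `ℝ^d`. -/
structure DyadicPartition (d : ℕ) where
  /-- The function `ρ₋₁`. -/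
  low : EuclideanSpace ℝ (Fin d) → ℝ
  /-- The function `ρ₀`. -/
  ann : EuclideanSpace ℝ (Fin d) → ℝ
  low_smooth : ContDiff ℝ (⊤ : ℕ∞) low
  ann_smooth : ContDiff ℝ (⊤ : ℕ∞) ann
  low_nonneg : ∀ x, 0 ≤ low x
  ann_nonneg : ∀ x, 0 ≤ ann x
  low_radial : ∀ x y, ‖x‖ = ‖y‖ → low x = low y
  ann_radial : ∀ x y, ‖x‖ = ‖y‖ → ann x = ann y
  low_support : tsupport low ⊆ {y | ‖y‖ ≤ 4 / 3}
  ann_support : tsupport ann ⊆ {y | 3 / 4 ≤ ‖y‖ ∧ ‖y‖ ≤ 8 / 3}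
  hasSum_one : ∀ x, HasSum (fun q : ℕ => ann (((2 : ℝ) ^ q)⁻¹ • x)) (1 - low x)

variable {d : ℕ}

/-- The functions of the partition, numbered from `0`: `ρ.fn j` is `ρ_{j-1}`, so `ρ.fn 0 = ρ₋₁`
and `ρ.fn (q + 1) = ρ_q = ρ₀(2^{-q} ·)`. -/
def DyadicPartition.fn (ρ : DyadicPartition d) : ℕ → EuclideanSpace ℝ (Fin d) → ℝ
  | 0 => ρ.low
  | q + 1 => fun x => ρ.ann (((2 : ℝ) ^ q)⁻¹ • x)

/-- The Littlewood-Paley block `Δ_{j-1} f = K_{j-1} * f`, where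
`K_{j-1}(x) = ∑_m ρ_{j-1}(m) cos(2π⟨x, m⟩)`. -/
def block (ρ : DyadicPartition d) (j : ℕ) (f : Dist d) : Torus d → ℝ :=
  convolve (cosSeries (ρ.fn j)) f

/-- The norm `‖f‖_α = sup_{j ∈ ℕ} 2^{α(j-1)} ‖Δ_{j-1} f‖_{L^∞}`, with values in `[0, ∞]`. -/
def besovNorm (ρ : DyadicPartition d) (α : ℝ) (f : Dist d) : ℝ≥0∞ :=
  ⨆ j : ℕ, (2 : ℝ≥0∞) ^ (α * ((j : ℝ) - 1)) * eLpNorm (block ρ j f) ∞ (torusMeasure d)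

/-- The Besov space `𝒞^α` of the distributions `f` with `2^{αq} ‖Δ_q f‖_{L^∞} → 0`. -/
def BesovC (ρ : DyadicPartition d) (α : ℝ) : Type :=
  {f : Dist d // Tendsto (fun q : ℕ => (2 : ℝ≥0∞) ^ (α * (q : ℝ)) *
    eLpNorm (block ρ (q + 1) f) ∞ (torusMeasure d)) atTop (𝓝 0)}

/-- The distribution underlying an element of `𝒞^α`. -/
def BesovC.toDist {ρ : DyadicPartition d} {α : ℝ} (f : BesovC ρ α) : Dist d := f.1

theorem block_add (ρ : DyadicPartition d) (j : ℕ) (f g : Dist d) :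
    block ρ j (f + g) = block ρ j f + block ρ j g := rfl

theorem block_neg (ρ : DyadicPartition d) (j : ℕ) (f : Dist d) :
    block ρ j (-f) = -block ρ j f := rfl

theorem besovNorm_zero (ρ : DyadicPartition d) (α : ℝ) : besovNorm ρ α 0 = 0 := by
  have : ∀ j, block ρ j (0 : Dist d) = 0 := fun j => rfl
  simp [besovNorm, this]

theorem besovNorm_neg (ρ : DyadicPartition d) (α : ℝ) (f : Dist d) :
    besovNorm ρ α (-f) = besovNorm ρ α f := by
  simp only [besovNorm, block_neg, eLpNorm_neg]

theorem besovNorm_add_le (ρ : DyadicPartition d) (α : ℝ) (f g : Dist d) :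
    besovNorm ρ α (f + g) ≤ besovNorm ρ α f + besovNorm ρ α g := by
  refine iSup_le fun j => ?_
  rw [block_add]
  calc _ ≤ (2 : ℝ≥0∞) ^ (α * ((j : ℝ) - 1)) * (eLpNorm (block ρ j f) ∞ (torusMeasure d)
        + eLpNorm (block ρ j g) ∞ (torusMeasure d)) := by
        refine mul_le_mul_right ?_ _
        simpa only [eLpNorm_exponent_top] using eLpNormEssSup_add_le
    _ ≤ _ := by
        rw [mul_add]
        exact add_le_add
          (le_iSup (fun j : ℕ => (2 : ℝ≥0∞) ^ (α * ((j : ℝ) - 1)) *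
            eLpNorm (block ρ j f) ∞ (torusMeasure d)) j)
          (le_iSup (fun j : ℕ => (2 : ℝ≥0∞) ^ (α * ((j : ℝ) - 1)) *
            eLpNorm (block ρ j g) ∞ (torusMeasure d)) j)

/-- The topology of `𝒞^α` is given by the distance `‖f - g‖_α`. -/
instance (ρ : DyadicPartition d) (α : ℝ) : PseudoEMetricSpace (BesovC ρ α) where
  edist f g := besovNorm ρ α (f.toDist - g.toDist)
  edist_self f := by
    have h : f.toDist - f.toDist = 0 := sub_self f.toDist
    rw [h, besovNorm_zero]
  edist_comm f g := by
    have h : f.toDist - g.toDist = -(g.toDist - f.toDist) := (neg_sub g.toDist f.toDist).symm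
    rw [h, besovNorm_neg]
  edist_triangle f g h := by
    rw [← sub_add_sub_cancel f.toDist g.toDist h.toDist]
    exact besovNorm_add_le ρ α _ _

/-- `𝒞^α` carries its Borel σ-algebra. -/
instance (ρ : DyadicPartition d) (α : ℝ) : MeasurableSpace (BesovC ρ α) := borel _

instance (ρ : DyadicPartition d) (α : ℝ) : BorelSpace (BesovC ρ α) := ⟨rfl⟩

/-! ### White noise and the stochastic convolution -/

/-- Lebesgue measure on `ℝ₊ × 𝕋^d`. -/
def noiseMeasure (d : ℕ) : Measure (ℝ≥0 × Torus d) :=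
  (Measure.comap ((↑) : ℝ≥0 → ℝ) volume).prod (torusMeasure d)

/-- The functions in `L²(ℝ₊ × 𝕋^d)`. -/
def SqIntegrable (h : ℝ≥0 × Torus d → ℝ) : Prop :=
  Measurable h ∧ MemLp h 2 (noiseMeasure d)

/-- A space-time white noise: a family of random variables, indexed by `L²(ℝ₊ × 𝕋^d)` and almost
surely linear in the index, such that `ξ_h` is centred and normally distributed with variance
`∫ h²`. The values at functions outside `L²(ℝ₊ × 𝕋^d)` carry no meaning and are never used. -/
structure IsSpaceTimeWhiteNoise {Ω : Type*} [MeasurableSpace Ω] (P : Measure Ω)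
    (ξ : (ℝ≥0 × Torus d → ℝ) → Ω → ℝ) : Prop where
  measurable : ∀ h, SqIntegrable h → Measurable (ξ h)
  map_eq : ∀ h, SqIntegrable h → P.map (ξ h) = gaussianReal 0
    (∫ z, h z ^ 2 ∂noiseMeasure d).toNNReal
  linear : ∀ g h, SqIntegrable g → SqIntegrable h → ∀ a b : ℝ,
    ∀ᵐ ω ∂P, ξ (a • g + b • h) ω = a * ξ g ω + b * ξ h ω

/-- The σ-algebra `ℱ_r`, the right-continuous completed σ-algebra of the noise up to time `r`. -/
@[reducible] def noiseSigma {Ω : Type*} [MeasurableSpace Ω] (P : Measure Ω)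
    (ξ : (ℝ≥0 × Torus d → ℝ) → Ω → ℝ) (r : ℝ≥0) : MeasurableSpace Ω :=
  ⨅ (q : ℝ≥0) (_ : r < q), MeasurableSpace.generateFrom {J | MeasurableSet J ∧ P J = 0} ⊔
    ⨆ (φ : ℝ≥0 × Torus d → ℝ) (_ : SqIntegrable φ ∧ ∀ s x, q < s → φ (s, x) = 0),
      MeasurableSpace.comap (ξ φ) inferInstance

/-- The kernel `η_s(x) = ∑_{m ∈ ℤ^d} cos(2π⟨x, m⟩) exp(-s |2πm|⁴)` for `s > 0`. -/
def heatKernel (s : ℝ) (x : Torus d) : ℝ :=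
  ∑' m : Fin d → ℤ, cosChar m x * Real.exp (-s * ‖(2 * Real.pi) • latticePt m‖ ^ 4)

/-- The bilaplacian semigroup: `η_s * φ` for `s > 0`, and `φ` for `s = 0`. -/
def heatSemigroup (s : ℝ≥0) (φ : Torus d → ℝ) (x : Torus d) : ℝ :=
  if s = 0 then φ x else ∫ y, heatKernel (s : ℝ) (x - y) * φ y ∂torusMeasure d

/-- The stochastic convolution `X_r(φ) = ∫_{[0,r] × 𝕋^d} (η_{r-q} * φ)(x) ξ(dq, dx)`. -/
def stochConv {Ω : Type*} (ξ : (ℝ≥0 × Torus d → ℝ) → Ω → ℝ) (r : ℝ≥0) (φ : Torus d → ℝ) :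
    Ω → ℝ :=
  ξ ((Set.Icc 0 r ×ˢ Set.univ).indicator fun p => heatSemigroup (r - p.1) φ p.2)

/-- The mollification `ζ_ε * f`, where `ζ_ε(x) = ∑_{q ∈ ℤ^d} ζ(εq) cos(2π⟨x, q⟩)`, as a
distribution. -/
def mollify (ζ : EuclideanSpace ℝ (Fin d) → ℝ) (ε : ℝ) (f : Dist d) : Dist d :=
  ofContinuous ⟨convolve (cosSeries fun x => ζ (ε • x)) f, continuous_convolve_cosSeries _ f⟩

end CahnHilliard

end

noncomputable section

namespace CahnHilliard

/-! ### Dyadic chaining for real processes -/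

/-! The stochastic convolution is diagonal in the Fourier basis: its modes `X_r(cos_m)` and
`X_r(sin_m)` are Gaussian, with memory `exp(-(r-q)|2πm|⁴)`. Take a combination of modes with
coefficients `u`, `v` whose eigenvalues `|2πm|⁴` are at least `2^{4j}`. Its increment over `[s, t]`,
with `t ≤ s + 1`, has variance at most `2 ∑ (u² + v²) · min(t - s, 2^{-4j})`
(`sqNorm_trigKernel_sub_le`). The `j`-th Littlewood-Paley block at a fixed point involves
`O(2^{dj})` bounded coefficients, so its variance is of order `2^{(d-4)j}` and its size of order
`2^{-(2-d/2)j}`. This is the threshold for `θ`.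

What remains is to make this estimate uniform in time and space. Gaussian moments of order `2n` are
multiples of the `n`-th power of the variance, and `min(δ, 2^{-4j})^n ≤ δ³ 2^{-4j(n-3)}`. The factor
`δ³` pays for a dyadic chaining in time (`lintegral_chainSum_le`, `enorm_pow_le_chainSum`). The
supremum over the torus is replaced by a sum over a grid, the error being controlled by the
Lipschitz constants of the characters (`enorm_trigSum_pow_le`). Both operations lose powers of `2^j`
that do not grow with `n`, so for large `n` the gap `2 - d/2 - θ` absorbs them (`exists_exponent`).

The outcome is `IsModeFamily.exists_besov_bound`: for a Fourier multiplier `a` with `|a| ≤ b_j` on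
the frequencies of block `j`, the `N`-th power of the Besov norm, uniformly on bounded time
intervals, is dominated by a random variable of mean at most a constant times `∑_j b_j^N 2^{-j}`. It
is used twice. With `a` the indicator of the high frequencies, it shows that almost surely the
truncated Fourier series converge in Besov norm, uniformly on bounded time intervals
(`IsModeFamily.ae_isGood`). The limit inherits from trigonometric polynomials the membership in
`𝒞^θ`, the continuity in time and the Borel measurability. With `a = ζ(ε ·) - 1`, Markov's
inequality and dominated convergence in `j` give the convergence of the mollifications.

The limit is the stochastic convolution because the truncations also converge to it in `L²`
(`IsSpaceTimeWhiteNoise.tsum_eq_stochConv`). On the exceptional null set the process is set to zero,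
which does not affect adaptedness, since the `σ`-algebras contain all null sets. -/

/-- The sum over all dyadic levels of the `p`-th powers of the increments of `y` on `[0, U]`. -/
def chainSum (p U : ℕ) (y : ℝ≥0 → ℝ) : ℝ≥0∞ :=
  ∑' n : ℕ, 2 ^ n * ∑ k ∈ Finset.range (U * 2 ^ n),
    ‖y ((k + 1 : ℕ) / 2 ^ n) - y ((k : ℕ) / 2 ^ n)‖ₑ ^ p

/-- The value of `y` at the largest dyadic point of level `n` which is at most `t`. -/
def dyadicApprox (y : ℝ≥0 → ℝ) (n : ℕ) (t : ℝ≥0) : ℝ := y ((⌊t * 2 ^ n⌋₊ : ℕ) / 2 ^ n)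

/-- The ratio of the geometric series in the chaining bound. -/
def chainRatio (p : ℕ) : ℝ := (1 / 2 : ℝ) ^ (1 / (p : ℝ))

theorem chainRatio_pos (p : ℕ) : 0 < chainRatio p := Real.rpow_pos_of_pos (by norm_num) _

theorem chainRatio_lt_one {p : ℕ} (hp : p ≠ 0) : chainRatio p < 1 :=
  Real.rpow_lt_one (by norm_num) (by norm_num) (by positivity)

theorem chainRatio_pow {p : ℕ} (hp : p ≠ 0) : chainRatio p ^ p = 1 / 2 := by
  rw [chainRatio, one_div (p : ℝ), Real.rpow_inv_natCast_pow (by norm_num) hp]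

/-- Each term of the sum is at most the whole sum. The weight `2^n` at level `n` therefore bounds
the `p`-th power of an increment by `2^{-n}` times the sum, and the `p`-th root decays geometrically
with ratio `2^{-1/p}`. -/
theorem abs_increment_le {p U : ℕ} (hp : p ≠ 0) {y : ℝ≥0 → ℝ} (h : chainSum p U y ≠ ∞)
    {n k : ℕ} (hk : k < U * 2 ^ n) :
    |y ((k + 1 : ℕ) / 2 ^ n) - y ((k : ℕ) / 2 ^ n)|
      ≤ (chainSum p U y).toReal ^ (1 / (p : ℝ)) * chainRatio p ^ n := by
  have h1 : 2 ^ n * ‖y ((k + 1 : ℕ) / 2 ^ n) - y ((k : ℕ) / 2 ^ n)‖ₑ ^ p ≤ chainSum p U y := by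
    refine le_trans ?_ (ENNReal.le_tsum n)
    refine mul_le_mul_right ?_ _
    exact Finset.single_le_sum (f := fun k : ℕ =>
      ‖y ((k + 1 : ℕ) / 2 ^ n) - y ((k : ℕ) / 2 ^ n)‖ₑ ^ p) (fun _ _ => zero_le) (Finset.mem_range.2 hk)
  have h2 := ENNReal.toReal_mono h h1
  rw [ENNReal.toReal_mul, ENNReal.toReal_pow, ENNReal.toReal_pow, toReal_enorm,
    Real.norm_eq_abs] at h2
  simp only [ENNReal.toReal_ofNat] at h2
  refine le_of_pow_le_pow_left₀ hp (mul_nonneg (by positivity) (pow_pos (chainRatio_pos p) n).le) ?_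
  rw [mul_pow, ← pow_mul, mul_comm n p, pow_mul, chainRatio_pow hp, one_div (p : ℝ),
    Real.rpow_inv_natCast_pow ENNReal.toReal_nonneg hp, one_div, inv_pow, ← div_eq_mul_inv,
    le_div_iff₀ (by positivity), mul_comm]
  exact h2

/-- Refining the mesh either keeps the dyadic point below `t` or moves it one step of level `n + 1`
to the right, so consecutive approximations differ by at most one increment. -/
theorem dyadicApprox_succ_sub_le {p U : ℕ} (hp : p ≠ 0) {y : ℝ≥0 → ℝ} (h : chainSum p U y ≠ ∞)
    (n : ℕ) {t : ℝ≥0} (ht : t ≤ U) :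
    dist (dyadicApprox y n t) (dyadicApprox y (n + 1) t)
      ≤ (chainSum p U y).toReal ^ (1 / (p : ℝ)) * chainRatio p ^ n := by
  set r := (chainSum p U y).toReal ^ (1 / (p : ℝ))
  have hr : 0 ≤ r := by positivity
  have hq := (chainRatio_pos p).le
  set k := ⌊t * 2 ^ n⌋₊ with hk
  have hk1 : (k : ℝ≥0) ≤ t * 2 ^ n := Nat.floor_le zero_le
  have hk2 : t * 2 ^ n < k + 1 := Nat.lt_floor_add_one _
  have hkk : ((k : ℕ) : ℝ≥0) / 2 ^ n = ((2 * k : ℕ) : ℝ≥0) / 2 ^ (n + 1) := by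
    push_cast; rw [pow_succ]; field_simp
  have hcase : ⌊t * 2 ^ (n + 1)⌋₊ = 2 * k ∨ ⌊t * 2 ^ (n + 1)⌋₊ = 2 * k + 1 := by
    have a1 : 2 * k ≤ ⌊t * 2 ^ (n + 1)⌋₊ := by
      apply Nat.le_floor
      push_cast
      calc (2 : ℝ≥0) * k ≤ 2 * (t * 2 ^ n) := by gcongr
        _ = t * 2 ^ (n + 1) := by ring
    have a2 : ⌊t * 2 ^ (n + 1)⌋₊ < 2 * k + 2 := by
      rw [Nat.floor_lt zero_le]
      push_cast
      calc t * 2 ^ (n + 1) = 2 * (t * 2 ^ n) := by ring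
        _ < 2 * (k + 1) := by gcongr
        _ = _ := by ring
    omega
  rcases hcase with hc | hc
  · rw [dyadicApprox, dyadicApprox, hc, ← hk, hkk, dist_self]
    positivity
  · rw [dyadicApprox, dyadicApprox, hc, ← hk, hkk, dist_comm, Real.dist_eq]
    refine (abs_increment_le hp h (n := n + 1) (k := 2 * k) ?_).trans ?_
    · have : ((2 * k + 1 : ℕ) : ℝ≥0) ≤ t * 2 ^ (n + 1) := by
        rw [← hc]; exact Nat.floor_le zero_le
      have h3 : ((2 * k + 1 : ℕ) : ℝ≥0) ≤ ((U * 2 ^ (n + 1) : ℕ) : ℝ≥0) := by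
        refine this.trans ?_
        push_cast
        gcongr
      have := Nat.cast_le.1 h3
      omega
    · exact mul_le_mul_of_nonneg_left
        (pow_le_pow_of_le_one hq (chainRatio_lt_one hp).le n.le_succ) hr

/-- The integer part of `t` is reached from `0` in at most `U` unit steps, each an increment of
level `0`. -/
theorem dyadicApprox_zero_sub_le {p U : ℕ} (hp : p ≠ 0) {y : ℝ≥0 → ℝ} (h : chainSum p U y ≠ ∞)
    {t : ℝ≥0} (ht : t ≤ U) :
    |dyadicApprox y 0 t - y 0| ≤ U * (chainSum p U y).toReal ^ (1 / (p : ℝ)) := by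
  have key : ∀ k : ℕ, k ≤ U →
      |y (k : ℕ) - y 0| ≤ k * (chainSum p U y).toReal ^ (1 / (p : ℝ)) := by
    intro k
    induction k with
    | zero => intro _; simp
    | succ k ih =>
      intro hk
      have h1 := abs_increment_le hp h (n := 0) (k := k) (by simpa using hk)
      simp only [pow_zero, div_one, mul_one] at h1
      have h2 := ih (by omega)
      calc |y (k + 1 : ℕ) - y 0| ≤ |y (k + 1 : ℕ) - y (k : ℕ)| + |y (k : ℕ) - y 0| :=
            abs_sub_le _ _ _
        _ ≤ _ := add_le_add h1 h2
        _ = _ := by push_cast; ring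
  have hf : ⌊t * 2 ^ 0⌋₊ ≤ U := by
    rw [pow_zero, mul_one]
    exact Nat.floor_le_of_le ht
  have := key _ hf
  rw [dyadicApprox]
  simp only [pow_zero, div_one] at this ⊢
  refine this.trans ?_
  gcongr
  simpa using hf

/-- Times at distance at most one mesh size have equal or adjacent dyadic floors. -/
theorem dyadicApprox_sub_le {p U : ℕ} (hp : p ≠ 0) {y : ℝ≥0 → ℝ} (h : chainSum p U y ≠ ∞)
    (n : ℕ) {s t : ℝ≥0} (hst : s ≤ t) (hts : t ≤ s + 1 / 2 ^ n) (ht : t ≤ U) :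
    |dyadicApprox y n t - dyadicApprox y n s|
      ≤ (chainSum p U y).toReal ^ (1 / (p : ℝ)) * chainRatio p ^ n := by
  have hcase : ⌊t * 2 ^ n⌋₊ = ⌊s * 2 ^ n⌋₊ ∨ ⌊t * 2 ^ n⌋₊ = ⌊s * 2 ^ n⌋₊ + 1 := by
    have a1 : ⌊s * 2 ^ n⌋₊ ≤ ⌊t * 2 ^ n⌋₊ := Nat.floor_le_floor (by gcongr)
    have a2 : ⌊t * 2 ^ n⌋₊ < ⌊s * 2 ^ n⌋₊ + 2 := by
      rw [Nat.floor_lt zero_le]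
      push_cast
      calc t * 2 ^ n ≤ (s + 1 / 2 ^ n) * 2 ^ n := by gcongr
        _ = s * 2 ^ n + 1 := by field_simp
        _ < ⌊s * 2 ^ n⌋₊ + 1 + 1 := by gcongr; exact Nat.lt_floor_add_one _
        _ = _ := by ring
    omega
  rcases hcase with hc | hc
  · rw [dyadicApprox, dyadicApprox, hc, sub_self, abs_zero]
    have := (chainRatio_pos p).le
    positivity
  · rw [dyadicApprox, dyadicApprox, hc]
    refine abs_increment_le hp h ?_
    have : ((⌊s * 2 ^ n⌋₊ + 1 : ℕ) : ℝ≥0) ≤ t * 2 ^ n := by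
      rw [← hc]; exact Nat.floor_le zero_le
    have h3 : ((⌊s * 2 ^ n⌋₊ + 1 : ℕ) : ℝ≥0) ≤ ((U * 2 ^ n : ℕ) : ℝ≥0) := by
      refine this.trans ?_
      push_cast
      gcongr
    exact Nat.cast_le.1 h3

theorem tendsto_dyadic_floor (t : ℝ≥0) :
    Tendsto (fun n : ℕ => ((⌊t * 2 ^ n⌋₊ : ℕ) : ℝ≥0) / 2 ^ n) atTop (𝓝 t) := by
  have h1 : Tendsto (fun n : ℕ => t - (1 / 2 : ℝ≥0) ^ n) atTop (𝓝 t) := by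
    have : Tendsto (fun n : ℕ => (1 / 2 : ℝ≥0) ^ n) atTop (𝓝 0) :=
      NNReal.tendsto_pow_atTop_nhds_zero_of_lt_one (by rw [← NNReal.coe_lt_coe]; norm_num)
    simpa using tendsto_const_nhds.sub this
  refine tendsto_of_tendsto_of_tendsto_of_le_of_le h1 tendsto_const_nhds (fun n => ?_) fun n => ?_
  · change t - (1 / 2 : ℝ≥0) ^ n ≤ _
    rw [tsub_le_iff_right, one_div, inv_pow, ← one_div, ← add_div, le_div_iff₀ (by positivity)]
    exact (Nat.lt_floor_add_one _).le
  · change _ / _ ≤ t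
    rw [div_le_iff₀ (by positivity)]
    exact Nat.floor_le zero_le

theorem exists_tendsto_dyadicApprox {p U : ℕ} (hp : p ≠ 0) {y : ℝ≥0 → ℝ}
    (h : chainSum p U y ≠ ∞) {t : ℝ≥0} (ht : t ≤ U) :
    ∃ l, Tendsto (fun n => dyadicApprox y n t) atTop (𝓝 l) :=
  cauchySeq_tendsto_of_complete
    (cauchySeq_of_le_geometric _ _ (chainRatio_lt_one hp)
      fun n => dyadicApprox_succ_sub_le hp h n ht)

theorem continuous_of_tendsto_dyadicApprox {p : ℕ} (hp : p ≠ 0) {y l : ℝ≥0 → ℝ}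
    (h : ∀ U, chainSum p U y ≠ ∞)
    (hl : ∀ t, Tendsto (fun n => dyadicApprox y n t) atTop (𝓝 (l t))) : Continuous l := by
  rw [Metric.continuous_iff]
  intro b ε hε
  -- The margin `1` keeps every point within distance `2^{-n} ≤ 1` of `b` inside `[0, U]`.
  obtain ⟨U, hU⟩ := exists_nat_gt (b + 1)
  set r := (chainSum p U y).toReal ^ (1 / (p : ℝ))
  set q := chainRatio p
  have hq0 : 0 < q := chainRatio_pos p
  have hq1 : q < 1 := chainRatio_lt_one hp
  have hr : 0 ≤ r := by positivity
  -- Two geometric tails, one for each endpoint, plus a single increment of level `n`.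
  have hlim : Tendsto (fun n : ℕ => (2 * r / (1 - q) + r) * q ^ n) atTop (𝓝 0) := by
    simpa using (tendsto_pow_atTop_nhds_zero_of_lt_one hq0.le hq1).const_mul (2 * r / (1 - q) + r)
  obtain ⟨n, hn⟩ := (hlim.eventually_lt_const hε).exists
  have app : ∀ t : ℝ≥0, t ≤ U → |dyadicApprox y n t - l t| ≤ r * q ^ n / (1 - q) := fun t ht =>
    dist_le_of_le_geometric_of_tendsto q r hq1
      (fun n => dyadicApprox_succ_sub_le hp (h U) n ht) (hl t) n
  have main : ∀ s t : ℝ≥0, s ≤ t → t ≤ s + 1 / 2 ^ n → t ≤ U → |l t - l s| < ε := by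
    intro s t hst hts ht
    have h1 := app t ht
    have h2 := app s (hst.trans ht)
    have h3 := dyadicApprox_sub_le hp (h U) n hst hts ht
    have h4 : |l t - l s| ≤ |dyadicApprox y n t - l t| + |dyadicApprox y n t - dyadicApprox y n s|
        + |dyadicApprox y n s - l s| := by
      rw [abs_sub_comm (dyadicApprox y n t) (l t)]
      exact (abs_sub_le _ (dyadicApprox y n s) _).trans
        (add_le_add_left (abs_sub_le _ _ _) _)
    refine lt_of_le_of_lt h4 (lt_of_le_of_lt (add_le_add (add_le_add h1 h3) h2) ?_)
    convert hn using 1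
    field_simp
    ring
  refine ⟨1 / 2 ^ n, by positivity, fun a hab => ?_⟩
  have hpow : (1 : ℝ) / 2 ^ n ≤ 1 := by
    rw [div_le_one (by positivity)]; exact one_le_pow₀ (by norm_num)
  rw [NNReal.dist_eq] at hab
  have hab' := abs_lt.1 hab
  have hUr : (b : ℝ) + 1 < U := by exact_mod_cast hU
  rw [Real.dist_eq]
  rcases le_total a b with hle | hle
  · rw [abs_sub_comm]
    refine main a b hle ?_ ?_
    · rw [← NNReal.coe_le_coe]; push_cast; linarith
    · rw [← NNReal.coe_le_coe]; push_cast; linarith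
  · refine main b a hle ?_ ?_
    · rw [← NNReal.coe_le_coe]; push_cast; linarith
    · rw [← NNReal.coe_le_coe]; push_cast; linarith

/-- The constant of the chaining bound. -/
def chainConst (p U : ℕ) : ℝ≥0 := (((U : ℝ) + 1 / (1 - chainRatio p)) ^ p).toNNReal

/-- A pathwise maximal inequality: the right side does not depend on `t`, so its expectation
controls the supremum over time without any question of measurability of that supremum. Continuity
is what makes the dyadic approximations converge to `y t` itself. -/
theorem enorm_pow_le_chainSum {p U : ℕ} (hp : p ≠ 0) {y : ℝ≥0 → ℝ} (hy : Continuous y)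
    (hy0 : y 0 = 0) {t : ℝ≥0} (ht : t ≤ U) :
    ‖y t‖ₑ ^ p ≤ chainConst p U * chainSum p U y := by
  have hq1 : 0 < 1 - chainRatio p := sub_pos.2 (chainRatio_lt_one hp)
  have hc : 0 < ((U : ℝ) + 1 / (1 - chainRatio p)) ^ p := by positivity
  -- An infinite sum makes the bound trivial only because the constant is nonzero; in `ℝ≥0∞` one has
  -- `0 * ∞ = 0`.
  by_cases h : chainSum p U y = ∞
  · rw [h, ENNReal.mul_top]
    · exact le_top
    · simpa [chainConst] using hc
  have hlim : Tendsto (fun n => dyadicApprox y n t) atTop (𝓝 (y t)) :=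
    (hy.tendsto t).comp (tendsto_dyadic_floor t)
  have h1 := dist_le_of_le_geometric_of_tendsto _ _ (chainRatio_lt_one hp)
      (fun n => dyadicApprox_succ_sub_le hp h n ht) hlim 0
  have h2 := dyadicApprox_zero_sub_le hp h ht
  rw [hy0, sub_zero] at h2
  rw [Real.dist_eq, pow_zero, mul_one] at h1
  set r := (chainSum p U y).toReal ^ (1 / (p : ℝ)) with hr
  have h3 : |y t| ≤ ((U : ℝ) + 1 / (1 - chainRatio p)) * r := by
    calc |y t| ≤ |dyadicApprox y 0 t| + |dyadicApprox y 0 t - y t| := by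
          have := abs_sub_abs_le_abs_sub (y t) (dyadicApprox y 0 t)
          rw [abs_sub_comm] at this
          linarith
      _ ≤ U * r + r / (1 - chainRatio p) := add_le_add h2 h1
      _ = _ := by ring
  have h4 : |y t| ^ p ≤ ((U : ℝ) + 1 / (1 - chainRatio p)) ^ p * (chainSum p U y).toReal := by
    calc |y t| ^ p ≤ (((U : ℝ) + 1 / (1 - chainRatio p)) * r) ^ p := by gcongr
      _ = _ := by
        rw [mul_pow, hr, one_div (p : ℝ), Real.rpow_inv_natCast_pow ENNReal.toReal_nonneg hp]
  rw [← ENNReal.toReal_le_toReal (by finiteness) (by finiteness), ENNReal.toReal_pow, toReal_enorm,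
    ENNReal.toReal_mul, Real.norm_eq_abs]
  rwa [ENNReal.coe_toReal, chainConst, Real.coe_toNNReal _ hc.le]

/-! ### Chaining in expectation and Kolmogorov's continuity criterion. -/

section Paths

variable {Ω : Type*} [MeasurableSpace Ω] {P : Measure Ω}

theorem measurable_chainSum {Y : ℝ≥0 → Ω → ℝ} (hY : ∀ t, Measurable (Y t)) (p U : ℕ) :
    Measurable fun ω => chainSum p U fun t => Y t ω := by
  unfold chainSum
  fun_prop (disch := assumption)

/-- The cube is used up as follows: one factor `2^{-n}` cancels the weight, one cancels the number
`U 2^n` of increments, and the third makes the series over the levels converge. -/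
theorem lintegral_chainSum_le {Y : ℝ≥0 → Ω → ℝ} (hY : ∀ t, Measurable (Y t)) {p : ℕ}
    {A : ℝ≥0∞} (hA : ∀ s t : ℝ≥0, s ≤ t → t ≤ s + 1 →
      ∫⁻ ω, ‖Y t ω - Y s ω‖ₑ ^ p ∂P ≤ A * ((t - s : ℝ≥0) : ℝ≥0∞) ^ 3) (U : ℕ) :
    ∫⁻ ω, chainSum p U (fun t => Y t ω) ∂P ≤ 2 * U * A := by
  unfold chainSum
  rw [lintegral_tsum (fun n => by fun_prop (disch := assumption))]
  calc _ ≤ ∑' n : ℕ, U * A * 2⁻¹ ^ n := by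
        refine ENNReal.tsum_le_tsum fun n => ?_
        rw [lintegral_const_mul _ (by fun_prop (disch := assumption)), lintegral_finsetSum _ (fun k _ => by fun_prop (disch := assumption))]
        have hk : ∀ k ∈ Finset.range (U * 2 ^ n),
            ∫⁻ ω, ‖Y ((k + 1 : ℕ) / 2 ^ n) ω - Y ((k : ℕ) / 2 ^ n) ω‖ₑ ^ p ∂P
              ≤ A * (2⁻¹ ^ n) ^ 3 := by
          intro k _
          have e : (((k + 1 : ℕ) : ℝ≥0) / 2 ^ n) = (k : ℕ) / 2 ^ n + 2⁻¹ ^ n := by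
            push_cast; rw [add_div, inv_pow, one_div]
          refine (hA _ _ ?_ ?_).trans ?_
          · rw [e]; exact le_self_add
          · rw [e]
            gcongr
            exact pow_le_one₀ zero_le (by rw [← NNReal.coe_le_coe]; norm_num)
          · rw [e, add_tsub_cancel_left, ENNReal.coe_pow,
              ENNReal.coe_inv two_ne_zero, ENNReal.coe_ofNat]
        refine (mul_le_mul_right (Finset.sum_le_sum hk) _).trans ?_
        rw [Finset.sum_const, Finset.card_range, nsmul_eq_mul]
        have h2 : (2 : ℝ≥0∞) ^ n * 2⁻¹ ^ n = 1 := by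
          rw [← mul_pow, ENNReal.mul_inv_cancel (by simp) (by simp), one_pow]
        push_cast
        calc (2 : ℝ≥0∞) ^ n * (U * 2 ^ n * (A * (2⁻¹ ^ n) ^ 3))
            = (2 ^ n * 2⁻¹ ^ n) * (2 ^ n * 2⁻¹ ^ n) * (U * A * 2⁻¹ ^ n) := by ring
          _ ≤ _ := by rw [h2]; simp
    _ = 2 * U * A := by
        rw [ENNReal.tsum_mul_left, ENNReal.tsum_geometric, ENNReal.one_sub_inv_two, inv_inv]
        ring

/-- A sequence which converges almost everywhere to `Z` and in mean to `W` has `Z = W` a.e. -/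
theorem ae_eq_of_tendsto_of_lintegral_tendsto {Z : ℕ → Ω → ℝ} {V W : Ω → ℝ} {p : ℕ} (hp : p ≠ 0)
    (hZ : ∀ n, AEMeasurable (Z n) P) (hW : AEMeasurable W P)
    (hlim : ∀ᵐ ω ∂P, Tendsto (fun n => Z n ω) atTop (𝓝 (V ω)))
    (hmean : Tendsto (fun n => ∫⁻ ω, ‖Z n ω - W ω‖ₑ ^ p ∂P) atTop (𝓝 0)) : V =ᵐ[P] W := by
  -- Fatou's lemma: the pointwise limit of the integrands has integral zero.
  have h1 : ∫⁻ ω, liminf (fun n => ‖Z n ω - W ω‖ₑ ^ p) atTop ∂P = 0 := by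
    refine le_antisymm ((lintegral_liminf_le' fun n => ?_).trans hmean.liminf_eq.le) zero_le
    exact (((hZ n).sub hW).enorm).pow_const p
  have h2 : ∫⁻ ω, ‖V ω - W ω‖ₑ ^ p ∂P = 0 := by
    rw [← h1]
    refine lintegral_congr_ae ?_
    filter_upwards [hlim] with ω hω
    have h3 : Tendsto (fun n => ‖Z n ω - W ω‖ₑ ^ p) atTop (𝓝 (‖V ω - W ω‖ₑ ^ p)) :=
      ((ENNReal.continuous_pow p).tendsto _).comp (hω.sub_const (W ω)).enorm
    exact h3.liminf_eq.symm
  have hV : AEMeasurable V P := aemeasurable_of_tendsto_metrizable_ae atTop hZ hlim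
  filter_upwards [(lintegral_eq_zero_iff' (((hV.sub hW).enorm).pow_const p)).1 h2] with ω hω
  simpa [hp, sub_eq_zero] using hω

/-- The expected chain sums are finite, so almost every path has a continuous limit along dyadic
floors. That limit agrees almost surely with `Y t`, because the values at the dyadic floors of `t`
also converge to `Y t` in the `p`-th mean. Measurability of the modification is not claimed here; it
will come from completeness of `P`. -/
theorem exists_continuous_modification {Y : ℝ≥0 → Ω → ℝ} (hY : ∀ t, Measurable (Y t)) {p : ℕ}
    (hp : p ≠ 0) {A : ℝ≥0∞} (hAtop : A ≠ ∞) (hA : ∀ s t : ℝ≥0, s ≤ t → t ≤ s + 1 →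
      ∫⁻ ω, ‖Y t ω - Y s ω‖ₑ ^ p ∂P ≤ A * ((t - s : ℝ≥0) : ℝ≥0∞) ^ 3) :
    ∃ L : ℝ≥0 → Ω → ℝ, (∀ ω, Continuous fun t => L t ω) ∧ ∀ t, L t =ᵐ[P] Y t := by
  classical
  have hfin : ∀ᵐ ω ∂P, ∀ U, chainSum p U (fun t => Y t ω) ≠ ∞ := by
    rw [ae_all_iff]
    intro U
    have h := ae_lt_top (μ := P) (measurable_chainSum hY p U)
      (ne_top_of_le_ne_top (by finiteness) (lintegral_chainSum_le hY hA U))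
    filter_upwards [h] with ω hω using hω.ne
  have hex : ∀ ω, (∀ U, chainSum p U (fun t => Y t ω) ≠ ∞) → ∀ t, ∃ l,
      Tendsto (fun n => dyadicApprox (fun t => Y t ω) n t) atTop (𝓝 l) := by
    intro ω h t
    obtain ⟨U, hU⟩ := exists_nat_ge t
    exact exists_tendsto_dyadicApprox hp (h U) hU
  choose! l hl using hex
  refine ⟨fun t ω => if ∀ U, chainSum p U (fun t => Y t ω) ≠ ∞ then l ω t else 0, fun ω => ?_,
    fun t => ?_⟩
  · by_cases h : ∀ U, chainSum p U (fun t => Y t ω) ≠ ∞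
    · simp only [if_pos h]
      exact continuous_of_tendsto_dyadicApprox hp h (hl ω h)
    · simp only [if_neg h]
      exact continuous_const
  · refine ae_eq_of_tendsto_of_lintegral_tendsto hp
      (Z := fun n ω => Y ((⌊t * 2 ^ n⌋₊ : ℕ) / 2 ^ n) ω) (fun n => (hY _).aemeasurable)
      (hY t).aemeasurable ?_ ?_
    · filter_upwards [hfin] with ω hω
      rw [if_pos hω]
      exact hl ω hω t
    · have hfl : ∀ n : ℕ, ((⌊t * 2 ^ n⌋₊ : ℕ) : ℝ≥0) / 2 ^ n ≤ t := fun n => by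
        rw [div_le_iff₀ (by positivity)]
        exact Nat.floor_le zero_le
      have hfu : ∀ n : ℕ, t ≤ ((⌊t * 2 ^ n⌋₊ : ℕ) : ℝ≥0) / 2 ^ n + 1 := fun n => by
        have h1 : t ≤ ((⌊t * 2 ^ n⌋₊ : ℕ) + 1 : ℝ≥0) / 2 ^ n := by
          rw [le_div_iff₀ (by positivity)]
          exact (Nat.lt_floor_add_one _).le
        refine h1.trans ?_
        rw [add_div]
        gcongr
        rw [div_le_one (by positivity)]
        exact one_le_pow₀ (by rw [← NNReal.coe_le_coe]; norm_num)
      have hz : Tendsto (fun n : ℕ => A * ((t - ((⌊t * 2 ^ n⌋₊ : ℕ) : ℝ≥0) / 2 ^ n : ℝ≥0) : ℝ≥0∞) ^ 3)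
          atTop (𝓝 0) := by
        have h0 : Tendsto (fun n : ℕ => ((t - ((⌊t * 2 ^ n⌋₊ : ℕ) : ℝ≥0) / 2 ^ n : ℝ≥0) : ℝ≥0∞))
            atTop (𝓝 0) := by
          rw [← ENNReal.coe_zero, ENNReal.tendsto_coe]
          simpa using (tendsto_const_nhds (x := t)).sub (tendsto_dyadic_floor t)
        have := ENNReal.Tendsto.const_mul (a := A)
          (((ENNReal.continuous_pow 3).tendsto 0).comp h0) (Or.inr hAtop)
        simpa using this
      refine tendsto_of_tendsto_of_tendsto_of_le_of_le tendsto_const_nhds hz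
        (fun _ => zero_le) fun n => ?_
      refine le_trans (le_of_eq (lintegral_congr fun ω => ?_)) (hA _ _ (hfl n) (hfu n))
      rw [← enorm_neg, neg_sub]

end Paths

variable {d : ℕ}

/-! ### Trigonometric integrals on the torus -/

instance : (torusMeasure d).IsAddRightInvariant := by unfold torusMeasure; infer_instance

theorem integral_mFourier (m : Fin d → ℤ) :
    ∫ x, UnitAddTorus.mFourier m x ∂torusMeasure d = if m = 0 then 1 else 0 := by
  have h1 : ∀ n : ℤ, ∫ x : UnitAddCircle, fourier n x ∂AddCircle.haarAddCircle
      = if n = 0 then (1 : ℂ) else 0 := by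
    intro n
    split_ifs with h
    · simp [h]
    · exact integral_eq_zero_of_add_right_eq_neg (fourier_add_half_inv_index h one_pos)
  have h2 : ∫ x, UnitAddTorus.mFourier m x ∂torusMeasure d
      = ∏ i, ∫ x : UnitAddCircle, fourier (m i) x ∂AddCircle.haarAddCircle := by
    unfold torusMeasure
    exact integral_fintype_prod_eq_prod (fun i (x : UnitAddCircle) => (fourier (m i) x : ℂ))
  rw [h2]
  simp only [h1]
  split_ifs with h
  · simp [h]
  · obtain ⟨i, hi⟩ := Function.ne_iff.1 h
    exact Finset.prod_eq_zero (Finset.mem_univ i) (if_neg hi)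

theorem integrable_continuous {E : Type*} [NormedAddCommGroup E] {f : Torus d → E}
    (hf : Continuous f) : Integrable f (torusMeasure d) :=
  hf.integrable_of_hasCompactSupport (HasCompactSupport.of_compactSpace _)

theorem continuous_cosChar (m : Fin d → ℤ) : Continuous (cosChar m) :=
  testFun_continuous (cosTest m)

theorem continuous_sinChar (m : Fin d → ℤ) : Continuous (sinChar m) :=
  testFun_continuous (sinTest m)

theorem norm_mFourier_apply (m : Fin d → ℤ) (x : Torus d) : ‖UnitAddTorus.mFourier m x‖ = 1 := by
  simp only [UnitAddTorus.mFourier, ContinuousMap.coe_mk, fourier_apply, norm_prod,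
    Circle.norm_coe, Finset.prod_const_one]

theorem abs_cosChar_le_one (m : Fin d → ℤ) (x : Torus d) : |cosChar m x| ≤ 1 :=
  (Complex.abs_re_le_norm _).trans (norm_mFourier_apply m x).le

theorem abs_sinChar_le_one (m : Fin d → ℤ) (x : Torus d) : |sinChar m x| ≤ 1 :=
  (Complex.abs_im_le_norm _).trans (norm_mFourier_apply m x).le

theorem cosChar_sq_add_sinChar_sq (m : Fin d → ℤ) (x : Torus d) :
    cosChar m x ^ 2 + sinChar m x ^ 2 = 1 := by
  obtain ⟨y, rfl⟩ := torusMk_surjective x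
  rw [cosChar_torusMk, sinChar_torusMk, Real.cos_sq_add_sin_sq]

theorem cosChar_neg (m : Fin d → ℤ) : cosChar (-m) = cosChar m := by
  funext x; simp [cosChar, UnitAddTorus.mFourier_neg]

theorem sinChar_neg (m : Fin d → ℤ) : sinChar (-m) = -sinChar m := by
  funext x; simp [sinChar, UnitAddTorus.mFourier_neg]

theorem integral_cosChar (m : Fin d → ℤ) :
    ∫ x, cosChar m x ∂torusMeasure d = if m = 0 then 1 else 0 := by
  have := integral_re (integrable_continuous (UnitAddTorus.mFourier m).continuous)
  rw [integral_mFourier] at this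
  simp only [RCLike.re_eq_complex_re] at this
  simp only [cosChar, this]
  split_ifs <;> simp

theorem integral_sinChar (m : Fin d → ℤ) : ∫ x, sinChar m x ∂torusMeasure d = 0 := by
  have := integral_im (integrable_continuous (UnitAddTorus.mFourier m).continuous)
  rw [integral_mFourier] at this
  simp only [RCLike.im_eq_complex_im] at this
  simp only [sinChar, this]
  split_ifs <;> simp

theorem cosChar_add (m n : Fin d → ℤ) (x : Torus d) :
    cosChar (m + n) x = cosChar m x * cosChar n x - sinChar m x * sinChar n x := by
  simp [cosChar, sinChar, UnitAddTorus.mFourier_add]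

theorem sinChar_add (m n : Fin d → ℤ) (x : Torus d) :
    sinChar (m + n) x = cosChar m x * sinChar n x + sinChar m x * cosChar n x := by
  simp [cosChar, sinChar, UnitAddTorus.mFourier_add]

theorem cosChar_sub (m n : Fin d → ℤ) (x : Torus d) :
    cosChar (m - n) x = cosChar m x * cosChar n x + sinChar m x * sinChar n x := by
  rw [sub_eq_add_neg, cosChar_add, cosChar_neg, sinChar_neg, Pi.neg_apply]; ring

theorem sinChar_sub (m n : Fin d → ℤ) (x : Torus d) :
    sinChar (m - n) x = sinChar m x * cosChar n x - cosChar m x * sinChar n x := by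
  rw [sub_eq_add_neg, sinChar_add, cosChar_neg, sinChar_neg, Pi.neg_apply]; ring

/-- `δ_{m,n}` as a real number. -/
def delta (m n : Fin d → ℤ) : ℝ := if m = n then 1 else 0

theorem integral_cosChar_mul_cosChar (m n : Fin d → ℤ) :
    ∫ x, cosChar m x * cosChar n x ∂torusMeasure d = (delta m n + delta m (-n)) / 2 := by
  have h : ∀ x : Torus d, cosChar m x * cosChar n x = (cosChar (m - n) x + cosChar (m + n) x) / 2 :=
    fun x => by rw [cosChar_add, cosChar_sub]; ring
  simp only [h]
  rw [integral_div, integral_add (integrable_continuous (continuous_cosChar _))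
    (integrable_continuous (continuous_cosChar _)), integral_cosChar, integral_cosChar]
  simp [delta, sub_eq_zero, add_eq_zero_iff_eq_neg]

theorem integral_sinChar_mul_sinChar (m n : Fin d → ℤ) :
    ∫ x, sinChar m x * sinChar n x ∂torusMeasure d = (delta m n - delta m (-n)) / 2 := by
  have h : ∀ x : Torus d, sinChar m x * sinChar n x = (cosChar (m - n) x - cosChar (m + n) x) / 2 :=
    fun x => by rw [cosChar_add, cosChar_sub]; ring
  simp only [h]
  rw [integral_div, integral_sub (integrable_continuous (continuous_cosChar _))
    (integrable_continuous (continuous_cosChar _)), integral_cosChar, integral_cosChar]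
  simp [delta, sub_eq_zero, add_eq_zero_iff_eq_neg]

theorem integral_sinChar_mul_cosChar (m n : Fin d → ℤ) :
    ∫ x, sinChar m x * cosChar n x ∂torusMeasure d = 0 := by
  have h : ∀ x : Torus d, sinChar m x * cosChar n x = (sinChar (m + n) x + sinChar (m - n) x) / 2 :=
    fun x => by rw [sinChar_add, sinChar_sub]; ring
  simp only [h]
  rw [integral_div, integral_add (integrable_continuous (continuous_sinChar _))
    (integrable_continuous (continuous_sinChar _)), integral_sinChar, integral_sinChar]
  simp

theorem integral_cosChar_mul_sinChar (m n : Fin d → ℤ) :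
    ∫ x, cosChar m x * sinChar n x ∂torusMeasure d = 0 := by
  simp only [mul_comm (cosChar m _)]
  exact integral_sinChar_mul_cosChar n m

/-- A form of Bessel's inequality. The system is redundant, since `m` and `-m` give the same
functions up to sign. For `m ≠ 0` the squared norms are only `1/2`, and this exactly compensates the
repetition, so that the constant is `1`. -/
theorem integral_trigSum_sq_le (F : Finset (Fin d → ℤ)) (u v : (Fin d → ℤ) → ℝ) :
    ∫ x, (∑ m ∈ F, (u m * cosChar m x + v m * sinChar m x)) ^ 2 ∂torusMeasure d
      ≤ ∑ m ∈ F, (u m ^ 2 + v m ^ 2) := by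
  have hc : ∀ m n, Integrable (fun x : Torus d => cosChar m x * cosChar n x) (torusMeasure d) :=
    fun m n => integrable_continuous ((continuous_cosChar m).mul (continuous_cosChar n))
  have hs : ∀ m n, Integrable (fun x : Torus d => sinChar m x * sinChar n x) (torusMeasure d) :=
    fun m n => integrable_continuous ((continuous_sinChar m).mul (continuous_sinChar n))
  have hsc : ∀ m n, Integrable (fun x : Torus d => sinChar m x * cosChar n x) (torusMeasure d) :=
    fun m n => integrable_continuous ((continuous_sinChar m).mul (continuous_cosChar n))
  have hcs : ∀ m n, Integrable (fun x : Torus d => cosChar m x * sinChar n x) (torusMeasure d) :=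
    fun m n => integrable_continuous ((continuous_cosChar m).mul (continuous_sinChar n))
  have hprod : ∀ m n, ∫ x, (u m * cosChar m x + v m * sinChar m x)
      * (u n * cosChar n x + v n * sinChar n x) ∂torusMeasure d
      = (u m * u n * (delta m n + delta m (-n)) + v m * v n * (delta m n - delta m (-n))) / 2 := by
    intro m n
    have h : ∀ x : Torus d, (u m * cosChar m x + v m * sinChar m x)
      * (u n * cosChar n x + v n * sinChar n x) = u m * u n * (cosChar m x * cosChar n x)
        + v m * v n * (sinChar m x * sinChar n x) + (u m * v n * (cosChar m x * sinChar n x)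
        + v m * u n * (sinChar m x * cosChar n x)) := fun x => by ring
    simp only [h]
    rw [integral_add, integral_add, integral_add, integral_const_mul, integral_const_mul,
      integral_const_mul, integral_const_mul, integral_cosChar_mul_cosChar,
      integral_sinChar_mul_sinChar, integral_cosChar_mul_sinChar, integral_sinChar_mul_cosChar]
    · ring
    · exact (hcs m n).const_mul _
    · exact (hsc m n).const_mul _
    · exact (hc m n).const_mul _
    · exact (hs m n).const_mul _
    · exact ((hc m n).const_mul _).add ((hs m n).const_mul _)
    · exact ((hcs m n).const_mul _).add ((hsc m n).const_mul _)
  have hint : ∀ m n, Integrable (fun x : Torus d => (u m * cosChar m x + v m * sinChar m x)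
      * (u n * cosChar n x + v n * sinChar n x)) (torusMeasure d) := fun m n =>
    integrable_continuous
      (((continuous_const.mul (continuous_cosChar m)).add
        (continuous_const.mul (continuous_sinChar m))).mul
      ((continuous_const.mul (continuous_cosChar n)).add
        (continuous_const.mul (continuous_sinChar n))))
  simp only [sq (∑ m ∈ F, _), Finset.sum_mul_sum]
  rw [integral_finsetSum _ fun m _ => integrable_finsetSum _ fun n _ => hint m n]
  simp only [integral_finsetSum _ fun n _ => hint _ n, hprod]
  have hle : ∀ m n, (u m * u n * (delta m n + delta m (-n))
        + v m * v n * (delta m n - delta m (-n))) / 2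
      ≤ (u m ^ 2 + v m ^ 2) / 2 * delta m n
        + ((u m ^ 2 + v m ^ 2) / 4 + (u n ^ 2 + v n ^ 2) / 4) * delta m (-n) := by
    intro m n
    have h1 : (u m * u n + v m * v n) * delta m n = (u m ^ 2 + v m ^ 2) * delta m n := by
      unfold delta
      split_ifs with h
      · rw [h]; ring
      · simp
    have h2 : 0 ≤ delta m (-n) := by unfold delta; split_ifs <;> norm_num
    nlinarith [mul_nonneg (add_nonneg (sq_nonneg (u m - u n)) (sq_nonneg (v m + v n))) h2]
  refine (Finset.sum_le_sum fun m _ => Finset.sum_le_sum fun n _ => hle m n).trans ?_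
  have e1 : ∀ m ∈ F, ∑ n ∈ F, delta m n ≤ 1 := fun m hm => by
    simp [delta, hm]
  have e2 : ∀ m : Fin d → ℤ, ∑ n ∈ F, delta m (-n) ≤ 1 := fun m => by
    simp only [delta, ← neg_eq_iff_eq_neg]
    rw [Finset.sum_ite_eq]
    split_ifs <;> norm_num
  have e3 : ∀ n : Fin d → ℤ, ∑ m ∈ F, delta m (-n) ≤ 1 := fun m => by
    simp only [delta]
    rw [Finset.sum_ite_eq']
    split_ifs <;> norm_num
  have hN : ∀ m, 0 ≤ u m ^ 2 + v m ^ 2 := fun m => by positivity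
  calc _ = ∑ m ∈ F, ((u m ^ 2 + v m ^ 2) / 2 * ∑ n ∈ F, delta m n)
        + ∑ m ∈ F, ((u m ^ 2 + v m ^ 2) / 4 * ∑ n ∈ F, delta m (-n))
        + ∑ n ∈ F, ((u n ^ 2 + v n ^ 2) / 4 * ∑ m ∈ F, delta m (-n)) := by
        simp only [add_mul, Finset.sum_add_distrib, Finset.mul_sum]
        rw [Finset.sum_comm (s := F) (t := F)
          (f := fun x y => (u x ^ 2 + v x ^ 2) / 4 * delta y (-x))]
        ring
    _ ≤ ∑ m ∈ F, ((u m ^ 2 + v m ^ 2) / 2 * 1)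
        + ∑ m ∈ F, ((u m ^ 2 + v m ^ 2) / 4 * 1)
        + ∑ n ∈ F, ((u n ^ 2 + v n ^ 2) / 4 * 1) := by
        refine add_le_add (add_le_add ?_ ?_) ?_
        · exact Finset.sum_le_sum fun m hm =>
            mul_le_mul_of_nonneg_left (e1 m hm) (by have := hN m; positivity)
        · exact Finset.sum_le_sum fun m hm =>
            mul_le_mul_of_nonneg_left (e2 m) (by have := hN m; positivity)
        · exact Finset.sum_le_sum fun m hm =>
            mul_le_mul_of_nonneg_left (e3 m) (by have := hN m; positivity)
    _ = _ := by
        rw [← Finset.sum_add_distrib, ← Finset.sum_add_distrib]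
        exact Finset.sum_congr rfl fun m _ => by ring

/-! ### Fourier coefficients of test functions -/

/-- The point `t e_i` of the torus. -/
def axisPt (i : Fin d) (t : ℝ) : Torus d := torusMk (t • Pi.single i 1)

theorem mFourier_axisPt (m : Fin d → ℤ) (i : Fin d) (t : ℝ) :
    UnitAddTorus.mFourier m (axisPt i t) = Complex.exp ((2 * Real.pi * m i * Complex.I) * t) := by
  rw [axisPt, mFourier_torusMk]
  congr 1
  have : ∑ j, (t • Pi.single i (1 : ℝ) : Fin d → ℝ) j * (m j : ℝ) = t * m i := by
    rw [Finset.sum_eq_single i]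
    · simp
    · intro j _ hj; simp [hj]
    · simp
  rw [this]
  push_cast
  ring

theorem mFourier_apply_add (m : Fin d → ℤ) (x y : Torus d) :
    UnitAddTorus.mFourier m (x + y) = UnitAddTorus.mFourier m x * UnitAddTorus.mFourier m y := by
  simp only [UnitAddTorus.mFourier, ContinuousMap.coe_mk, ← Finset.prod_mul_distrib, Pi.add_apply,
    fourier_apply, smul_add, AddCircle.toCircle_add, Circle.coe_mul]

theorem hasDerivAt_periodicLift (φ : TestFun d) (i : Fin d) (y : Fin d → ℝ) (t : ℝ) :
    HasDerivAt (fun t : ℝ => (φ : Torus d → ℝ) (torusMk y + axisPt i t))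
      (fderiv ℝ (periodicLift (φ : Torus d → ℝ)) (y + t • Pi.single i 1) (Pi.single i 1)) t := by
  have h1 : HasFDerivAt (periodicLift (φ : Torus d → ℝ))
      (fderiv ℝ (periodicLift (φ : Torus d → ℝ)) (y + t • Pi.single i 1)) (y + t • Pi.single i 1) :=
    (((testFun_contDiff φ).differentiable (by simp)) _).hasFDerivAt
  have h2 : HasDerivAt (fun t : ℝ => y + t • (Pi.single i 1 : Fin d → ℝ)) (Pi.single i 1) t := by
    simpa using ((hasDerivAt_id t).smul_const (Pi.single i 1 : Fin d → ℝ)).const_add y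
  exact h1.comp_hasDerivAt t h2

/-- The partial derivative `∂_i φ` of a test function. -/
def partialDeriv (i : Fin d) (φ : TestFun d) : TestFun d :=
  ⟨fun x => deriv (fun t : ℝ => (φ : Torus d → ℝ) (x + axisPt i t)) 0, by
    change ContDiff ℝ (⊤ : ℕ∞) fun y : Fin d → ℝ =>
      deriv (fun t : ℝ => (φ : Torus d → ℝ) (torusMk y + axisPt i t)) 0
    simp only [(hasDerivAt_periodicLift φ i _ 0).deriv, zero_smul, add_zero]
    exact ((testFun_contDiff φ).fderiv_right (m := (⊤ : ℕ∞)) le_rfl).clm_apply contDiff_const⟩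

theorem periodicLift_partialDeriv (i : Fin d) (φ : TestFun d) (y : Fin d → ℝ) :
    periodicLift (partialDeriv i φ : Torus d → ℝ) y
      = fderiv ℝ (periodicLift (φ : Torus d → ℝ)) y (Pi.single i 1) := by
  change deriv (fun t : ℝ => (φ : Torus d → ℝ) (torusMk y + axisPt i t)) 0 = _
  rw [(hasDerivAt_periodicLift φ i _ 0).deriv, zero_smul, add_zero]

theorem hasDerivAt_add_axisPt (φ : TestFun d) (i : Fin d) (x : Torus d) (t : ℝ) :
    HasDerivAt (fun t : ℝ => (φ : Torus d → ℝ) (x + axisPt i t))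
      ((partialDeriv i φ : Torus d → ℝ) (x + axisPt i t)) t := by
  obtain ⟨y, rfl⟩ := torusMk_surjective x
  convert hasDerivAt_periodicLift φ i y t using 1
  exact periodicLift_partialDeriv i φ (y + t • Pi.single i 1)

theorem iteratedPartial_partialDeriv (i : Fin d) (k : ℕ) (φ : TestFun d) (y : Fin d → ℝ) :
    iteratedPartial k (fun _ => i) (partialDeriv i φ : Torus d → ℝ) y
      = iteratedPartial (k + 1) (fun _ => i) (φ : Torus d → ℝ) y := by
  have h : periodicLift (partialDeriv i φ : Torus d → ℝ)
      = (ContinuousLinearMap.apply ℝ ℝ (Pi.single i 1 : Fin d → ℝ)) ∘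
        (fun y => fderiv ℝ (periodicLift (φ : Torus d → ℝ)) y) :=
    funext fun y => periodicLift_partialDeriv i φ y
  have hd : ContDiffAt ℝ (⊤ : ℕ∞) (fun y => fderiv ℝ (periodicLift (φ : Torus d → ℝ)) y) y :=
    ((testFun_contDiff φ).fderiv_right (m := (⊤ : ℕ∞)) le_rfl).contDiffAt
  rw [iteratedPartial, iteratedPartial, iteratedFDeriv_succ_apply_right, h,
    ContinuousLinearMap.iteratedFDeriv_comp_left _ hd (by exact_mod_cast le_top)]
  rfl

theorem iterate_partialDeriv_torusMk (i : Fin d) (k : ℕ) (φ : TestFun d) (y : Fin d → ℝ) :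
    ((partialDeriv i)^[k] φ : Torus d → ℝ) (torusMk y)
      = iteratedPartial k (fun _ => i) (φ : Torus d → ℝ) y := by
  induction k generalizing φ with
  | zero => simp [iteratedPartial, periodicLift]
  | succ k ih => rw [Function.iterate_succ_apply, ih, iteratedPartial_partialDeriv]

/-- The complex Fourier integral `∫ φ(x) exp(2πi⟨x, m⟩) dx`. -/
def fourierInt (φ : Torus d → ℝ) (m : Fin d → ℤ) : ℂ :=
  ∫ x, (φ x : ℂ) * UnitAddTorus.mFourier m x ∂torusMeasure d

theorem enorm_fourierInt_le {φ : Torus d → ℝ} {C : ℝ≥0∞} (h : ∀ x, ‖φ x‖ₑ ≤ C) (m : Fin d → ℤ) :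
    ‖fourierInt φ m‖ₑ ≤ C := by
  refine (enorm_integral_le_lintegral_enorm _).trans ?_
  calc ∫⁻ x, ‖(φ x : ℂ) * UnitAddTorus.mFourier m x‖ₑ ∂torusMeasure d
      ≤ ∫⁻ _, C ∂torusMeasure d := lintegral_mono fun x => by
        rw [enorm_mul, ← ofReal_norm (UnitAddTorus.mFourier m x), norm_mFourier_apply,
          ENNReal.ofReal_one, mul_one]
        refine le_trans (le_of_eq ?_) (h x)
        rw [← ofReal_norm, ← ofReal_norm, Complex.norm_real]
    _ = C := by simp

/-- Integration by parts in the form of translation invariance: the integral of `φ(x + t e_i)`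
against the character equals an exponential in `t` times the Fourier integral, and both expressions
are differentiated at `t = 0`. -/
theorem fourierInt_partialDeriv (φ : TestFun d) (i : Fin d) (m : Fin d → ℤ) :
    fourierInt (partialDeriv i φ : Torus d → ℝ) m
      = -(2 * Real.pi * m i * Complex.I) * fourierInt (φ : Torus d → ℝ) m := by
  obtain ⟨C, hC⟩ := (isCompact_range (testFun_continuous (partialDeriv i φ))).isBounded.exists_norm_le
  have hC' : ∀ x, ‖(partialDeriv i φ : Torus d → ℝ) x‖ ≤ C := fun x => hC _ ⟨x, rfl⟩
  have hcont : ∀ (ψ : TestFun d) (t : ℝ), Continuous fun x : Torus d =>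
      (((ψ : Torus d → ℝ) (x + axisPt i t) : ℝ) : ℂ) * UnitAddTorus.mFourier m x := fun ψ t =>
    (Complex.continuous_ofReal.comp ((testFun_continuous ψ).comp
      (continuous_id.add continuous_const))).mul (UnitAddTorus.mFourier m).continuous
  have h1 := (hasDerivAt_integral_of_dominated_loc_of_deriv_le (μ := torusMeasure d) (𝕜 := ℝ)
    (F := fun t x => (((φ : Torus d → ℝ) (x + axisPt i t) : ℝ) : ℂ) * UnitAddTorus.mFourier m x)
    (F' := fun t x => (((partialDeriv i φ : Torus d → ℝ) (x + axisPt i t) : ℝ) : ℂ)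
      * UnitAddTorus.mFourier m x) (x₀ := 0) (s := Set.univ) (bound := fun _ => C) univ_mem
    (Eventually.of_forall fun t => (hcont φ t).aestronglyMeasurable)
    (integrable_continuous (hcont φ 0)) (hcont _ 0).aestronglyMeasurable
    (ae_of_all _ fun x t _ => by
      rw [norm_mul, norm_mFourier_apply, mul_one, Complex.norm_real]; exact hC' _)
    (integrable_const _)
    (ae_of_all _ fun x t _ => (hasDerivAt_add_axisPt φ i x t).ofReal_comp.mul_const _)).2
  have h2 : ∀ t : ℝ, ∫ x, (((φ : Torus d → ℝ) (x + axisPt i t) : ℝ) : ℂ)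
      * UnitAddTorus.mFourier m x ∂torusMeasure d
      = Complex.exp (-(2 * Real.pi * m i * Complex.I) * t) * fourierInt (φ : Torus d → ℝ) m := by
    intro t
    have h3 : ∀ x : Torus d, UnitAddTorus.mFourier m x
        = Complex.exp (-(2 * Real.pi * m i * Complex.I) * t)
          * UnitAddTorus.mFourier m (x + axisPt i t) := by
      intro x
      rw [mFourier_apply_add, mFourier_axisPt, mul_left_comm, ← Complex.exp_add]
      simp
    rw [fourierInt, ← integral_const_mul]
    refine Eq.trans ?_ (integral_add_right_eq_self (fun x =>
      Complex.exp (-(2 * Real.pi * m i * Complex.I) * t)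
        * (((φ : Torus d → ℝ) x : ℂ) * UnitAddTorus.mFourier m x)) (axisPt i t))
    refine integral_congr_ae (ae_of_all _ fun x => ?_)
    change _ * _ = _ * (_ * _)
    rw [h3 x]
    ring
  simp only [h2] at h1
  have h4 : HasDerivAt (fun t : ℝ => Complex.exp (-(2 * Real.pi * m i * Complex.I) * t)
      * fourierInt (φ : Torus d → ℝ) m)
      (-(2 * Real.pi * m i * Complex.I) * fourierInt (φ : Torus d → ℝ) m) 0 := by
    have h5 : HasDerivAt (fun t : ℝ => -(2 * Real.pi * m i * Complex.I) * (t : ℂ))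
        (-(2 * Real.pi * m i * Complex.I)) 0 := by
      simpa using (Complex.ofRealCLM.hasDerivAt (x := 0)).const_mul
        (-(2 * Real.pi * m i * Complex.I))
    have h6 := h5.cexp.mul_const (fourierInt (φ : Torus d → ℝ) m)
    simpa using h6
  have h7 := h1.unique h4
  rw [← h7, fourierInt]
  have h0 : axisPt i 0 = 0 := by
    rw [axisPt, zero_smul]; rfl
  simp [h0]

theorem enorm_fourierInt_mul_le (φ : TestFun d) (k : ℕ) (m : Fin d → ℤ) :
    ‖fourierInt (φ : Torus d → ℝ) m‖ₑ * ENNReal.ofReal ((1 + ‖m‖) ^ k)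
      ≤ 2 ^ k * testSeminorm k (φ : Torus d → ℝ) := by
  have hiter : ∀ (i : Fin d) (k : ℕ) (φ : TestFun d),
      fourierInt ((partialDeriv i)^[k] φ : Torus d → ℝ) m
        = (-(2 * Real.pi * m i * Complex.I)) ^ k * fourierInt (φ : Torus d → ℝ) m := by
    intro i k
    induction k with
    | zero => intro φ; simp
    | succ k ih =>
      intro φ
      rw [Function.iterate_succ_apply, ih, fourierInt_partialDeriv]
      ring
  -- For `‖m‖ < 1` the weight is at most `2^k` and no derivative is needed. Otherwise all `k`
  -- derivatives are taken along a coordinate where the supremum norm of `m` is attained, and `1 +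
  -- ‖m‖ ≤ 2‖m‖`.
  rcases lt_or_ge ‖m‖ 1 with hm | hm
  · have h1 : (1 + ‖m‖) ^ k ≤ 2 ^ k := by gcongr; linarith
    rw [mul_comm]
    refine mul_le_mul' ?_ (enorm_fourierInt_le (fun x =>
      (enorm_le_testSeminorm _ x).trans (testSeminorm_mono (Nat.zero_le k) _)) m)
    calc ENNReal.ofReal ((1 + ‖m‖) ^ k) ≤ ENNReal.ofReal (2 ^ k) := ENNReal.ofReal_le_ofReal h1
      _ = 2 ^ k := by rw [ENNReal.ofReal_pow (by norm_num), ENNReal.ofReal_ofNat]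
  · obtain ⟨i, hi⟩ : ∃ i, ‖m‖ ≤ ‖m i‖ := by
      by_contra! hcon
      exact lt_irrefl _ ((pi_norm_lt_iff (by linarith)).2 hcon)
    have h2 : ‖fourierInt ((partialDeriv i)^[k] φ : Torus d → ℝ) m‖ₑ
        ≤ testSeminorm k (φ : Torus d → ℝ) := by
      refine enorm_fourierInt_le (fun x => ?_) m
      obtain ⟨y, rfl⟩ := torusMk_surjective x
      rw [iterate_partialDeriv_torusMk]
      exact le_iSup_of_le k (le_iSup_of_le le_rfl (le_iSup_of_le (fun _ => i)
        (le_iSup_of_le y le_rfl)))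
    have h3 : (1 + ‖m‖) ^ k ≤ 2 ^ k * ‖(-(2 * Real.pi * m i * Complex.I)) ^ k‖ := by
      rw [norm_pow, ← mul_pow]
      gcongr
      have e1 : ‖(-(2 * Real.pi * m i * Complex.I) : ℂ)‖ = 2 * Real.pi * ‖m i‖ := by
        simp [abs_of_pos Real.pi_pos, Int.norm_eq_abs]
      rw [e1]
      nlinarith [Real.pi_gt_three, norm_nonneg (m i)]
    calc ‖fourierInt (φ : Torus d → ℝ) m‖ₑ * ENNReal.ofReal ((1 + ‖m‖) ^ k)
        ≤ ‖fourierInt (φ : Torus d → ℝ) m‖ₑ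
          * ENNReal.ofReal (2 ^ k * ‖(-(2 * Real.pi * m i * Complex.I)) ^ k‖) :=
          mul_le_mul_right (ENNReal.ofReal_le_ofReal h3) _
      _ = 2 ^ k * ‖fourierInt ((partialDeriv i)^[k] φ : Torus d → ℝ) m‖ₑ := by
          rw [hiter, enorm_mul, ENNReal.ofReal_mul (by positivity), ofReal_norm,
            ENNReal.ofReal_pow (by norm_num), ENNReal.ofReal_ofNat]
          ring
      _ ≤ _ := mul_le_mul_right h2 _

/-- By periodicity, the suprema of the derivatives may be taken over the compact unit cube.
Finiteness matters because the decay constants below are obtained with `toReal`. -/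
theorem testSeminorm_ne_top (j : ℕ) (φ : TestFun d) :
    testSeminorm j (φ : Torus d → ℝ) ≠ ∞ := by
  set f := periodicLift (φ : Torus d → ℝ) with hf
  have hb : ∀ k : ℕ, ∃ C : ℝ≥0, ∀ y, ‖iteratedFDeriv ℝ k f y‖ₑ ≤ C := by
    intro k
    have hcont : Continuous (iteratedFDeriv ℝ k f) :=
      (testFun_contDiff φ).continuous_iteratedFDeriv (by exact_mod_cast le_top)
    obtain ⟨C, hC⟩ := ((isCompact_Icc (a := (0 : Fin d → ℝ)) (b := 1)).image hcont).isBounded.exists_norm_le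
    refine ⟨C.toNNReal, fun y => ?_⟩
    set n : Fin d → ℝ := fun i => ((⌊y i⌋ : ℤ) : ℝ)
    have hper : ∀ z, f (z + n) = f z := by
      intro z
      change (φ : Torus d → ℝ) (torusMk z + torusMk n) = (φ : Torus d → ℝ) (torusMk z)
      have : torusMk n = (0 : Torus d) := funext fun i => by
        have := AddCircle.coe_eq_zero_iff (p := (1 : ℝ)) (x := n i)
        exact this.2 ⟨⌊y i⌋, by simp [n]⟩
      rw [this, add_zero]
    have h1 : iteratedFDeriv ℝ k f y = iteratedFDeriv ℝ k f (y - n) := by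
      have h2 := iteratedFDeriv_comp_add_right (𝕜 := ℝ) (f := f) k n (y - n)
      rw [sub_add_cancel] at h2
      rw [← h2, funext hper]
    rw [h1, ← ofReal_norm]
    refine ENNReal.ofReal_le_ofReal (hC _ ⟨y - n, ⟨fun i => ?_, fun i => ?_⟩, rfl⟩)
    · simp [n]
    · have := Int.lt_floor_add_one (y i)
      simp only [Pi.sub_apply, Pi.one_apply, n]
      linarith
  choose C hC using hb
  refine ne_top_of_le_ne_top (b := ((∑ k ∈ Finset.range (j + 1), C k : ℝ≥0) : ℝ≥0∞)) (by finiteness) ?_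
  refine iSup_le fun k => iSup_le fun hk => iSup_le fun v => iSup_le fun y => ?_
  have h3 : ‖iteratedPartial k v (φ : Torus d → ℝ) y‖ ≤ ‖iteratedFDeriv ℝ k f y‖ := by
    refine (ContinuousMultilinearMap.le_opNorm _ _).trans ?_
    refine mul_le_of_le_one_right (norm_nonneg _) (Finset.prod_le_one (fun _ _ => norm_nonneg _) ?_)
    intro i _
    rw [Pi.norm_single, norm_one]
  calc ‖iteratedPartial k v (φ : Torus d → ℝ) y‖ₑ ≤ ‖iteratedFDeriv ℝ k f y‖ₑ := by
        rw [← ofReal_norm, ← ofReal_norm]; exact ENNReal.ofReal_le_ofReal h3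
    _ ≤ C k := hC k y
    _ ≤ _ := by
        rw [ENNReal.coe_le_coe]
        exact Finset.single_le_sum (f := C) (fun _ _ => zero_le) (Finset.mem_range.2 (by omega))

/-! ### Lattice sums -/

theorem tsum_pi_prod (d : ℕ) (f : ℤ → ℝ≥0∞) :
    ∑' m : Fin d → ℤ, ∏ i, f (m i) = (∑' n, f n) ^ d := by
  induction d with
  | zero => simp
  | succ d ih =>
    rw [← (Fin.consEquiv fun _ : Fin (d + 1) => ℤ).tsum_eq, ENNReal.tsum_prod']
    simp only [Fin.consEquiv_apply, Fin.prod_univ_succ, Fin.cons_zero, Fin.cons_succ]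
    simp only [ENNReal.tsum_mul_left, ih]
    rw [ENNReal.tsum_mul_right, pow_succ, mul_comm]

/-- The exponent `2d` allows a comparison with the product of `d` copies of the one-dimensional
series `∑ (1 + |n|)^{-2}`. -/
theorem summable_lattice (d : ℕ) :
    Summable fun m : Fin d → ℤ => ((1 + ‖m‖) ^ (2 * d))⁻¹ := by
  have h1 : Summable fun n : ℤ => ((1 + |(n : ℝ)|) ^ 2)⁻¹ := by
    have h2 : Summable fun n : ℕ => ((1 + |(n : ℝ)|) ^ 2)⁻¹ := by
      have h3 := (summable_nat_add_iff 1).2 (Real.summable_nat_pow_inv (p := 2).2 (by norm_num))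
      refine h3.congr fun n => ?_
      rw [abs_of_nonneg (Nat.cast_nonneg n)]
      push_cast
      ring
    refine Summable.of_nat_of_neg (by simpa using h2) (by simpa using h2)
  have h4 : ∑' m : Fin d → ℤ, ∏ i, ENNReal.ofReal ((1 + |(m i : ℝ)|) ^ 2)⁻¹ ≠ ∞ := by
    rw [tsum_pi_prod d fun n => ENNReal.ofReal ((1 + |(n : ℝ)|) ^ 2)⁻¹]
    exact ENNReal.pow_ne_top h1.tsum_ofReal_ne_top
  have h5 : ∑' m : Fin d → ℤ, ENNReal.ofReal ((1 + ‖m‖) ^ (2 * d))⁻¹ ≠ ∞ := by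
    refine ne_top_of_le_ne_top h4 (ENNReal.tsum_le_tsum fun m => ?_)
    rw [← ENNReal.ofReal_prod_of_nonneg fun i _ => by positivity]
    refine ENNReal.ofReal_le_ofReal ?_
    rw [Finset.prod_inv_distrib]
    refine inv_anti₀ (Finset.prod_pos fun i _ => by positivity) ?_
    rw [pow_mul]
    calc ∏ i, (1 + |(m i : ℝ)|) ^ 2 ≤ ∏ _i : Fin d, (1 + ‖m‖) ^ 2 := by
          refine Finset.prod_le_prod (fun i _ => by positivity) fun i _ => ?_
          gcongr
          have := norm_le_pi_norm m i
          rwa [Int.norm_eq_abs] at this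
      _ = _ := by simp
  have h6 := ENNReal.summable_toReal h5
  exact h6.congr fun m => ENNReal.toReal_ofReal (by positivity)

/-! ### Lattice balls and the dyadic partition -/

/-- The lattice points with coordinates of absolute value at most `R`. -/
def latticeBall (d R : ℕ) : Finset (Fin d → ℤ) :=
  Fintype.piFinset fun _ => Finset.Icc (-(R : ℤ)) R

theorem mem_latticeBall {R : ℕ} {m : Fin d → ℤ} : m ∈ latticeBall d R ↔ ∀ i, |m i| ≤ R := by
  simp [latticeBall, abs_le]

theorem neg_mem_latticeBall {R : ℕ} {m : Fin d → ℤ} :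
    -m ∈ latticeBall d R ↔ m ∈ latticeBall d R := by
  simp [mem_latticeBall]

theorem card_latticeBall (d R : ℕ) : (latticeBall d R).card = (2 * R + 1) ^ d := by
  rw [latticeBall, Fintype.card_piFinset]
  simp only [Int.card_Icc, Finset.prod_const, Finset.card_univ, Fintype.card_fin]
  congr 1
  omega

theorem latticeBall_mono {R S : ℕ} (h : R ≤ S) : latticeBall d R ⊆ latticeBall d S := fun m hm => by
  rw [mem_latticeBall] at hm ⊢
  exact fun i => (hm i).trans (by exact_mod_cast h)

theorem abs_le_norm_latticePt (m : Fin d → ℤ) (i : Fin d) : (|m i| : ℝ) ≤ ‖latticePt m‖ := by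
  have := PiLp.norm_apply_le (latticePt m) i
  simpa [latticePt] using this

theorem exists_lt_norm_of_notMem {R : ℕ} {m : Fin d → ℤ} (h : m ∉ latticeBall d R) :
    (R : ℝ) < ‖latticePt m‖ := by
  rw [mem_latticeBall] at h
  push Not at h
  obtain ⟨i, hi⟩ := h
  refine lt_of_lt_of_le ?_ (abs_le_norm_latticePt m i)
  exact_mod_cast hi

theorem latticePt_neg (m : Fin d → ℤ) : latticePt (-m) = -latticePt m := by
  ext i; simp [latticePt]

/-- The eigenvalue `|2πm|⁴` of the bilaplacian. -/
def eigen (m : Fin d → ℤ) : ℝ := ‖(2 * Real.pi) • latticePt m‖ ^ 4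

theorem eigen_nonneg (m : Fin d → ℤ) : 0 ≤ eigen m := by unfold eigen; positivity

theorem eigen_neg (m : Fin d → ℤ) : eigen (-m) = eigen m := by
  rw [eigen, latticePt_neg, smul_neg, norm_neg, eigen]

theorem DyadicPartition.fn_nonneg (ρ : DyadicPartition d) (j : ℕ) (x : EuclideanSpace ℝ (Fin d)) :
    0 ≤ ρ.fn j x := by
  cases j with
  | zero => exact ρ.low_nonneg x
  | succ q => exact ρ.ann_nonneg _

theorem DyadicPartition.fn_le_one (ρ : DyadicPartition d) (j : ℕ)
    (x : EuclideanSpace ℝ (Fin d)) : ρ.fn j x ≤ 1 := by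
  have h := ρ.hasSum_one x
  cases j with
  | zero =>
    have := h.nonneg fun q => ρ.ann_nonneg _
    change ρ.low x ≤ 1
    linarith
  | succ q =>
    have h1 := le_hasSum h q fun _ _ => ρ.ann_nonneg _
    have h2 := ρ.low_nonneg x
    change ρ.ann _ ≤ 1
    linarith

/-- The support of the `j`-th function has radius `4/3` for `j = 0` and `(8/3) 2^{j-1}` otherwise,
both less than `3 · 2^j`. Thus each block is a sum over a finite box. -/
theorem DyadicPartition.fn_eq_zero (ρ : DyadicPartition d) (j : ℕ) {m : Fin d → ℤ}
    (hm : m ∉ latticeBall d (3 * 2 ^ j)) : ρ.fn j (latticePt m) = 0 := by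
  have h := exists_lt_norm_of_notMem hm
  push_cast at h
  cases j with
  | zero =>
    by_contra hne
    have h1 := ρ.low_support (subset_tsupport _ (Function.mem_support.2 hne))
    rw [Set.mem_ofPred_eq] at h1
    norm_num at h
    linarith
  | succ q =>
    by_contra hne
    have h1 := (ρ.ann_support (subset_tsupport _ (Function.mem_support.2 hne))).2
    rw [norm_smul, norm_inv, norm_pow, Real.norm_ofNat, inv_mul_le_iff₀ (by positivity)] at h1
    rw [pow_succ] at h
    have : (0 : ℝ) < 2 ^ q := by positivity
    linarith

/-- On the `j`-th annulus `|2πm| ≥ 2π · (3/4) · 2^{j-1} > 2^j`. The maximum with `1` accommodates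
the lowest block, which may contain `m = 0`. This lower bound is the source of the smoothing in the
variance estimates. -/
theorem DyadicPartition.pow_le_of_fn_ne_zero (ρ : DyadicPartition d) (j : ℕ) {m : Fin d → ℤ}
    (hm : ρ.fn j (latticePt m) ≠ 0) : (16 : ℝ) ^ j ≤ max 1 (eigen m) := by
  cases j with
  | zero => simp
  | succ q =>
    refine le_max_of_le_right ?_
    have h1 := (ρ.ann_support (subset_tsupport _ (Function.mem_support.2 hm))).1
    rw [norm_smul, norm_inv, norm_pow, Real.norm_ofNat, le_inv_mul_iff₀ (by positivity)] at h1
    have h2 : (2 : ℝ) ^ (q + 1) ≤ ‖(2 * Real.pi) • latticePt m‖ := by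
      rw [norm_smul, Real.norm_of_nonneg (by positivity), pow_succ]
      nlinarith [Real.pi_gt_three, norm_nonneg (latticePt m)]
    calc (16 : ℝ) ^ (q + 1) = (2 ^ (q + 1)) ^ 4 := by
          rw [← pow_mul, mul_comm, pow_mul]; norm_num
      _ ≤ _ := by unfold eigen; gcongr

/-! ### Littlewood-Paley blocks in terms of Fourier coefficients -/

theorem cosTest_neg (m : Fin d → ℤ) : cosTest (-m) = cosTest m := Subtype.ext (cosChar_neg m)

theorem sinTest_neg (m : Fin d → ℤ) : sinTest (-m) = -sinTest m := Subtype.ext (sinChar_neg m)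

/-- The value of a distribution at a test function. -/
def pair (f : Dist d) (φ : TestFun d) : ℝ := (f : TestFun d →ₗ[ℝ] ℝ) φ

theorem dist_ext {f g : Dist d} (h : ∀ φ, pair f φ = pair g φ) : f = g :=
  Subtype.ext (LinearMap.ext h)

theorem pair_sub (f g : Dist d) (φ : TestFun d) : pair (f - g) φ = pair f φ - pair g φ := rfl

theorem pair_add (f g : Dist d) (φ : TestFun d) : pair (f + g) φ = pair f φ + pair g φ := rfl

theorem pair_sum {ι : Type*} (F : Finset ι) (f : ι → Dist d) (φ : TestFun d) :
    pair (∑ m ∈ F, f m) φ = ∑ m ∈ F, pair (f m) φ := by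
  classical
  induction F using Finset.induction_on with
  | empty => rfl
  | insert a s ha ih => rw [Finset.sum_insert ha, Finset.sum_insert ha, pair_add, ih]

theorem convolve_cosSeries_eq {h : EuclideanSpace ℝ (Fin d) → ℝ} {F : Finset (Fin d → ℤ)}
    (hF : ∀ m ∉ F, h (latticePt m) = 0) (f : Dist d) (x : Torus d) :
    convolve (cosSeries h) f x = ∑ m ∈ F, h (latticePt m) *
      (cosChar m x * pair f (cosTest m) + sinChar m x * pair f (sinTest m)) := by
  have hs : (Function.support fun m : Fin d → ℤ => h (latticePt m) • cosTest m) ⊆ F := by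
    intro m hm
    by_contra hmF
    exact hm (by simp [hF m (by simpa using hmF)])
  rw [convolve, cosSeries, finsum_eq_sum_of_support_subset _ hs]
  simp only [map_sum, map_smul, reflectTranslate_cosTest, map_add, smul_eq_mul]
  rfl

theorem block_eq_sum (ρ : DyadicPartition d) (j : ℕ) (f : Dist d) (x : Torus d) :
    block ρ j f x = ∑ m ∈ latticeBall d (3 * 2 ^ j), ρ.fn j (latticePt m) *
      (cosChar m x * pair f (cosTest m) + sinChar m x * pair f (sinTest m)) :=
  convolve_cosSeries_eq (fun _ => ρ.fn_eq_zero j) f x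

theorem besovNorm_le_of_block_le {ρ : DyadicPartition d} {α : ℝ} {f : Dist d} {C : ℝ≥0∞}
    (h : ∀ (j : ℕ) (x : Torus d), (2 : ℝ≥0∞) ^ (α * ((j : ℝ) - 1)) * ‖block ρ j f x‖ₑ ≤ C) :
    besovNorm ρ α f ≤ C := by
  refine iSup_le fun j => ?_
  have h2 : (2 : ℝ≥0∞) ^ (α * ((j : ℝ) - 1)) ≠ 0 := by simp
  have h3 : (2 : ℝ≥0∞) ^ (α * ((j : ℝ) - 1)) ≠ ∞ :=
    ENNReal.rpow_ne_top_of_ne_zero (by simp) (by simp)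
  rw [mul_comm, ← ENNReal.le_div_iff_mul_le (Or.inl h2) (Or.inl h3), eLpNorm_exponent_top]
  refine essSup_le_of_ae_le _ (ae_of_all _ fun x => ?_)
  change ‖block ρ j f x‖ₑ ≤ _
  rw [ENNReal.le_div_iff_mul_le (Or.inl h2) (Or.inl h3), mul_comm]
  exact h j x

/-! ### Distributions with given Fourier coefficients -/

/-- The function `cos(2π⟨·, m⟩)` as a distribution. -/
def cosDist (m : Fin d → ℤ) : Dist d := ofContinuous ⟨cosChar m, continuous_cosChar m⟩

/-- The function `sin(2π⟨·, m⟩)` as a distribution. -/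
def sinDist (m : Fin d → ℤ) : Dist d := ofContinuous ⟨sinChar m, continuous_sinChar m⟩

theorem pair_cosDist (m : Fin d → ℤ) (φ : TestFun d) :
    pair (cosDist m) φ = ∫ x, cosChar m x * (φ : Torus d → ℝ) x ∂torusMeasure d := rfl

theorem pair_sinDist (m : Fin d → ℤ) (φ : TestFun d) :
    pair (sinDist m) φ = ∫ x, sinChar m x * (φ : Torus d → ℝ) x ∂torusMeasure d := rfl

theorem integrable_mul_mFourier (m : Fin d → ℤ) (φ : TestFun d) :
    Integrable (fun x => ((φ : Torus d → ℝ) x : ℂ) * UnitAddTorus.mFourier m x) (torusMeasure d) :=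
  integrable_continuous ((Complex.continuous_ofReal.comp (testFun_continuous φ)).mul
    (UnitAddTorus.mFourier m).continuous)

theorem pair_cosDist_eq_re (m : Fin d → ℤ) (φ : TestFun d) :
    pair (cosDist m) φ = (fourierInt (φ : Torus d → ℝ) m).re := by
  have := integral_re (integrable_mul_mFourier m φ)
  simp only [RCLike.re_eq_complex_re, Complex.re_ofReal_mul] at this
  rw [fourierInt, ← this, pair_cosDist]
  exact integral_congr_ae (ae_of_all _ fun x => mul_comm _ _)

theorem pair_sinDist_eq_im (m : Fin d → ℤ) (φ : TestFun d) :
    pair (sinDist m) φ = (fourierInt (φ : Torus d → ℝ) m).im := by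
  have := integral_im (integrable_mul_mFourier m φ)
  simp only [RCLike.im_eq_complex_im, Complex.im_ofReal_mul] at this
  rw [fourierInt, ← this, pair_sinDist]
  exact integral_congr_ae (ae_of_all _ fun x => mul_comm _ _)

/-- A bound for the rate of decay of the Fourier coefficients of a test function. -/
def decayConst (φ : TestFun d) : ℝ := 2 ^ (4 * d) * (testSeminorm (4 * d) (φ : Torus d → ℝ)).toReal

theorem decayConst_nonneg (φ : TestFun d) : 0 ≤ decayConst φ := by unfold decayConst; positivity

theorem norm_fourierInt_le (φ : TestFun d) (m : Fin d → ℤ) :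
    ‖fourierInt (φ : Torus d → ℝ) m‖ ≤ decayConst φ * ((1 + ‖m‖) ^ (4 * d))⁻¹ := by
  have h := ENNReal.toReal_mono (by have := testSeminorm_ne_top (4 * d) φ; finiteness)
    (enorm_fourierInt_mul_le φ (4 * d) m)
  rw [ENNReal.toReal_mul, ENNReal.toReal_mul, toReal_enorm, ENNReal.toReal_ofReal (by positivity),
    ENNReal.toReal_pow, ENNReal.toReal_ofNat] at h
  rw [← div_eq_mul_inv, le_div_iff₀ (by positivity)]
  exact h

theorem abs_pair_cosDist_le (m : Fin d → ℤ) (φ : TestFun d) :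
    |pair (cosDist m) φ| ≤ decayConst φ * ((1 + ‖m‖) ^ (4 * d))⁻¹ := by
  rw [pair_cosDist_eq_re]
  exact (Complex.abs_re_le_norm _).trans (norm_fourierInt_le φ m)

theorem abs_pair_sinDist_le (m : Fin d → ℤ) (φ : TestFun d) :
    |pair (sinDist m) φ| ≤ decayConst φ * ((1 + ‖m‖) ^ (4 * d))⁻¹ := by
  rw [pair_sinDist_eq_im]
  exact (Complex.abs_im_le_norm _).trans (norm_fourierInt_le φ m)

/-- Fourier coefficients of polynomial growth. -/
def PolyBounded (c : (Fin d → ℤ) → ℝ) : Prop := ∃ C : ℝ, ∀ m, |c m| ≤ C * (1 + ‖m‖) ^ (2 * d)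

/-- Growth of order `2d` against decay of order `4d` leaves the summable weight of order `-2d`. -/
theorem abs_term_le {c s : (Fin d → ℤ) → ℝ} {C D : ℝ} (hc : ∀ m, |c m| ≤ C * (1 + ‖m‖) ^ (2 * d))
    (hs : ∀ m, |s m| ≤ D * (1 + ‖m‖) ^ (2 * d)) (φ : TestFun d) (m : Fin d → ℤ) :
    |c m * pair (cosDist m) φ + s m * pair (sinDist m) φ|
      ≤ (C + D) * decayConst φ * ((1 + ‖m‖) ^ (2 * d))⁻¹ := by
  have e : ∀ B : ℝ, B * (1 + ‖m‖) ^ (2 * d) * (decayConst φ * ((1 + ‖m‖) ^ (4 * d))⁻¹)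
      = B * decayConst φ * ((1 + ‖m‖) ^ (2 * d))⁻¹ := fun B => by
    rw [show 4 * d = 2 * d + 2 * d by ring, pow_add]
    have : (1 + ‖m‖) ^ (2 * d) ≠ 0 := by positivity
    field_simp
  calc _ ≤ |c m| * |pair (cosDist m) φ| + |s m| * |pair (sinDist m) φ| := by
        rw [← abs_mul, ← abs_mul]; exact abs_add_le _ _
    _ ≤ C * (1 + ‖m‖) ^ (2 * d) * (decayConst φ * ((1 + ‖m‖) ^ (4 * d))⁻¹)
        + D * (1 + ‖m‖) ^ (2 * d) * (decayConst φ * ((1 + ‖m‖) ^ (4 * d))⁻¹) := by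
        refine add_le_add ?_ ?_
        · exact mul_le_mul (hc m) (abs_pair_cosDist_le m φ) (abs_nonneg _)
            ((abs_nonneg _).trans (hc m))
        · exact mul_le_mul (hs m) (abs_pair_sinDist_le m φ) (abs_nonneg _)
            ((abs_nonneg _).trans (hs m))
    _ = _ := by rw [e, e]; ring

theorem summable_term {c s : (Fin d → ℤ) → ℝ} (hc : PolyBounded c) (hs : PolyBounded s)
    (φ : TestFun d) :
    Summable fun m => c m * pair (cosDist m) φ + s m * pair (sinDist m) φ := by
  obtain ⟨C, hC⟩ := hc
  obtain ⟨D, hD⟩ := hs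
  exact Summable.of_norm_bounded ((summable_lattice d).mul_left ((C + D) * decayConst φ))
    fun m => abs_term_le hC hD φ m

/-- The distribution with the Fourier coefficients `c` and `s`. -/
def coeffDist (c s : (Fin d → ℤ) → ℝ) (hc : PolyBounded c) (hs : PolyBounded s) : Dist d :=
  ⟨{  toFun := fun φ => ∑' m, (c m * pair (cosDist m) φ + s m * pair (sinDist m) φ)
      map_add' := fun φ ψ => by
        rw [← (summable_term hc hs φ).tsum_add (summable_term hc hs ψ)]
        refine tsum_congr fun m => ?_
        simp only [pair, map_add]
        ring
      map_smul' := fun a φ => by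
        rw [RingHom.id_apply, smul_eq_mul, ← tsum_mul_left]
        refine tsum_congr fun m => ?_
        simp only [pair, map_smul, smul_eq_mul]
        ring }, by
    obtain ⟨C, hC⟩ := hc
    obtain ⟨D, hD⟩ := hs
    set S := ∑' m : Fin d → ℤ, ((1 + ‖m‖) ^ (2 * d))⁻¹
    have h0 : 0 ≤ C + D := by
      have h1 := (abs_nonneg _).trans (hC 0)
      have h2 := (abs_nonneg _).trans (hD 0)
      simp only [norm_zero, add_zero, one_pow, mul_one] at h1 h2
      linarith
    have hS : 0 ≤ S := tsum_nonneg fun m => by positivity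
    refine ⟨((C + D) * 2 ^ (4 * d) * S).toNNReal, 4 * d, fun φ => ?_⟩
    have h1 : ‖∑' m, (c m * pair (cosDist m) φ + s m * pair (sinDist m) φ)‖
        ≤ (C + D) * decayConst φ * S := by
      refine tsum_of_norm_bounded ?_ fun m => abs_term_le hC hD φ m
      exact (summable_lattice d).hasSum.mul_left _
    rw [LinearMap.coe_mk, AddHom.coe_mk, ← ofReal_norm]
    refine (ENNReal.ofReal_le_ofReal h1).trans (le_of_eq ?_)
    rw [decayConst, show (C + D) * (2 ^ (4 * d) * (testSeminorm (4 * d) (φ : Torus d → ℝ)).toReal) * S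
      = (C + D) * 2 ^ (4 * d) * S * (testSeminorm (4 * d) (φ : Torus d → ℝ)).toReal by ring,
      ENNReal.ofReal_mul (by positivity), ENNReal.ofReal_toReal (testSeminorm_ne_top _ _)]
    rfl⟩

theorem pair_coeffDist {c s : (Fin d → ℤ) → ℝ} (hc : PolyBounded c) (hs : PolyBounded s)
    (φ : TestFun d) : pair (coeffDist c s hc hs) φ
      = ∑' m, (c m * pair (cosDist m) φ + s m * pair (sinDist m) φ) := rfl

theorem pair_cosDist_cosTest (m n : Fin d → ℤ) :
    pair (cosDist m) (cosTest n) = (delta m n + delta m (-n)) / 2 :=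
  integral_cosChar_mul_cosChar m n

theorem pair_sinDist_cosTest (m n : Fin d → ℤ) : pair (sinDist m) (cosTest n) = 0 :=
  integral_sinChar_mul_cosChar m n

theorem pair_cosDist_sinTest (m n : Fin d → ℤ) : pair (cosDist m) (sinTest n) = 0 :=
  integral_cosChar_mul_sinChar m n

theorem pair_sinDist_sinTest (m n : Fin d → ℤ) :
    pair (sinDist m) (sinTest n) = (delta m n - delta m (-n)) / 2 :=
  integral_sinChar_mul_sinChar m n

theorem hasSum_mul_delta (c : (Fin d → ℤ) → ℝ) (n : Fin d → ℤ) :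
    HasSum (fun m => c m * delta m n) (c n) := by
  convert hasSum_ite_eq n (c n) using 2 with m
  unfold delta
  split_ifs with h
  · rw [h, mul_one]
  · rw [mul_zero]

/-- The indices `n` and `-n` each contribute one half, so the prescribed coefficient is recovered
exactly when `c` is even; in the same way the sine coefficients have to be odd. -/
theorem pair_coeffDist_cosTest {c s : (Fin d → ℤ) → ℝ} (hc : PolyBounded c) (hs : PolyBounded s)
    (hce : ∀ m, c (-m) = c m) (n : Fin d → ℤ) :
    pair (coeffDist c s hc hs) (cosTest n) = c n := by
  have h := ((hasSum_mul_delta c n).add (hasSum_mul_delta c (-n))).div_const 2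
  rw [pair_coeffDist]
  simp only [pair_cosDist_cosTest, pair_sinDist_cosTest, mul_zero, add_zero]
  rw [← (show (c n + c (-n)) / 2 = c n by rw [hce]; ring), ← h.tsum_eq]
  exact tsum_congr fun m => by ring

theorem pair_coeffDist_sinTest {c s : (Fin d → ℤ) → ℝ} (hc : PolyBounded c) (hs : PolyBounded s)
    (hso : ∀ m, s (-m) = -s m) (n : Fin d → ℤ) :
    pair (coeffDist c s hc hs) (sinTest n) = s n := by
  have h := ((hasSum_mul_delta s n).sub (hasSum_mul_delta s (-n))).div_const 2
  rw [pair_coeffDist]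
  simp only [pair_cosDist_sinTest, pair_sinDist_sinTest, mul_zero, zero_add]
  rw [← (show (s n - s (-n)) / 2 = s n by rw [hso]; ring), ← h.tsum_eq]
  exact tsum_congr fun m => by ring

/-! ### Trigonometric polynomials -/

/-- The trigonometric polynomial with coefficients `c` and `s`, as a distribution. -/
def trigDist (R : ℕ) (c s : (Fin d → ℤ) → ℝ) : Dist d :=
  ∑ m ∈ latticeBall d R, (c m • cosDist m + s m • sinDist m)

theorem pair_trigDist (R : ℕ) (c s : (Fin d → ℤ) → ℝ) (φ : TestFun d) :
    pair (trigDist R c s) φ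
      = ∑ m ∈ latticeBall d R, (c m * pair (cosDist m) φ + s m * pair (sinDist m) φ) := by
  rw [trigDist, pair_sum]
  rfl

theorem sum_mul_delta (F : Finset (Fin d → ℤ)) (c : (Fin d → ℤ) → ℝ) (n : Fin d → ℤ) :
    ∑ m ∈ F, c m * delta m n = if n ∈ F then c n else 0 := by
  simp [delta]

theorem pair_trigDist_cosTest (R : ℕ) (c s : (Fin d → ℤ) → ℝ) (n : Fin d → ℤ) :
    pair (trigDist R c s) (cosTest n)
      = if n ∈ latticeBall d R then (c n + c (-n)) / 2 else 0 := by
  rw [pair_trigDist]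
  simp only [pair_cosDist_cosTest, pair_sinDist_cosTest, mul_zero, add_zero, ← mul_div_assoc,
    mul_add, ← Finset.sum_div, Finset.sum_add_distrib, sum_mul_delta, neg_mem_latticeBall]
  split_ifs <;> simp

theorem pair_trigDist_sinTest (R : ℕ) (c s : (Fin d → ℤ) → ℝ) (n : Fin d → ℤ) :
    pair (trigDist R c s) (sinTest n)
      = if n ∈ latticeBall d R then (s n - s (-n)) / 2 else 0 := by
  rw [pair_trigDist]
  simp only [pair_cosDist_sinTest, pair_sinDist_sinTest, mul_zero, zero_add, ← mul_div_assoc,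
    mul_sub, ← Finset.sum_div, Finset.sum_sub_distrib, sum_mul_delta, neg_mem_latticeBall]
  split_ifs <;> simp

theorem exists_fn_eq_zero_of_le (ρ : DyadicPartition d) (R : ℕ) :
    ∃ J : ℕ, ∀ j, J ≤ j → ∀ m ∈ latticeBall d R, ρ.fn j (latticePt m) = 0 := by
  have h : ∀ᶠ j : ℕ in atTop, ∀ m ∈ latticeBall d R, ρ.fn j (latticePt m) = 0 := by
    rw [Filter.eventually_all_finset]
    intro m _
    have h1 := (tendsto_pow_atTop_atTop_of_one_lt (r := (16 : ℝ)) (by norm_num)).eventually_gt_atTop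
      (max 1 (eigen m))
    filter_upwards [h1] with j hj
    by_contra hne
    exact absurd (ρ.pow_le_of_fn_ne_zero j hne) (not_le.2 hj)
  exact eventually_atTop.1 h

theorem block_trigDist_eq_zero {ρ : DyadicPartition d} {R j : ℕ}
    (h : ∀ m ∈ latticeBall d R, ρ.fn j (latticePt m) = 0) (c s : (Fin d → ℤ) → ℝ) :
    block ρ j (trigDist R c s) = 0 := by
  funext x
  rw [block_eq_sum]
  refine Finset.sum_eq_zero fun m _ => ?_
  by_cases hm : m ∈ latticeBall d R
  · rw [h m hm, zero_mul]
  · rw [pair_trigDist_cosTest, pair_trigDist_sinTest, if_neg hm, if_neg hm]; simp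

/-- The trigonometric polynomial with coefficients `c` and `s`, as an element of `𝒞^α`. -/
def trigBesov (ρ : DyadicPartition d) (α : ℝ) (R : ℕ)
    (z : ((Fin d → ℤ) → ℝ) × ((Fin d → ℤ) → ℝ)) : BesovC ρ α :=
  ⟨trigDist R z.1 z.2, by
    obtain ⟨J, hJ⟩ := exists_fn_eq_zero_of_le ρ R
    refine tendsto_const_nhds.congr' ?_
    filter_upwards [eventually_ge_atTop J] with q hq
    rw [block_trigDist_eq_zero (hJ (q + 1) (by omega))]
    simp⟩

theorem trigDist_sub (R : ℕ) (c s c' s' : (Fin d → ℤ) → ℝ) :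
    trigDist R c s - trigDist R c' s' = trigDist R (c - c') (s - s') := by
  refine dist_ext fun φ => ?_
  rw [pair_sub, pair_trigDist, pair_trigDist, pair_trigDist, ← Finset.sum_sub_distrib]
  refine Finset.sum_congr rfl fun m _ => ?_
  simp only [Pi.sub_apply]
  ring

/-- Only finitely many blocks see the frequencies of the ball, and in each of them the multiplier
and the characters are bounded by `1`. -/
theorem exists_besovNorm_trigDist_le (ρ : DyadicPartition d) (α : ℝ) (R : ℕ) :
    ∃ K : ℝ≥0, ∀ c s : (Fin d → ℤ) → ℝ, besovNorm ρ α (trigDist R c s)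
      ≤ K * ∑ m ∈ latticeBall d R, (‖c m‖ₑ + ‖s m‖ₑ) := by
  obtain ⟨J, hJ⟩ := exists_fn_eq_zero_of_le ρ R
  -- The sum of the weights of the blocks below `J` dominates each of these weights.
  refine ⟨∑ j ∈ Finset.range J, (2 : ℝ≥0) ^ (α * ((j : ℝ) - 1)), fun c s => ?_⟩
  refine besovNorm_le_of_block_le fun j x => ?_
  rcases le_or_gt J j with hj | hj
  · rw [block_trigDist_eq_zero (hJ j hj)]
    simp
  refine mul_le_mul' ?_ ?_
  · have h1 : ((2 : ℝ≥0∞) ^ (α * ((j : ℝ) - 1))) = (((2 : ℝ≥0) ^ (α * ((j : ℝ) - 1)) : ℝ≥0) : ℝ≥0∞) := by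
      rw [ENNReal.coe_rpow_of_ne_zero (by norm_num)]; rfl
    rw [h1, ENNReal.coe_le_coe]
    exact Finset.single_le_sum (f := fun j : ℕ => (2 : ℝ≥0) ^ (α * ((j : ℝ) - 1)))
      (fun _ _ => zero_le) (Finset.mem_range.2 hj)
  · have hterm : ∀ m : Fin d → ℤ, ‖ρ.fn j (latticePt m) *
        (cosChar m x * pair (trigDist R c s) (cosTest m)
          + sinChar m x * pair (trigDist R c s) (sinTest m))‖
        ≤ |pair (trigDist R c s) (cosTest m)| + |pair (trigDist R c s) (sinTest m)| := by
      intro m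
      rw [norm_mul, Real.norm_of_nonneg (ρ.fn_nonneg j _)]
      refine (mul_le_of_le_one_left (norm_nonneg _) (ρ.fn_le_one j _)).trans ?_
      refine (norm_add_le _ _).trans (add_le_add ?_ ?_)
      · rw [norm_mul]
        exact mul_le_of_le_one_left (norm_nonneg _) (abs_cosChar_le_one m x)
      · rw [norm_mul]
        exact mul_le_of_le_one_left (norm_nonneg _) (abs_sinChar_le_one m x)
    have hsum : ‖block ρ j (trigDist R c s) x‖ ≤ ∑ m ∈ latticeBall d R, (|c m| + |s m|) := by
      rw [block_eq_sum]
      refine (norm_sum_le_of_le _ fun m _ => hterm m).trans ?_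
      simp only [pair_trigDist_cosTest, pair_trigDist_sinTest]
      have h2 : ∀ g : (Fin d → ℤ) → ℝ,
          ∑ m ∈ latticeBall d R, |g (-m)| = ∑ m ∈ latticeBall d R, |g m| := fun g =>
        Finset.sum_bij (fun m _ => -m) (fun m hm => neg_mem_latticeBall.2 hm)
          (fun a _ b _ h => neg_injective h)
          (fun b hb => ⟨-b, neg_mem_latticeBall.2 hb, neg_neg b⟩) fun m _ => rfl
      calc _ ≤ ∑ m ∈ latticeBall d R, (|(c m + c (-m)) / 2| + |(s m - s (-m)) / 2|) := by
            have e : ∀ m : Fin d → ℤ, |if m ∈ latticeBall d R then (c m + c (-m)) / 2 else 0|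
                + |if m ∈ latticeBall d R then (s m - s (-m)) / 2 else 0|
                = if m ∈ latticeBall d R then
                  |(c m + c (-m)) / 2| + |(s m - s (-m)) / 2| else 0 := fun m => by
              split_ifs <;> simp
            simp only [e]
            rw [Finset.sum_ite_mem]
            exact Finset.sum_le_sum_of_subset_of_nonneg Finset.inter_subset_right
              fun _ _ _ => by positivity
        _ ≤ ∑ m ∈ latticeBall d R, ((|c m| + |c (-m)|) / 2 + (|s m| + |s (-m)|) / 2) := by
            refine Finset.sum_le_sum fun m _ => ?_
            rw [abs_div, abs_div, abs_two]
            have := abs_add_le (c m) (c (-m))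
            have := abs_sub (s m) (s (-m))
            gcongr
        _ = _ := by
            simp only [Finset.sum_add_distrib, ← Finset.sum_div, h2]
            ring
    rw [← ofReal_norm]
    refine (ENNReal.ofReal_le_ofReal hsum).trans (le_of_eq ?_)
    rw [ENNReal.ofReal_sum_of_nonneg fun m _ => by positivity]
    refine Finset.sum_congr rfl fun m _ => ?_
    rw [ENNReal.ofReal_add (abs_nonneg _) (abs_nonneg _), ← Real.norm_eq_abs, ← Real.norm_eq_abs,
      ofReal_norm, ofReal_norm]

/-- Continuity is with respect to the product topology on the coefficients. It transfers both
continuity in time and measurability in `ω` from the scalar modes to the Besov space. -/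
theorem continuous_trigBesov (ρ : DyadicPartition d) (α : ℝ) (R : ℕ) :
    Continuous (trigBesov ρ α R) := by
  obtain ⟨K, hK⟩ := exists_besovNorm_trigDist_le ρ α R
  rw [continuous_iff_continuousAt]
  intro z
  rw [ContinuousAt, tendsto_iff_edist_tendsto_0]
  have hz : Tendsto (fun w : ((Fin d → ℤ) → ℝ) × ((Fin d → ℤ) → ℝ) => (K : ℝ≥0∞) *
      ∑ m ∈ latticeBall d R, (‖w.1 m - z.1 m‖ₑ + ‖w.2 m - z.2 m‖ₑ)) (𝓝 z) (𝓝 0) := by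
    have h1 : Continuous fun w : ((Fin d → ℤ) → ℝ) × ((Fin d → ℤ) → ℝ) =>
        ∑ m ∈ latticeBall d R, (‖w.1 m - z.1 m‖ₑ + ‖w.2 m - z.2 m‖ₑ) :=
      continuous_finsetSum _ fun m _ => by fun_prop
    have h2 := ENNReal.Tendsto.const_mul (a := (K : ℝ≥0∞)) (h1.tendsto z)
      (Or.inr ENNReal.coe_ne_top)
    simpa using h2
  refine tendsto_of_tendsto_of_tendsto_of_le_of_le tendsto_const_nhds hz (fun _ => zero_le)
    fun w => ?_
  change besovNorm ρ α (trigDist R w.1 w.2 - trigDist R z.1 z.2) ≤ _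
  rw [trigDist_sub]
  exact hK _ _

/-! ### Mollification -/

theorem exists_apply_smul_eq_zero {ζ : EuclideanSpace ℝ (Fin d) → ℝ} (hζ : HasCompactSupport ζ)
    {ε : ℝ} (hε : 0 < ε) :
    ∃ R : ℕ, ∀ m ∉ latticeBall d R, ζ (ε • latticePt m) = 0 := by
  obtain ⟨C, hC⟩ := hζ.isCompact.isBounded.exists_norm_le
  obtain ⟨R, hR⟩ := exists_nat_gt (C / ε)
  refine ⟨R, fun m hm => ?_⟩
  by_contra hne
  have h1 := hC _ (subset_tsupport _ (Function.mem_support.2 hne))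
  have h2 := exists_lt_norm_of_notMem hm
  rw [norm_smul, Real.norm_of_nonneg hε.le] at h1
  rw [div_lt_iff₀ hε] at hR
  nlinarith

/-- Compact support of `ζ` leaves finitely many frequencies, so sum and integral commute and the
mollification is a trigonometric polynomial. -/
theorem pair_mollify {ζ : EuclideanSpace ℝ (Fin d) → ℝ} {ε : ℝ} {R : ℕ}
    (hR : ∀ m ∉ latticeBall d R, ζ (ε • latticePt m) = 0) (f : Dist d) (φ : TestFun d) :
    pair (mollify ζ ε f) φ = pair (trigDist R
      (fun m => ζ (ε • latticePt m) * pair f (cosTest m))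
      (fun m => ζ (ε • latticePt m) * pair f (sinTest m))) φ := by
  rw [pair_trigDist]
  change ∫ x, convolve (cosSeries fun x => ζ (ε • x)) f x * (φ : Torus d → ℝ) x ∂torusMeasure d = _
  simp only [convolve_cosSeries_eq (h := fun x => ζ (ε • x)) hR, Finset.sum_mul]
  have hc : ∀ m : Fin d → ℤ, Integrable (fun x => cosChar m x * (φ : Torus d → ℝ) x)
      (torusMeasure d) := fun m =>
    integrable_continuous ((continuous_cosChar m).mul (testFun_continuous φ))
  have hs : ∀ m : Fin d → ℤ, Integrable (fun x => sinChar m x * (φ : Torus d → ℝ) x)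
      (torusMeasure d) := fun m =>
    integrable_continuous ((continuous_sinChar m).mul (testFun_continuous φ))
  have e : ∀ (m : Fin d → ℤ) (x : Torus d), ζ (ε • latticePt m) * (cosChar m x * pair f (cosTest m)
      + sinChar m x * pair f (sinTest m)) * (φ : Torus d → ℝ) x
      = ζ (ε • latticePt m) * pair f (cosTest m) * (cosChar m x * (φ : Torus d → ℝ) x)
      + ζ (ε • latticePt m) * pair f (sinTest m) * (sinChar m x * (φ : Torus d → ℝ) x) :=
    fun m x => by ring
  simp only [e]
  have hint : ∀ m : Fin d → ℤ, Integrable (fun x =>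
      ζ (ε • latticePt m) * pair f (cosTest m) * (cosChar m x * (φ : Torus d → ℝ) x)
      + ζ (ε • latticePt m) * pair f (sinTest m) * (sinChar m x * (φ : Torus d → ℝ) x))
      (torusMeasure d) := fun m => ((hc m).const_mul _).add ((hs m).const_mul _)
  rw [integral_finsetSum _ fun m _ => hint m]
  refine Finset.sum_congr rfl fun m _ => ?_
  rw [integral_add ((hc m).const_mul _) ((hs m).const_mul _), integral_const_mul,
    integral_const_mul]
  rfl

theorem pair_neg_right (f : Dist d) (φ : TestFun d) : pair f (-φ) = -pair f φ := map_neg _ _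

theorem pair_mollify_cosTest {ζ : EuclideanSpace ℝ (Fin d) → ℝ} (hζ : HasCompactSupport ζ)
    (heven : ∀ x, ζ (-x) = ζ x) {ε : ℝ} (hε : 0 < ε) (f : Dist d) (n : Fin d → ℤ) :
    pair (mollify ζ ε f) (cosTest n) = ζ (ε • latticePt n) * pair f (cosTest n) := by
  obtain ⟨R, hR⟩ := exists_apply_smul_eq_zero hζ hε
  rw [pair_mollify hR, pair_trigDist_cosTest, latticePt_neg, smul_neg, heven, cosTest_neg]
  split_ifs with h
  · ring
  · rw [hR n h, zero_mul]

theorem pair_mollify_sinTest {ζ : EuclideanSpace ℝ (Fin d) → ℝ} (hζ : HasCompactSupport ζ)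
    (heven : ∀ x, ζ (-x) = ζ x) {ε : ℝ} (hε : 0 < ε) (f : Dist d) (n : Fin d → ℤ) :
    pair (mollify ζ ε f) (sinTest n) = ζ (ε • latticePt n) * pair f (sinTest n) := by
  obtain ⟨R, hR⟩ := exists_apply_smul_eq_zero hζ hε
  rw [pair_mollify hR, pair_trigDist_sinTest, latticePt_neg, smul_neg, heven, sinTest_neg,
    pair_neg_right]
  split_ifs with h
  · ring
  · rw [hR n h, zero_mul]

/-! ### Moments of the noise -/

/-- The moment of order `2n` of the standard normal distribution. -/
def gaussConst (n : ℕ) : ℝ≥0∞ := ∫⁻ x, ‖x‖ₑ ^ (2 * n) ∂gaussianReal 0 1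

theorem gaussConst_ne_top (n : ℕ) : gaussConst n ≠ ∞ := by
  rcases Nat.eq_zero_or_pos n with rfl | hn
  · simp [gaussConst]
  have h := (memLp_id_gaussianReal (μ := 0) (v := 1) ((2 * n : ℕ) : ℝ≥0)).eLpNorm_lt_top
  rw [eLpNorm_lt_top_iff_lintegral_rpow_enorm_lt_top (by simpa using hn.ne') ENNReal.coe_ne_top] at h
  refine ne_of_lt (lt_of_le_of_lt (le_of_eq (lintegral_congr fun x => ?_)) h)
  rw [ENNReal.coe_toReal, NNReal.coe_natCast, ENNReal.rpow_natCast, id]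

theorem lintegral_gaussianReal_pow (v : ℝ≥0) (n : ℕ) :
    ∫⁻ x, ‖x‖ₑ ^ (2 * n) ∂gaussianReal 0 v = gaussConst n * (v : ℝ≥0∞) ^ n := by
  have h : gaussianReal 0 v = (gaussianReal 0 1).map (fun x => (NNReal.sqrt v : ℝ) * x) := by
    rw [gaussianReal_map_const_mul, gaussianReal_ext_iff]
    refine ⟨by simp, ?_⟩
    ext
    simp
  rw [h, lintegral_map (by fun_prop) (by fun_prop)]
  have e : ∀ x : ℝ, ‖(NNReal.sqrt v : ℝ) * x‖ₑ ^ (2 * n) = (v : ℝ≥0∞) ^ n * ‖x‖ₑ ^ (2 * n) := by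
    intro x
    rw [enorm_mul, mul_pow, pow_mul]
    congr 2
    rw [show ‖(NNReal.sqrt v : ℝ)‖ₑ = (NNReal.sqrt v : ℝ≥0∞) by
      rw [← ofReal_norm, Real.norm_of_nonneg (by positivity), ENNReal.ofReal_coe_nnreal],
      ← ENNReal.coe_pow, NNReal.sq_sqrt]
  simp only [e]
  rw [lintegral_const_mul _ (by fun_prop), gaussConst, mul_comm]

/-- The squared `L²`-norm on `ℝ₊ × 𝕋^d`. -/
def sqNorm (h : ℝ≥0 × Torus d → ℝ) : ℝ≥0∞ := ∫⁻ z, ‖h z‖ₑ ^ 2 ∂noiseMeasure d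

theorem SqIntegrable.smul {h : ℝ≥0 × Torus d → ℝ} (hh : SqIntegrable h) (a : ℝ) :
    SqIntegrable (a • h) := ⟨hh.1.const_smul a, hh.2.const_smul a⟩

theorem SqIntegrable.add {g h : ℝ≥0 × Torus d → ℝ} (hg : SqIntegrable g) (hh : SqIntegrable h) :
    SqIntegrable (g + h) := ⟨hg.1.add hh.1, hg.2.add hh.2⟩

theorem SqIntegrable.sub {g h : ℝ≥0 × Torus d → ℝ} (hg : SqIntegrable g) (hh : SqIntegrable h) :
    SqIntegrable (g - h) := ⟨hg.1.sub hh.1, hg.2.sub hh.2⟩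

theorem sqIntegrable_zero : SqIntegrable (0 : ℝ≥0 × Torus d → ℝ) :=
  ⟨measurable_const, MemLp.zero⟩

theorem sqIntegrable_sum {ι : Type*} (F : Finset ι) {h : ι → ℝ≥0 × Torus d → ℝ}
    (hh : ∀ i, SqIntegrable (h i)) : SqIntegrable (∑ i ∈ F, h i) := by
  classical
  induction F using Finset.induction_on with
  | empty => exact sqIntegrable_zero
  | insert a s ha ih => rw [Finset.sum_insert ha]; exact (hh a).add ih

section Noise

variable {Ω : Type*} [MeasurableSpace Ω] {P : Measure Ω}
  {ξ : (ℝ≥0 × Torus d → ℝ) → Ω → ℝ}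

theorem IsSpaceTimeWhiteNoise.lintegral_pow (hξ : IsSpaceTimeWhiteNoise P ξ)
    {h : ℝ≥0 × Torus d → ℝ} (hh : SqIntegrable h) (n : ℕ) :
    ∫⁻ ω, ‖ξ h ω‖ₑ ^ (2 * n) ∂P = gaussConst n * sqNorm h ^ n := by
  have h1 : ∫⁻ ω, ‖ξ h ω‖ₑ ^ (2 * n) ∂P = ∫⁻ x, ‖x‖ₑ ^ (2 * n) ∂(P.map (ξ h)) := by
    rw [lintegral_map (by fun_prop) (hξ.measurable h hh)]
  rw [h1, hξ.map_eq h hh, lintegral_gaussianReal_pow]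
  congr 2
  change ENNReal.ofReal _ = _
  rw [ofReal_integral_eq_lintegral_ofReal hh.2.integrable_sq (ae_of_all _ fun x => sq_nonneg _)]
  refine lintegral_congr fun z => ?_
  rw [← ofReal_norm, ← ENNReal.ofReal_pow (norm_nonneg _), Real.norm_eq_abs, sq_abs]

theorem IsSpaceTimeWhiteNoise.sub_ae (hξ : IsSpaceTimeWhiteNoise P ξ)
    {g h : ℝ≥0 × Torus d → ℝ} (hg : SqIntegrable g) (hh : SqIntegrable h) :
    ∀ᵐ ω ∂P, ξ (g - h) ω = ξ g ω - ξ h ω := by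
  filter_upwards [hξ.linear g h hg hh 1 (-1)] with ω hω
  rw [show g - h = (1 : ℝ) • g + (-1 : ℝ) • h by simp [sub_eq_add_neg], hω]
  ring

theorem IsSpaceTimeWhiteNoise.sum_ae (hξ : IsSpaceTimeWhiteNoise P ξ) {ι : Type*} (F : Finset ι)
    {h : ι → ℝ≥0 × Torus d → ℝ} (hh : ∀ i, SqIntegrable (h i)) (a : ι → ℝ) :
    ∀ᵐ ω ∂P, ξ (∑ i ∈ F, a i • h i) ω = ∑ i ∈ F, a i * ξ (h i) ω := by
  classical
  induction F using Finset.induction_on with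
  | empty =>
    filter_upwards [hξ.linear 0 0 sqIntegrable_zero sqIntegrable_zero 0 0] with ω hω
    simpa using hω
  | insert i s hi ih =>
    filter_upwards [ih, hξ.linear (h i) (∑ i ∈ s, a i • h i) (hh i)
      (sqIntegrable_sum s fun i => (hh i).smul (a i)) (a i) 1] with ω h1 h2
    rw [Finset.sum_insert hi, Finset.sum_insert hi, ← h1, ← one_mul (ξ (∑ i ∈ s, a i • h i) ω), ← h2,
      one_smul]

end Noise

/-! ### The bilaplacian semigroup -/

theorem one_add_norm_le (m : Fin d → ℤ) : 1 + ‖m‖ ≤ 1 + eigen m := by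
  have h1 : ‖m‖ ≤ ‖latticePt m‖ := by
    refine (pi_norm_le_iff_of_nonneg (norm_nonneg _)).2 fun i => ?_
    rw [Int.norm_eq_abs]
    exact_mod_cast abs_le_norm_latticePt m i
  rcases eq_or_ne m 0 with rfl | hm
  · simp [eigen_nonneg]
  · have h2 : 1 ≤ ‖m‖ := by
      obtain ⟨i, hi⟩ := Function.ne_iff.1 hm
      refine le_trans ?_ (norm_le_pi_norm m i)
      rw [Int.norm_eq_abs]
      exact_mod_cast Int.one_le_abs hi
    have h3 : ‖latticePt m‖ ≤ ‖(2 * Real.pi) • latticePt m‖ := by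
      rw [norm_smul, Real.norm_of_nonneg (by positivity)]
      nlinarith [Real.pi_gt_three, norm_nonneg (latticePt m)]
    have h4 : ‖m‖ ≤ ‖(2 * Real.pi) • latticePt m‖ := h1.trans h3
    have h5 : ‖(2 * Real.pi) • latticePt m‖ ≤ eigen m :=
      le_self_pow₀ (h2.trans h4) (by norm_num)
    linarith

/-- The bound `x^k / k! ≤ exp x` is applied to `x = s(1 + λ)` instead of `sλ`, so that the zero
eigenvalue causes no division by zero; the price is the factor `exp s` in the constant. -/
theorem summable_exp_eigen {s : ℝ} (hs : 0 < s) :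
    Summable fun m : Fin d → ℤ => Real.exp (-s * eigen m) := by
  set C := Real.exp s * (2 * d).factorial / s ^ (2 * d)
  refine Summable.of_nonneg_of_le (fun m => (Real.exp_pos _).le) (fun m => ?_)
    ((summable_lattice d).mul_left C)
  have h0 := eigen_nonneg m
  have h1 := Real.pow_div_factorial_le_exp (s * (1 + eigen m)) (by positivity) (2 * d)
  have h2 : (1 + ‖m‖) ^ (2 * d) ≤ (1 + eigen m) ^ (2 * d) := by
    have := one_add_norm_le m
    gcongr
  have h3 : Real.exp (-s * eigen m) = Real.exp s / Real.exp (s * (1 + eigen m)) := by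
    rw [← Real.exp_sub]; ring_nf
  rw [h3]
  calc Real.exp s / Real.exp (s * (1 + eigen m))
      ≤ Real.exp s / ((s * (1 + eigen m)) ^ (2 * d) / (2 * d).factorial) := by gcongr
    _ = C * ((1 + eigen m) ^ (2 * d))⁻¹ := by
        rw [mul_pow]
        simp only [C]
        field_simp
    _ ≤ _ := by
        have : 0 ≤ C := by positivity
        gcongr

/-- The `m`-th term of the Fourier series of a test function. -/
def fourierTerm (φ : TestFun d) (m : Fin d → ℤ) (x : Torus d) : ℝ :=
  cosChar m x * pair (cosDist m) φ + sinChar m x * pair (sinDist m) φ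

theorem abs_fourierTerm_le (φ : TestFun d) (m : Fin d → ℤ) (x : Torus d) :
    |fourierTerm φ m x| ≤ 2 * decayConst φ * ((1 + ‖m‖) ^ (4 * d))⁻¹ := by
  have h1 := abs_pair_cosDist_le m φ
  have h2 := abs_pair_sinDist_le m φ
  calc |fourierTerm φ m x| ≤ |cosChar m x| * |pair (cosDist m) φ|
        + |sinChar m x| * |pair (sinDist m) φ| := by
        rw [← abs_mul, ← abs_mul]; exact abs_add_le _ _
    _ ≤ 1 * (decayConst φ * ((1 + ‖m‖) ^ (4 * d))⁻¹)
        + 1 * (decayConst φ * ((1 + ‖m‖) ^ (4 * d))⁻¹) := by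
        have h3 := abs_cosChar_le_one m x
        have h4 := abs_sinChar_le_one m x
        gcongr
    _ = _ := by ring

theorem summable_decay (φ : TestFun d) :
    Summable fun m : Fin d → ℤ => 2 * decayConst φ * ((1 + ‖m‖) ^ (4 * d))⁻¹ := by
  refine Summable.mul_left _ (Summable.of_nonneg_of_le (fun m => by positivity) (fun m => ?_)
    (summable_lattice d))
  gcongr
  · linarith [norm_nonneg m]
  · omega

theorem abs_exp_mul_fourierTerm_le (φ : TestFun d) (s : ℝ≥0) (m : Fin d → ℤ) (x : Torus d) :
    |Real.exp (-s * eigen m) * fourierTerm φ m x|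
      ≤ 2 * decayConst φ * ((1 + ‖m‖) ^ (4 * d))⁻¹ := by
  have h0 : Real.exp (-s * eigen m) ≤ 1 := by
    rw [Real.exp_le_one_iff, neg_mul]
    have := eigen_nonneg m
    exact neg_nonpos.2 (by positivity)
  rw [abs_mul, Real.abs_exp]
  exact (mul_le_of_le_one_left (abs_nonneg _) h0).trans (abs_fourierTerm_le φ m x)

theorem cosChar_apply_sub (m : Fin d → ℤ) (x y : Torus d) :
    cosChar m (x - y) = cosChar m x * cosChar m y + sinChar m x * sinChar m y :=
  congrFun (congrArg Subtype.val (reflectTranslate_cosTest m x)) y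

theorem exists_abs_le (φ : TestFun d) : ∃ B : ℝ, 0 ≤ B ∧ ∀ x, |(φ : Torus d → ℝ) x| ≤ B := by
  obtain ⟨C, hC⟩ := (isCompact_range (testFun_continuous φ)).isBounded.exists_norm_le
  exact ⟨C, (norm_nonneg _).trans (hC _ ⟨0, rfl⟩), fun x => hC _ ⟨x, rfl⟩⟩

/-- For positive time the kernel series converges absolutely and may be integrated term by term. The
case `s = 0` would be Fourier inversion; it is not needed, because in the noise integrals it occurs
only at the single instant `q = r`. -/
theorem heatSemigroup_eq_tsum {s : ℝ≥0} (hs : s ≠ 0) (φ : TestFun d) (x : Torus d) :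
    heatSemigroup s (φ : Torus d → ℝ) x
      = ∑' m : Fin d → ℤ, Real.exp (-s * eigen m) * fourierTerm φ m x := by
  obtain ⟨B, hB0, hB⟩ := exists_abs_le φ
  have hspos : (0 : ℝ) < s := by positivity
  rw [heatSemigroup, if_neg hs]
  have e1 : ∀ y, heatKernel (s : ℝ) (x - y) * (φ : Torus d → ℝ) y
      = ∑' m : Fin d → ℤ, cosChar m (x - y) * Real.exp (-s * eigen m) * (φ : Torus d → ℝ) y := by
    intro y
    rw [heatKernel, ← tsum_mul_right]
    rfl
  have hcont : ∀ m : Fin d → ℤ, Continuous fun y : Torus d =>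
      cosChar m (x - y) * Real.exp (-s * eigen m) * (φ : Torus d → ℝ) y := fun m =>
    (((continuous_cosChar m).comp (continuous_const.sub continuous_id)).mul
      continuous_const).mul (testFun_continuous φ)
  have hbound : ∀ (m : Fin d → ℤ) (y : Torus d),
      ‖cosChar m (x - y) * Real.exp (-s * eigen m) * (φ : Torus d → ℝ) y‖
        ≤ Real.exp (-s * eigen m) * B := by
    intro m y
    rw [norm_mul, norm_mul, Real.norm_eq_abs, Real.norm_eq_abs, Real.norm_eq_abs, Real.abs_exp]
    exact mul_le_mul (mul_le_of_le_one_left (Real.exp_pos _).le (abs_cosChar_le_one m _)) (hB y)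
      (abs_nonneg _) (Real.exp_pos _).le
  simp only [e1]
  rw [← integral_tsum_of_summable_integral_norm (fun m => integrable_continuous (hcont m))]
  · refine tsum_congr fun m => ?_
    have e2 : ∀ y, cosChar m (x - y) * Real.exp (-s * eigen m) * (φ : Torus d → ℝ) y
        = Real.exp (-s * eigen m) * cosChar m x * (cosChar m y * (φ : Torus d → ℝ) y)
        + Real.exp (-s * eigen m) * sinChar m x * (sinChar m y * (φ : Torus d → ℝ) y) := fun y => by
      rw [cosChar_apply_sub]; ring
    simp only [e2]
    rw [integral_add, integral_const_mul, integral_const_mul, fourierTerm, pair_cosDist,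
      pair_sinDist]
    · ring
    · exact (integrable_continuous
        ((continuous_cosChar m).mul (testFun_continuous φ))).const_mul _
    · exact (integrable_continuous
        ((continuous_sinChar m).mul (testFun_continuous φ))).const_mul _
  · refine Summable.of_nonneg_of_le (fun m => integral_nonneg fun y => norm_nonneg _) (fun m => ?_)
      ((summable_exp_eigen hspos).mul_right B)
    calc ∫ y, ‖cosChar m (x - y) * Real.exp (-s * eigen m) * (φ : Torus d → ℝ) y‖ ∂torusMeasure d
        ≤ ∫ _, Real.exp (-s * eigen m) * B ∂torusMeasure d :=
          integral_mono (integrable_continuous (hcont m).norm) (integrable_const _) (hbound m)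
      _ = _ := by simp

theorem exists_abs_heatSemigroup_le (φ : TestFun d) :
    ∃ B : ℝ, 0 ≤ B ∧ ∀ (s : ℝ≥0) (x : Torus d), |heatSemigroup s (φ : Torus d → ℝ) x| ≤ B := by
  obtain ⟨B, hB0, hB⟩ := exists_abs_le φ
  have hS : 0 ≤ ∑' m : Fin d → ℤ, 2 * decayConst φ * ((1 + ‖m‖) ^ (4 * d))⁻¹ :=
    tsum_nonneg fun m => by have := decayConst_nonneg φ; positivity
  refine ⟨B + ∑' m : Fin d → ℤ, 2 * decayConst φ * ((1 + ‖m‖) ^ (4 * d))⁻¹, by positivity,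
    fun s x => ?_⟩
  by_cases hs : s = 0
  · rw [heatSemigroup, if_pos hs]
    linarith [hB x]
  · rw [heatSemigroup_eq_tsum hs]
    have := tsum_of_norm_bounded (f := fun m => Real.exp (-s * eigen m) * fourierTerm φ m x)
      (summable_decay φ).hasSum fun m => abs_exp_mul_fourierTerm_le φ s m x
    rw [Real.norm_eq_abs] at this
    linarith

theorem measurable_heatSemigroup (φ : TestFun d) :
    Measurable fun p : ℝ≥0 × Torus d => heatSemigroup p.1 (φ : Torus d → ℝ) p.2 := by
  have h1 : (fun p : ℝ≥0 × Torus d => heatSemigroup p.1 (φ : Torus d → ℝ) p.2)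
      = fun p => if p.1 = 0 then (φ : Torus d → ℝ) p.2
        else ∑' m : Fin d → ℤ, Real.exp (-p.1 * eigen m) * fourierTerm φ m p.2 := by
    funext p
    split_ifs with h
    · rw [heatSemigroup, if_pos h]
    · rw [heatSemigroup_eq_tsum h]
  rw [h1]
  refine Measurable.ite (measurable_fst (measurableSet_singleton 0))
    ((testFun_continuous φ).measurable.comp measurable_snd) (Measurable.tsum fun m => ?_)
  have h2 := (continuous_cosChar m).measurable
  have h3 := (continuous_sinChar m).measurable
  unfold fourierTerm
  fun_prop

/-! ### The integrand of the stochastic convolution -/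

/-- The integrand of the stochastic convolution. -/
def convKernel (r : ℝ≥0) (φ : Torus d → ℝ) : ℝ≥0 × Torus d → ℝ :=
  (Set.Icc 0 r ×ˢ Set.univ).indicator fun p => heatSemigroup (r - p.1) φ p.2

theorem convKernel_of_lt {r s : ℝ≥0} (h : r < s) (φ : Torus d → ℝ) (x : Torus d) :
    convKernel r φ (s, x) = 0 :=
  Set.indicator_of_notMem (fun hmem => absurd hmem.1.2 (not_le.2 h)) _

theorem convKernel_of_gt {r s : ℝ≥0} (h : s < r) (φ : TestFun d) (x : Torus d) :
    convKernel r (φ : Torus d → ℝ) (s, x)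
      = ∑' m : Fin d → ℤ, Real.exp (-(r - s : ℝ≥0) * eigen m) * fourierTerm φ m x := by
  have hmem : (s, x) ∈ Set.Icc 0 r ×ˢ (Set.univ : Set (Torus d)) :=
    ⟨⟨zero_le, h.le⟩, Set.mem_univ _⟩
  rw [convKernel, Set.indicator_of_mem hmem, heatSemigroup_eq_tsum (tsub_pos_of_lt h).ne']

theorem fourierTerm_cosTest (n m : Fin d → ℤ) (x : Torus d) :
    fourierTerm (cosTest n) m x = cosChar n x * (delta m n + delta m (-n)) / 2 := by
  rw [fourierTerm, pair_cosDist_cosTest, pair_sinDist_cosTest]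
  unfold delta
  split_ifs with h1 h2 h2
  · rw [h1]; ring
  · rw [h1]; ring
  · rw [h2, cosChar_neg]; ring
  · simp

theorem fourierTerm_sinTest (n m : Fin d → ℤ) (x : Torus d) :
    fourierTerm (sinTest n) m x = sinChar n x * (delta m n + delta m (-n)) / 2 := by
  rw [fourierTerm, pair_cosDist_sinTest, pair_sinDist_sinTest]
  unfold delta
  split_ifs with h1 h2 h2
  -- When `n = -n`, the pairing of sines vanishes while the right side is `sinChar n x`; the two
  -- agree because this sine is zero.
  · have h3 : sinChar n x = 0 := by
      have h4 : sinChar n x = -sinChar n x := by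
        nth_rw 1 [← h1, h2, sinChar_neg]; rfl
      linarith
    rw [h1, h3]; ring
  · rw [h1]; ring
  · rw [h2, sinChar_neg, Pi.neg_apply]; ring
  · simp

theorem tsum_exp_mul_delta (t a : ℝ) (n : Fin d → ℤ) :
    ∑' m : Fin d → ℤ, Real.exp (t * eigen m) * (a * (delta m n + delta m (-n)) / 2)
      = Real.exp (t * eigen n) * a := by
  have h := ((hasSum_mul_delta (fun m => Real.exp (t * eigen m) * (a / 2)) n).add
    (hasSum_mul_delta (fun m => Real.exp (t * eigen m) * (a / 2)) (-n)))
  rw [eigen_neg] at h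
  rw [show Real.exp (t * eigen n) * a
    = Real.exp (t * eigen n) * (a / 2) + Real.exp (t * eigen n) * (a / 2) by ring, ← h.tsum_eq]
  exact tsum_congr fun m => by ring

/-- The decay in time of the `m`-th Fourier mode. -/
def modeKernel (m : Fin d → ℤ) (r s : ℝ≥0) : ℝ :=
  if s < r then Real.exp (-((r : ℝ) - s) * eigen m) else 0

theorem convKernel_cosChar {r s : ℝ≥0} (h : s ≠ r) (n : Fin d → ℤ) (x : Torus d) :
    convKernel r (cosChar n) (s, x) = modeKernel n r s * cosChar n x := by
  rcases lt_or_gt_of_ne h with h | h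
  · have := convKernel_of_gt h (cosTest n) x
    simp only [fourierTerm_cosTest, tsum_exp_mul_delta] at this
    rw [modeKernel, if_pos h, ← NNReal.coe_sub h.le, ← this]
    rfl
  · rw [convKernel_of_lt h, modeKernel, if_neg h.not_gt, zero_mul]

theorem convKernel_sinChar {r s : ℝ≥0} (h : s ≠ r) (n : Fin d → ℤ) (x : Torus d) :
    convKernel r (sinChar n) (s, x) = modeKernel n r s * sinChar n x := by
  rcases lt_or_gt_of_ne h with h | h
  · have := convKernel_of_gt h (sinTest n) x
    simp only [fourierTerm_sinTest, tsum_exp_mul_delta] at this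
    rw [modeKernel, if_pos h, ← NNReal.coe_sub h.le, ← this]
    rfl
  · rw [convKernel_of_lt h, modeKernel, if_neg h.not_gt, zero_mul]

/-- Lebesgue measure on `ℝ₊`. -/
def timeMeasure : Measure ℝ≥0 := Measure.comap ((↑) : ℝ≥0 → ℝ) volume

theorem noiseMeasure_eq (d : ℕ) : noiseMeasure d = timeMeasure.prod (torusMeasure d) := rfl

theorem measurableEmbedding_coe : MeasurableEmbedding ((↑) : ℝ≥0 → ℝ) :=
  MeasurableEmbedding.subtype_coe measurableSet_Ici

theorem lintegral_timeMeasure_le (f : ℝ → ℝ≥0∞) :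
    ∫⁻ s : ℝ≥0, f s ∂timeMeasure ≤ ∫⁻ x, f x := by
  rw [timeMeasure, ← measurableEmbedding_coe.lintegral_map, measurableEmbedding_coe.map_comap]
  exact setLIntegral_le_lintegral _ _

theorem timeMeasure_apply (s : Set ℝ≥0) : timeMeasure s = volume (((↑) : ℝ≥0 → ℝ) '' s) :=
  measurableEmbedding_coe.comap_apply _ _

theorem ae_ne_time (r : ℝ≥0) : ∀ᵐ s ∂timeMeasure, s ≠ r := by
  rw [ae_iff]
  simp only [ne_eq, not_not, Set.ofPred_eq_eq_singleton]
  rw [timeMeasure_apply, Set.image_singleton, Real.volume_singleton]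

theorem timeMeasure_Icc (r : ℝ≥0) : timeMeasure (Set.Icc 0 r) ≤ r := by
  rw [timeMeasure_apply]
  refine (measure_mono (t := Set.Icc (0 : ℝ) r) ?_).trans ?_
  · rintro _ ⟨y, hy, rfl⟩
    exact ⟨y.2, by exact_mod_cast hy.2⟩
  · rw [Real.volume_Icc, sub_zero, ENNReal.ofReal_coe_nnreal]

theorem sqNorm_eq {h : ℝ≥0 × Torus d → ℝ} (hh : Measurable h) :
    sqNorm h = ∫⁻ s, ∫⁻ x, ‖h (s, x)‖ₑ ^ 2 ∂torusMeasure d ∂timeMeasure := by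
  rw [sqNorm, noiseMeasure_eq, lintegral_prod _ (by fun_prop)]

theorem measurable_convKernel (r : ℝ≥0) (φ : TestFun d) :
    Measurable (convKernel r (φ : Torus d → ℝ)) := by
  refine Measurable.indicator ?_ (measurableSet_Icc.prod MeasurableSet.univ)
  exact (measurable_heatSemigroup φ).comp
    (f := fun p : ℝ≥0 × Torus d => ((r - p.1, p.2) : ℝ≥0 × Torus d)) (by fun_prop)

theorem sqIntegrable_convKernel (r : ℝ≥0) (φ : TestFun d) :
    SqIntegrable (convKernel r (φ : Torus d → ℝ)) := by
  obtain ⟨B, hB0, hB⟩ := exists_abs_heatSemigroup_le φ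
  refine ⟨measurable_convKernel r φ, ?_⟩
  have hfin : noiseMeasure d (Set.Icc 0 r ×ˢ Set.univ) ≠ ∞ := by
    rw [noiseMeasure_eq, Measure.prod_prod, measure_univ, mul_one]
    exact ne_top_of_le_ne_top ENNReal.coe_ne_top (timeMeasure_Icc r)
  unfold convKernel
  rw [memLp_indicator_iff_restrict (measurableSet_Icc.prod MeasurableSet.univ)]
  have : IsFiniteMeasure ((noiseMeasure d).restrict (Set.Icc 0 r ×ˢ Set.univ)) :=
    isFiniteMeasure_restrict.2 hfin
  refine MemLp.of_bound ?_ B (ae_of_all _ fun p => hB _ _)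
  exact ((measurable_heatSemigroup φ).comp
    (f := fun p : ℝ≥0 × Torus d => ((r - p.1, p.2) : ℝ≥0 × Torus d))
    (by fun_prop)).aestronglyMeasurable

/-! ### The variance of the increments of the Fourier modes -/

theorem lintegral_exp_Iic {a : ℝ} (ha : 0 < a) (c : ℝ) :
    ∫⁻ x in Set.Iic c, ENNReal.ofReal (Real.exp (a * (x - c))) = ENNReal.ofReal (1 / a) := by
  have e : ∀ x, Real.exp (a * (x - c)) = Real.exp (a * x) * Real.exp (-(a * c)) := fun x => by
    rw [← Real.exp_add]; ring_nf
  simp only [e]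
  rw [← ofReal_integral_eq_lintegral_ofReal ((integrableOn_exp_mul_Iic ha c).mul_const _)
    (ae_of_all _ fun x => by positivity), integral_mul_const, integral_exp_mul_Iic ha, div_mul_eq_mul_div,
    ← Real.exp_add, add_neg_cancel, Real.exp_zero]

theorem measurable_modeKernel (m : Fin d → ℤ) (r : ℝ≥0) : Measurable (modeKernel m r) := by
  unfold modeKernel
  exact Measurable.ite measurableSet_Iio (by fun_prop) measurable_const

/-- Before time `s` the difference of the two exponentials factors as `1 - exp(-(t-s)λ)` times the
kernel at `s`, up to sign. Between `s` and `t` only the kernel at `t` is present, and afterwards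
both vanish. The bound is written with functions on `ℝ`, where the exponential integrals are
available. -/
theorem sq_modeKernel_sub_le (m : Fin d → ℤ) {s t : ℝ≥0} (hst : s ≤ t) (q : ℝ≥0) :
    ‖modeKernel m t q - modeKernel m s q‖ₑ ^ 2
      ≤ ENNReal.ofReal ((1 - Real.exp (-((t - s : ℝ) * eigen m))) ^ 2) *
        (Set.Iic (s : ℝ)).indicator (fun x => ENNReal.ofReal (Real.exp (2 * eigen m * (x - s)))) q
      + (Set.Ico (s : ℝ) t).indicator
        (fun x => ENNReal.ofReal (Real.exp (2 * eigen m * (x - t)))) q := by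
  have e : ∀ x : ℝ, ‖x‖ₑ ^ 2 = ENNReal.ofReal (x ^ 2) := fun x => by
    rw [← ofReal_norm, ← ENNReal.ofReal_pow (norm_nonneg _), Real.norm_eq_abs, sq_abs]
  rw [e]
  rcases lt_or_ge q s with h | h
  · refine le_add_right ?_
    rw [modeKernel, modeKernel, if_pos h, if_pos (h.trans_le hst),
      Set.indicator_of_mem (Set.mem_Iic.2 (by exact_mod_cast h.le)),
      ← ENNReal.ofReal_mul (sq_nonneg _)]
    refine ENNReal.ofReal_le_ofReal (le_of_eq ?_)
    have e1 : Real.exp (-((t : ℝ) - q) * eigen m)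
        = Real.exp (-((t - s : ℝ) * eigen m)) * Real.exp ((q - s) * eigen m) := by
      rw [← Real.exp_add]; ring_nf
    have e2 : Real.exp (-((s : ℝ) - q) * eigen m) = Real.exp ((q - s) * eigen m) := by ring_nf
    have e3 : Real.exp (2 * eigen m * (q - s)) = Real.exp ((q - s) * eigen m) ^ 2 := by
      rw [← Real.exp_nat_mul]; push_cast; ring_nf
    rw [e1, e2, e3]
    ring
  · rcases lt_or_ge q t with h' | h'
    · refine le_add_left ?_
      rw [modeKernel, modeKernel, if_pos h', if_neg h.not_gt,
        Set.indicator_of_mem (Set.mem_Ico.2 ⟨by exact_mod_cast h, by exact_mod_cast h'⟩), sub_zero]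
      refine ENNReal.ofReal_le_ofReal (le_of_eq ?_)
      rw [← Real.exp_nat_mul]; push_cast; ring_nf
    · rw [modeKernel, modeKernel, if_neg h'.not_gt, if_neg h.not_gt]
      simp

/-- Two competing bounds. The new noise on `[s, t]` and the damping of the old noise, by `(1 -
exp(-δλ))² ≤ δλ`, each contribute at most `δ`. Alternatively, each is at most the full exponential
integral `1/(2λ)`. -/
theorem lintegral_sq_modeKernel_sub_le (m : Fin d → ℤ) {s t : ℝ≥0} (hst : s ≤ t)
    (hts : t ≤ s + 1) {L : ℝ} (hL1 : 1 ≤ L) (hL : L ≤ max 1 (eigen m)) :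
    ∫⁻ q, ‖modeKernel m t q - modeKernel m s q‖ₑ ^ 2 ∂timeMeasure
      ≤ ENNReal.ofReal (2 * min (t - s : ℝ) L⁻¹) := by
  set l := eigen m with hl
  set δ : ℝ := t - s with hδ
  have hl0 : 0 ≤ l := eigen_nonneg m
  have hδ0 : 0 ≤ δ := sub_nonneg.2 (by exact_mod_cast hst)
  have hδ1 : δ ≤ 1 := by
    have : (t : ℝ) ≤ s + 1 := by exact_mod_cast hts
    linarith
  set A := (1 - Real.exp (-(δ * l))) ^ 2 with hA
  have hx0 : 0 ≤ 1 - Real.exp (-(δ * l)) := by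
    rw [sub_nonneg, Real.exp_le_one_iff]; exact neg_nonpos.2 (by positivity)
  have hx1 : 1 - Real.exp (-(δ * l)) ≤ 1 := by linarith [Real.exp_pos (-(δ * l))]
  have hx2 : 1 - Real.exp (-(δ * l)) ≤ δ * l := by linarith [Real.add_one_le_exp (-(δ * l))]
  have hA1 : A ≤ 1 := pow_le_one₀ hx0 hx1
  have hA2 : A ≤ δ * l := by rw [hA, sq]; nlinarith
  have hV : ∫⁻ q, ‖modeKernel m t q - modeKernel m s q‖ₑ ^ 2 ∂timeMeasure
      ≤ ENNReal.ofReal A * (∫⁻ x in Set.Iic (s : ℝ), ENNReal.ofReal (Real.exp (2 * l * (x - s))))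
        + ∫⁻ x in Set.Ico (s : ℝ) t, ENNReal.ofReal (Real.exp (2 * l * (x - t))) := by
    refine (lintegral_mono fun q => sq_modeKernel_sub_le m hst q).trans ?_
    refine (lintegral_timeMeasure_le (fun x => ENNReal.ofReal A *
        (Set.Iic (s : ℝ)).indicator (fun x => ENNReal.ofReal (Real.exp (2 * l * (x - s)))) x
      + (Set.Ico (s : ℝ) t).indicator
        (fun x => ENNReal.ofReal (Real.exp (2 * l * (x - t)))) x)).trans ?_
    rw [lintegral_add_right _ (Measurable.indicator (by fun_prop) measurableSet_Ico),
      lintegral_const_mul _ (Measurable.indicator (by fun_prop) measurableSet_Iic),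
      lintegral_indicator measurableSet_Iic, lintegral_indicator measurableSet_Ico]
  have hS1 : ∫⁻ x in Set.Ico (s : ℝ) t, ENNReal.ofReal (Real.exp (2 * l * (x - t)))
      ≤ ENNReal.ofReal δ := by
    calc _ ≤ ∫⁻ _ in Set.Ico (s : ℝ) t, 1 := by
          refine setLIntegral_mono measurable_const fun x hx => ?_
          rw [← ENNReal.ofReal_one]
          refine ENNReal.ofReal_le_ofReal ?_
          rw [Real.exp_le_one_iff]
          exact mul_nonpos_of_nonneg_of_nonpos (by positivity) (by linarith [hx.2])
      _ = _ := by rw [setLIntegral_one, Real.volume_Ico]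
  have h1 : ∫⁻ q, ‖modeKernel m t q - modeKernel m s q‖ₑ ^ 2 ∂timeMeasure
      ≤ ENNReal.ofReal (2 * δ) := by
    refine hV.trans ?_
    rw [two_mul δ, ENNReal.ofReal_add hδ0 hδ0]
    refine add_le_add ?_ hS1
    -- For eigenvalue `0` the half-line integral is infinite, but its prefactor `A` vanishes.
    rcases hl0.eq_or_lt with h0 | h0
    · have : A = 0 := by rw [hA, ← h0]; simp
      rw [this, ENNReal.ofReal_zero, zero_mul]
      exact zero_le
    · rw [lintegral_exp_Iic (by positivity), ← ENNReal.ofReal_mul (sq_nonneg _)]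
      refine ENNReal.ofReal_le_ofReal ?_
      calc A * (1 / (2 * l)) ≤ δ * l * (1 / (2 * l)) := by gcongr
        _ = δ / 2 := by field_simp
        _ ≤ δ := by linarith
  -- For small eigenvalues `L` must equal `1`, and the minimum is `δ` because `δ ≤ 1`; this is where
  -- the restriction to time steps of length at most one enters.
  rcases le_or_gt l 1 with hl1 | hl1
  · rw [max_eq_left hl1] at hL
    rw [le_antisymm hL hL1, inv_one, min_eq_left hδ1]
    exact h1
  rw [max_eq_right hl1.le] at hL
  have hl00 : 0 < l := by linarith
  have h2 : ∫⁻ q, ‖modeKernel m t q - modeKernel m s q‖ₑ ^ 2 ∂timeMeasure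
      ≤ ENNReal.ofReal (2 * L⁻¹) := by
    refine hV.trans ?_
    have h3 : ∫⁻ x in Set.Ico (s : ℝ) t, ENNReal.ofReal (Real.exp (2 * l * (x - t)))
        ≤ ENNReal.ofReal (1 / (2 * l)) := by
      rw [← lintegral_exp_Iic (by positivity) (t : ℝ)]
      exact lintegral_mono_set fun x hx => hx.2.le
    have h4 : 1 / (2 * l) ≤ L⁻¹ := by
      rw [one_div]
      exact inv_anti₀ (by linarith) (by linarith)
    rw [two_mul L⁻¹, ENNReal.ofReal_add (by positivity) (by positivity)]
    refine add_le_add ?_ (h3.trans (ENNReal.ofReal_le_ofReal h4))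
    rw [lintegral_exp_Iic (by positivity), ← ENNReal.ofReal_mul (sq_nonneg _)]
    refine ENNReal.ofReal_le_ofReal (le_trans ?_ h4)
    exact mul_le_of_le_one_left (by positivity) hA1
  rcases le_total δ L⁻¹ with hm | hm
  · rw [min_eq_left hm]; exact h1
  · rw [min_eq_right hm]; exact h2

/-! ### Trigonometric polynomials of the stochastic convolution -/

/-- The integrand whose noise integral is `∑ (u_m X_r(cos_m) + v_m X_r(sin_m))`. -/
def trigKernel (F : Finset (Fin d → ℤ)) (u v : (Fin d → ℤ) → ℝ) (r : ℝ≥0) :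
    ℝ≥0 × Torus d → ℝ :=
  ∑ m ∈ F, u m • convKernel r (cosChar m) + ∑ m ∈ F, v m • convKernel r (sinChar m)

theorem sqIntegrable_convKernel_cosChar (r : ℝ≥0) (m : Fin d → ℤ) :
    SqIntegrable (convKernel r (cosChar m)) := sqIntegrable_convKernel r (cosTest m)

theorem sqIntegrable_convKernel_sinChar (r : ℝ≥0) (m : Fin d → ℤ) :
    SqIntegrable (convKernel r (sinChar m)) := sqIntegrable_convKernel r (sinTest m)

theorem sqIntegrable_trigKernel (F : Finset (Fin d → ℤ)) (u v : (Fin d → ℤ) → ℝ) (r : ℝ≥0) :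
    SqIntegrable (trigKernel F u v r) :=
  (sqIntegrable_sum F fun m => (sqIntegrable_convKernel_cosChar r m).smul (u m)).add
    (sqIntegrable_sum F fun m => (sqIntegrable_convKernel_sinChar r m).smul (v m))

theorem trigKernel_apply (F : Finset (Fin d → ℤ)) (u v : (Fin d → ℤ) → ℝ) {r q : ℝ≥0}
    (h : q ≠ r) (x : Torus d) : trigKernel F u v r (q, x)
      = ∑ m ∈ F, modeKernel m r q * (u m * cosChar m x + v m * sinChar m x) := by
  simp only [trigKernel, Pi.add_apply, Finset.sum_apply, Pi.smul_apply, smul_eq_mul,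
    convKernel_cosChar h, convKernel_sinChar h, ← Finset.sum_add_distrib]
  exact Finset.sum_congr rfl fun m _ => by ring

/-- At each fixed time, Bessel's inequality decouples the modes in space; the time integral is then
estimated mode by mode. Modes with zero coefficients are exempt from the lower bound on the
eigenvalue, so that a whole box of frequencies may serve as index set for an annulus. -/
theorem sqNorm_trigKernel_sub_le (F : Finset (Fin d → ℤ)) (u v : (Fin d → ℤ) → ℝ) {s t : ℝ≥0}
    (hst : s ≤ t) (hts : t ≤ s + 1) {L : ℝ} (hL1 : 1 ≤ L)
    (hL : ∀ m ∈ F, L ≤ max 1 (eigen m) ∨ (u m = 0 ∧ v m = 0)) :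
    sqNorm (trigKernel F u v t - trigKernel F u v s)
      ≤ ENNReal.ofReal ((∑ m ∈ F, (u m ^ 2 + v m ^ 2)) * (2 * min (t - s : ℝ) L⁻¹)) := by
  have hδ0 : (0 : ℝ) ≤ t - s := sub_nonneg.2 (by exact_mod_cast hst)
  have hmin : 0 ≤ 2 * min (t - s : ℝ) L⁻¹ :=
    mul_nonneg two_pos.le (le_min hδ0 (inv_nonneg.2 (by linarith)))
  rw [sqNorm_eq ((sqIntegrable_trigKernel F u v t).sub (sqIntegrable_trigKernel F u v s)).1]
  have hinner : ∀ᵐ q ∂timeMeasure,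
      ∫⁻ x, ‖(trigKernel F u v t - trigKernel F u v s) (q, x)‖ₑ ^ 2 ∂torusMeasure d
        ≤ ∑ m ∈ F, ENNReal.ofReal (u m ^ 2 + v m ^ 2) *
          ‖modeKernel m t q - modeKernel m s q‖ₑ ^ 2 := by
    filter_upwards [ae_ne_time t, ae_ne_time s] with q hqt hqs
    have e : ∀ x : Torus d, ‖(trigKernel F u v t - trigKernel F u v s) (q, x)‖ₑ ^ 2
        = ENNReal.ofReal ((∑ m ∈ F, ((modeKernel m t q - modeKernel m s q) * u m * cosChar m x
          + (modeKernel m t q - modeKernel m s q) * v m * sinChar m x)) ^ 2) := by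
      intro x
      rw [Pi.sub_apply, trigKernel_apply F u v hqt, trigKernel_apply F u v hqs,
        ← Finset.sum_sub_distrib, ← ofReal_norm, ← ENNReal.ofReal_pow (norm_nonneg _),
        Real.norm_eq_abs, sq_abs]
      congr 2
      exact Finset.sum_congr rfl fun m _ => by ring
    simp only [e]
    rw [← ofReal_integral_eq_lintegral_ofReal _ (ae_of_all _ fun x => sq_nonneg _)]
    · refine (ENNReal.ofReal_le_ofReal (integral_trigSum_sq_le F _ _)).trans (le_of_eq ?_)
      rw [ENNReal.ofReal_sum_of_nonneg fun m _ => by positivity]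
      refine Finset.sum_congr rfl fun m _ => ?_
      rw [← ofReal_norm, ← ENNReal.ofReal_pow (norm_nonneg _), Real.norm_eq_abs, sq_abs,
        ← ENNReal.ofReal_mul (by positivity)]
      congr 1
      ring
    · refine integrable_continuous (Continuous.pow (continuous_finsetSum _ fun m _ => ?_) 2)
      exact (continuous_const.mul (continuous_cosChar m)).add
        (continuous_const.mul (continuous_sinChar m))
  refine (lintegral_mono_ae hinner).trans ?_
  have hmeas : ∀ m : Fin d → ℤ, Measurable fun q =>
      ‖modeKernel m t q - modeKernel m s q‖ₑ ^ 2 := fun m =>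
    (((measurable_modeKernel m t).sub (measurable_modeKernel m s)).enorm).pow_const 2
  rw [lintegral_finsetSum _ fun m _ => (hmeas m).const_mul _, Finset.sum_mul,
    ENNReal.ofReal_sum_of_nonneg fun m _ => by positivity]
  refine Finset.sum_le_sum fun m hm => ?_
  rw [lintegral_const_mul _ (hmeas m), ENNReal.ofReal_mul (by positivity)]
  rcases hL m hm with h | ⟨h1, h2⟩
  · exact mul_le_mul_right (lintegral_sq_modeKernel_sub_le m hst hts hL1 h) _
  · simp [h1, h2]

/-! ### Moments of the increments, and the Fourier series of the stochastic convolution. -/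

section Noise

variable {Ω : Type*} [MeasurableSpace Ω] {P : Measure Ω}
  {ξ : (ℝ≥0 × Torus d → ℝ) → Ω → ℝ}

theorem IsSpaceTimeWhiteNoise.trigKernel_ae (hξ : IsSpaceTimeWhiteNoise P ξ)
    (F : Finset (Fin d → ℤ)) (u v : (Fin d → ℤ) → ℝ) (r : ℝ≥0) :
    ∀ᵐ ω ∂P, ξ (trigKernel F u v r) ω
      = ∑ m ∈ F, (u m * stochConv ξ r (cosChar m) ω + v m * stochConv ξ r (sinChar m) ω) := by
  filter_upwards [hξ.sum_ae F (fun m => sqIntegrable_convKernel_cosChar r m) u,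
    hξ.sum_ae F (fun m => sqIntegrable_convKernel_sinChar r m) v,
    hξ.linear _ _ (sqIntegrable_sum F fun m => (sqIntegrable_convKernel_cosChar r m).smul (u m))
      (sqIntegrable_sum F fun m => (sqIntegrable_convKernel_sinChar r m).smul (v m)) 1 1]
    with ω h1 h2 h3
  rw [one_smul, one_smul, one_mul, one_mul, h1, h2] at h3
  rw [Finset.sum_add_distrib]
  exact h3

theorem IsSpaceTimeWhiteNoise.lintegral_increment_le (hξ : IsSpaceTimeWhiteNoise P ξ)
    (F : Finset (Fin d → ℤ)) (u v : (Fin d → ℤ) → ℝ) {s t : ℝ≥0}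
    (hst : s ≤ t) (hts : t ≤ s + 1) {L : ℝ} (hL1 : 1 ≤ L)
    (hL : ∀ m ∈ F, L ≤ max 1 (eigen m) ∨ (u m = 0 ∧ v m = 0)) {n : ℕ} (hn : 3 ≤ n) :
    ∫⁻ ω, ‖∑ m ∈ F, (u m * stochConv ξ t (cosChar m) ω + v m * stochConv ξ t (sinChar m) ω)
        - ∑ m ∈ F, (u m * stochConv ξ s (cosChar m) ω + v m * stochConv ξ s (sinChar m) ω)‖ₑ
          ^ (2 * n) ∂P
      ≤ gaussConst n * ENNReal.ofReal ((2 * ∑ m ∈ F, (u m ^ 2 + v m ^ 2)) ^ n * L⁻¹ ^ (n - 3))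
        * ((t - s : ℝ≥0) : ℝ≥0∞) ^ 3 := by
  have hδ0 : (0 : ℝ) ≤ t - s := sub_nonneg.2 (by exact_mod_cast hst)
  have hLi : 0 ≤ L⁻¹ := inv_nonneg.2 (by linarith)
  have hS : 0 ≤ ∑ m ∈ F, (u m ^ 2 + v m ^ 2) := Finset.sum_nonneg fun m _ => by positivity
  have hsub := (sqIntegrable_trigKernel F u v t).sub (sqIntegrable_trigKernel F u v s)
  calc _ = ∫⁻ ω, ‖ξ (trigKernel F u v t - trigKernel F u v s) ω‖ₑ ^ (2 * n) ∂P := by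
        refine lintegral_congr_ae ?_
        filter_upwards [hξ.trigKernel_ae F u v t, hξ.trigKernel_ae F u v s,
          hξ.sub_ae (sqIntegrable_trigKernel F u v t) (sqIntegrable_trigKernel F u v s)]
          with ω h1 h2 h3
        rw [h3, h1, h2]
    _ = gaussConst n * sqNorm (trigKernel F u v t - trigKernel F u v s) ^ n :=
        hξ.lintegral_pow hsub n
    _ ≤ gaussConst n * ENNReal.ofReal (((∑ m ∈ F, (u m ^ 2 + v m ^ 2))
          * (2 * min (t - s : ℝ) L⁻¹)) ^ n) := by
        rw [ENNReal.ofReal_pow (mul_nonneg hS (mul_nonneg two_pos.le (le_min hδ0 hLi)))]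
        gcongr
        exact sqNorm_trigKernel_sub_le F u v hst hts hL1 hL
    _ ≤ gaussConst n * ENNReal.ofReal ((2 * ∑ m ∈ F, (u m ^ 2 + v m ^ 2)) ^ n * L⁻¹ ^ (n - 3)
          * (t - s : ℝ) ^ 3) := by
        refine mul_le_mul_right (ENNReal.ofReal_le_ofReal ?_) _
        -- Interpolation: three factors are spent on the time increment, as the chaining requires,
        -- and the other `n - 3` on decay in frequency.
        have h1 : min (t - s : ℝ) L⁻¹ ^ n ≤ L⁻¹ ^ (n - 3) * (t - s : ℝ) ^ 3 := by
          calc min (t - s : ℝ) L⁻¹ ^ n = min (t - s : ℝ) L⁻¹ ^ (n - 3) * min (t - s : ℝ) L⁻¹ ^ 3 := by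
                rw [← pow_add]; congr 1; omega
            _ ≤ _ := by
                have h0 : 0 ≤ min (t - s : ℝ) L⁻¹ := le_min hδ0 hLi
                have h2 : min (t - s : ℝ) L⁻¹ ≤ t - s := min_le_left _ _
                have h3 : min (t - s : ℝ) L⁻¹ ≤ L⁻¹ := min_le_right _ _
                gcongr
        calc ((∑ m ∈ F, (u m ^ 2 + v m ^ 2)) * (2 * min (t - s : ℝ) L⁻¹)) ^ n
            = (2 * ∑ m ∈ F, (u m ^ 2 + v m ^ 2)) ^ n * min (t - s : ℝ) L⁻¹ ^ n := by
              rw [← mul_pow]; ring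
          _ ≤ (2 * ∑ m ∈ F, (u m ^ 2 + v m ^ 2)) ^ n * (L⁻¹ ^ (n - 3) * (t - s : ℝ) ^ 3) := by
              gcongr
          _ = _ := by ring
    _ = _ := by
        rw [ENNReal.ofReal_mul (by positivity), ENNReal.ofReal_pow hδ0, ← NNReal.coe_sub hst,
          ENNReal.ofReal_coe_nnreal, mul_assoc]

theorem tendsto_latticeBall (d : ℕ) : Tendsto (latticeBall d) atTop atTop := by
  refine tendsto_atTop_finset_of_monotone (fun R S h => latticeBall_mono h) fun m => ?_
  refine ⟨∑ i, (m i).natAbs, mem_latticeBall.2 fun i => ?_⟩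
  rw [Int.abs_eq_natAbs]
  exact_mod_cast Finset.single_le_sum (f := fun i => (m i).natAbs) (fun _ _ => Nat.zero_le _)
    (Finset.mem_univ i)

theorem abs_sum_sub_tsum_le {ι : Type*} {f b : ι → ℝ} (hb : Summable b) (h : ∀ i, |f i| ≤ b i)
    (F : Finset ι) : |∑ i ∈ F, f i - ∑' i, f i| ≤ ∑' i, b i - ∑ i ∈ F, b i := by
  have hf : Summable f := Summable.of_norm_bounded hb h
  rw [← hf.sum_add_tsum_subtype_compl F, ← hb.sum_add_tsum_subtype_compl F, sub_add_cancel_left,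
    add_sub_cancel_left, abs_neg]
  exact tsum_of_norm_bounded (f := fun i : { i // i ∉ F } => f i) (hb.subtype _).hasSum
    fun i => h i

/-- The exponentials are at most `1`, so the tail of the series for the kernel is bounded uniformly
in time and space by the tail of the decay series of `φ`. -/
theorem sqNorm_trigKernel_sub_convKernel_le (N : ℕ) (r : ℝ≥0) (φ : TestFun d) :
    sqNorm (trigKernel (latticeBall d N) (fun m => pair (cosDist m) φ)
        (fun m => pair (sinDist m) φ) r - convKernel r (φ : Torus d → ℝ))
      ≤ r * ENNReal.ofReal (∑' m : Fin d → ℤ, 2 * decayConst φ * ((1 + ‖m‖) ^ (4 * d))⁻¹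
        - ∑ m ∈ latticeBall d N, 2 * decayConst φ * ((1 + ‖m‖) ^ (4 * d))⁻¹) ^ 2 := by
  set T := ∑' m : Fin d → ℤ, 2 * decayConst φ * ((1 + ‖m‖) ^ (4 * d))⁻¹
        - ∑ m ∈ latticeBall d N, 2 * decayConst φ * ((1 + ‖m‖) ^ (4 * d))⁻¹
  rw [sqNorm_eq ((sqIntegrable_trigKernel _ _ _ r).sub (sqIntegrable_convKernel r φ)).1]
  have hq : ∀ᵐ q ∂timeMeasure, ∫⁻ x, ‖(trigKernel (latticeBall d N) (fun m => pair (cosDist m) φ)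
        (fun m => pair (sinDist m) φ) r - convKernel r (φ : Torus d → ℝ)) (q, x)‖ₑ ^ 2
          ∂torusMeasure d
      ≤ (Set.Icc 0 r).indicator (fun _ => ENNReal.ofReal T ^ 2) q := by
    filter_upwards [ae_ne_time r] with q hqr
    rcases lt_or_gt_of_ne hqr with h | h
    · rw [Set.indicator_of_mem (show q ∈ Set.Icc 0 r from ⟨zero_le, h.le⟩)]
      refine (lintegral_mono (g := fun _ => ENNReal.ofReal T ^ 2) fun x => ?_).trans (by simp)
      refine pow_le_pow_left₀ zero_le ?_ 2
      rw [Pi.sub_apply, trigKernel_apply _ _ _ hqr, convKernel_of_gt h, ← ofReal_norm]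
      refine ENNReal.ofReal_le_ofReal ?_
      have := abs_sum_sub_tsum_le (summable_decay φ)
        (fun m => abs_exp_mul_fourierTerm_le φ (r - q) m x) (latticeBall d N)
      refine le_trans (le_of_eq ?_) this
      rw [Real.norm_eq_abs]
      congr 2
      refine Finset.sum_congr rfl fun m _ => ?_
      rw [modeKernel, if_pos h, NNReal.coe_sub h.le, fourierTerm]
      ring
    · have h0 : ∀ x : Torus d, (trigKernel (latticeBall d N) (fun m => pair (cosDist m) φ)
          (fun m => pair (sinDist m) φ) r - convKernel r (φ : Torus d → ℝ)) (q, x) = 0 := by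
        intro x
        rw [Pi.sub_apply, trigKernel_apply _ _ _ hqr, convKernel_of_lt h, sub_zero]
        exact Finset.sum_eq_zero fun m _ => by rw [modeKernel, if_neg h.not_gt, zero_mul]
      simp [h0]
  refine (lintegral_mono_ae hq).trans ?_
  rw [lintegral_indicator measurableSet_Icc, setLIntegral_const, mul_comm]
  exact mul_le_mul_left (timeMeasure_Icc r) _

/-- The stochastic convolution is the sum of its Fourier series. -/
theorem IsSpaceTimeWhiteNoise.tsum_eq_stochConv (hξ : IsSpaceTimeWhiteNoise P ξ) (r : ℝ≥0)
    (φ : TestFun d) {c s : (Fin d → ℤ) → Ω → ℝ}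
    (hc : ∀ m, c m =ᵐ[P] stochConv ξ r (cosChar m)) (hs : ∀ m, s m =ᵐ[P] stochConv ξ r (sinChar m))
    (hsum : ∀ᵐ ω ∂P, Summable fun m => c m ω * pair (cosDist m) φ + s m ω * pair (sinDist m) φ) :
    ∀ᵐ ω ∂P, ∑' m, (c m ω * pair (cosDist m) φ + s m ω * pair (sinDist m) φ)
      = stochConv ξ r (φ : Torus d → ℝ) ω := by
  have hmc : ∀ m, Measurable (stochConv ξ r (cosChar m)) := fun m =>
    hξ.measurable _ (sqIntegrable_convKernel_cosChar r m)
  have hms : ∀ m, Measurable (stochConv ξ r (sinChar m)) := fun m =>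
    hξ.measurable _ (sqIntegrable_convKernel_sinChar r m)
  -- The truncations to growing boxes converge almost surely to the sum of the series, by
  -- summability, and in `L²` to the noise integral, by the isometry.
  refine ae_eq_of_tendsto_of_lintegral_tendsto (p := 2) two_ne_zero
    (Z := fun N ω => ∑ m ∈ latticeBall d N, (pair (cosDist m) φ * stochConv ξ r (cosChar m) ω
      + pair (sinDist m) φ * stochConv ξ r (sinChar m) ω)) (fun N => ?_)
    (hξ.measurable _ (sqIntegrable_convKernel r φ)).aemeasurable ?_ ?_
  · exact (Finset.measurable_sum _ fun m _ => ((hmc m).const_mul _).add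
      ((hms m).const_mul _)).aemeasurable
  · filter_upwards [ae_all_iff.2 hc, ae_all_iff.2 hs, hsum] with ω h1 h2 h3
    simp only [← h1, ← h2]
    refine (h3.hasSum.comp (tendsto_latticeBall d)).congr fun N => ?_
    exact Finset.sum_congr rfl fun m _ => by ring
  · have hz : Tendsto (fun N : ℕ => gaussConst 1 * (r * ENNReal.ofReal
        (∑' m : Fin d → ℤ, 2 * decayConst φ * ((1 + ‖m‖) ^ (4 * d))⁻¹
        - ∑ m ∈ latticeBall d N, 2 * decayConst φ * ((1 + ‖m‖) ^ (4 * d))⁻¹) ^ 2))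
        atTop (𝓝 0) := by
      have h1 := ((summable_decay φ).hasSum.comp (tendsto_latticeBall d)).const_sub
        (∑' m : Fin d → ℤ, 2 * decayConst φ * ((1 + ‖m‖) ^ (4 * d))⁻¹)
      rw [sub_self] at h1
      have h2 := ((ENNReal.continuous_pow 2).tendsto _).comp (ENNReal.tendsto_ofReal h1)
      have h3 := ENNReal.Tendsto.const_mul (a := gaussConst 1)
        (ENNReal.Tendsto.const_mul (a := (r : ℝ≥0∞)) h2 (Or.inr ENNReal.coe_ne_top))
        (Or.inr (gaussConst_ne_top 1))
      simpa using h3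
    refine tendsto_of_tendsto_of_tendsto_of_le_of_le tendsto_const_nhds hz
      (fun _ => zero_le) fun N => ?_
    have e : ∫⁻ ω, ‖∑ m ∈ latticeBall d N, (pair (cosDist m) φ * stochConv ξ r (cosChar m) ω
        + pair (sinDist m) φ * stochConv ξ r (sinChar m) ω)
          - stochConv ξ r (φ : Torus d → ℝ) ω‖ₑ ^ 2 ∂P
        = gaussConst 1 * sqNorm (trigKernel (latticeBall d N) (fun m => pair (cosDist m) φ)
          (fun m => pair (sinDist m) φ) r - convKernel r (φ : Torus d → ℝ)) := by
      have h1 := hξ.lintegral_pow ((sqIntegrable_trigKernel (latticeBall d N)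
        (fun m => pair (cosDist m) φ) (fun m => pair (sinDist m) φ) r).sub
          (sqIntegrable_convKernel r φ)) 1
      rw [pow_one, mul_one] at h1
      rw [← h1]
      refine lintegral_congr_ae ?_
      filter_upwards [hξ.trigKernel_ae (latticeBall d N) (fun m => pair (cosDist m) φ)
        (fun m => pair (sinDist m) φ) r, hξ.sub_ae (sqIntegrable_trigKernel (latticeBall d N)
        (fun m => pair (cosDist m) φ) (fun m => pair (sinDist m) φ) r)
          (sqIntegrable_convKernel r φ)] with ω h2 h3
      rw [h3, h2]
      rfl
    exact e.le.trans (mul_le_mul_right (sqNorm_trigKernel_sub_convKernel_le N r φ) _)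

end Noise

/-! ### Discretization of the torus -/

/-- The point `k / N` of the torus. -/
def gridPt (N : ℕ) (k : Fin d → Fin N) : Torus d := torusMk fun i => (k i : ℝ) / N

/-- Rounding the fractional parts down moves each coordinate by at most `1/N`, so the phase changes
by at most `2π ∑ |m_i| / N`; cosine and sine are `1`-Lipschitz. -/
theorem exists_gridPt_close {N : ℕ} (hN : 0 < N) (R : ℕ) (x : Torus d) :
    ∃ k : Fin d → Fin N, ∀ m ∈ latticeBall d R,
      |cosChar m x - cosChar m (gridPt N k)| ≤ 2 * Real.pi * d * R / N ∧
      |sinChar m x - sinChar m (gridPt N k)| ≤ 2 * Real.pi * d * R / N := by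
  obtain ⟨y, rfl⟩ := torusMk_surjective x
  have hN' : (0 : ℝ) < N := by exact_mod_cast hN
  set z : Fin d → ℝ := fun i => Int.fract (y i) with hz
  have hyz : torusMk y = torusMk z := by
    funext i
    have h1 : ((⌊y i⌋ : ℝ) : UnitAddCircle) = 0 :=
      (AddCircle.coe_eq_zero_iff (p := (1 : ℝ)) (x := (⌊y i⌋ : ℝ))).2 ⟨⌊y i⌋, by simp⟩
    have h2 : (y i : UnitAddCircle) = ((⌊y i⌋ + Int.fract (y i) : ℝ) : UnitAddCircle) := by
      rw [Int.floor_add_fract]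
    change (y i : UnitAddCircle) = ((Int.fract (y i) : ℝ) : UnitAddCircle)
    rw [h2, AddCircle.coe_add, h1, zero_add]
  have hlt : ∀ i, ⌊N * z i⌋₊ < N := fun i => by
    rw [Nat.floor_lt (mul_nonneg hN'.le (Int.fract_nonneg _))]
    exact mul_lt_of_lt_one_right hN' (Int.fract_lt_one _)
  refine ⟨fun i => ⟨⌊N * z i⌋₊, hlt i⟩, fun m hm => ?_⟩
  have hclose : ∀ i, |z i - (⌊N * z i⌋₊ : ℝ) / N| ≤ 1 / N := by
    intro i
    have h1 := Nat.floor_le (mul_nonneg hN'.le (Int.fract_nonneg (y i)))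
    have h2 := Nat.lt_floor_add_one (N * z i)
    rw [abs_le, ← sub_nonneg, ← sub_nonneg (b := _ - _)]
    have e1 : z i - (⌊N * z i⌋₊ : ℝ) / N - -(1 / N) = (N * z i - ⌊N * z i⌋₊ + 1) / N := by
      field_simp
      ring
    have e2 : 1 / N - (z i - (⌊N * z i⌋₊ : ℝ) / N) = (⌊N * z i⌋₊ + 1 - N * z i) / N := by
      field_simp
      ring
    rw [e1, e2]
    exact ⟨div_nonneg (by change (⌊N * z i⌋₊ : ℝ) ≤ N * z i at h1; linarith) hN'.le,
      div_nonneg (by linarith) hN'.le⟩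
  have hang : |2 * Real.pi * ∑ i, z i * m i - 2 * Real.pi * ∑ i, (⌊N * z i⌋₊ : ℝ) / N * m i|
      ≤ 2 * Real.pi * d * R / N := by
    rw [← mul_sub, ← Finset.sum_sub_distrib, abs_mul, abs_of_pos (by positivity)]
    have h3 : |∑ i, (z i * m i - (⌊N * z i⌋₊ : ℝ) / N * m i)| ≤ ∑ _i : Fin d, 1 / N * (R : ℝ) := by
      refine (Finset.abs_sum_le_sum_abs _ _).trans (Finset.sum_le_sum fun i _ => ?_)
      rw [← sub_mul, abs_mul]
      have h4 : |(m i : ℝ)| ≤ R := by exact_mod_cast mem_latticeBall.1 hm i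
      exact mul_le_mul (hclose i) h4 (abs_nonneg _) (by positivity)
    calc _ ≤ 2 * Real.pi * ∑ _i : Fin d, 1 / N * (R : ℝ) := by gcongr
      _ = _ := by simp; ring
  rw [hyz, gridPt, cosChar_torusMk, cosChar_torusMk, sinChar_torusMk, sinChar_torusMk]
  exact ⟨(Real.abs_cos_sub_cos_le _ _).trans hang, (Real.abs_sin_sub_sin_le _ _).trans hang⟩

theorem sum_pow_le_card_pow_mul {ι : Type*} (F : Finset ι) (f : ι → ℝ≥0∞) (p : ℕ) (hp : p ≠ 0) :
    (∑ i ∈ F, f i) ^ p ≤ (F.card : ℝ≥0∞) ^ p * ∑ i ∈ F, f i ^ p := by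
  rcases F.eq_empty_or_nonempty with rfl | hF
  · simp [hp]
  obtain ⟨i, hi, hmax⟩ := F.exists_max_image f hF
  calc (∑ i ∈ F, f i) ^ p ≤ (F.card * f i) ^ p := by
        gcongr
        calc ∑ i ∈ F, f i ≤ ∑ _j ∈ F, f i := Finset.sum_le_sum hmax
          _ = _ := by simp
    _ = (F.card : ℝ≥0∞) ^ p * f i ^ p := mul_pow _ _ _
    _ ≤ _ := by
        gcongr
        exact Finset.single_le_sum (f := fun i => f i ^ p) (fun _ _ => zero_le) hi

theorem add_pow_le_two_pow_mul (a b : ℝ≥0∞) (p : ℕ) : (a + b) ^ p ≤ 2 ^ p * (a ^ p + b ^ p) := by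
  rcases le_total a b with h | h
  · calc (a + b) ^ p ≤ (2 * b) ^ p := by rw [two_mul]; gcongr
      _ = 2 ^ p * b ^ p := mul_pow _ _ _
      _ ≤ _ := by gcongr; exact le_add_self
  · calc (a + b) ^ p ≤ (2 * a) ^ p := by rw [two_mul]; gcongr
      _ = 2 ^ p * a ^ p := mul_pow _ _ _
      _ ≤ _ := by gcongr; exact le_self_add

/-- A trigonometric polynomial is controlled by its values on a grid and by its coefficients. -/
theorem enorm_trigSum_pow_le {N : ℕ} (hN : 0 < N) (R : ℕ) {p : ℕ} (hp : p ≠ 0)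
    {w c s : (Fin d → ℤ) → ℝ} {b : ℝ} (hw : ∀ m ∈ latticeBall d R, |w m| ≤ b) (x : Torus d) :
    ‖∑ m ∈ latticeBall d R, w m * (cosChar m x * c m + sinChar m x * s m)‖ₑ ^ p
      ≤ 2 ^ p * (∑ k : Fin d → Fin N, ‖∑ m ∈ latticeBall d R, w m *
          (cosChar m (gridPt N k) * c m + sinChar m (gridPt N k) * s m)‖ₑ ^ p
        + ENNReal.ofReal (2 * Real.pi * d * R * b / N) ^ p
          * (2 * (latticeBall d R).card : ℝ≥0∞) ^ p
          * ∑ m ∈ latticeBall d R, (‖c m‖ₑ ^ p + ‖s m‖ₑ ^ p)) := by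
  obtain ⟨k, hk⟩ := exists_gridPt_close hN R x
  set f : Torus d → ℝ := fun x =>
    ∑ m ∈ latticeBall d R, w m * (cosChar m x * c m + sinChar m x * s m) with hf
  have h1 : |f x - f (gridPt N k)|
      ≤ 2 * Real.pi * d * R * b / N * ∑ m ∈ latticeBall d R, (|c m| + |s m|) := by
    rw [hf]
    simp only
    rw [← Finset.sum_sub_distrib, Finset.mul_sum]
    refine (Finset.abs_sum_le_sum_abs _ _).trans (Finset.sum_le_sum fun m hm => ?_)
    obtain ⟨hc, hs⟩ := hk m hm
    have hb : 0 ≤ b := (abs_nonneg _).trans (hw m hm)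
    rw [← mul_sub, show cosChar m x * c m + sinChar m x * s m
      - (cosChar m (gridPt N k) * c m + sinChar m (gridPt N k) * s m)
      = (cosChar m x - cosChar m (gridPt N k)) * c m
        + (sinChar m x - sinChar m (gridPt N k)) * s m by ring, abs_mul]
    calc |w m| * |(cosChar m x - cosChar m (gridPt N k)) * c m
        + (sinChar m x - sinChar m (gridPt N k)) * s m|
        ≤ b * (2 * Real.pi * d * R / N * |c m| + 2 * Real.pi * d * R / N * |s m|) := by
          refine mul_le_mul (hw m hm) ?_ (abs_nonneg _) hb
          refine (abs_add_le _ _).trans ?_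
          rw [abs_mul, abs_mul]
          gcongr
      _ = _ := by ring
  have h2 : ‖f x‖ₑ ≤ ‖f (gridPt N k)‖ₑ + ENNReal.ofReal (2 * Real.pi * d * R * b / N)
      * ∑ m ∈ latticeBall d R, (‖c m‖ₑ + ‖s m‖ₑ) := by
    have h3 : ‖f x‖ₑ ≤ ‖f (gridPt N k)‖ₑ + ‖f x - f (gridPt N k)‖ₑ := by
      calc ‖f x‖ₑ = ‖f (gridPt N k) + (f x - f (gridPt N k))‖ₑ := by rw [add_sub_cancel]
        _ ≤ _ := enorm_add_le _ _
    refine h3.trans (add_le_add_right ?_ _)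
    rw [← ofReal_norm, Real.norm_eq_abs]
    refine (ENNReal.ofReal_le_ofReal h1).trans (le_of_eq ?_)
    rw [ENNReal.ofReal_mul' (Finset.sum_nonneg fun m _ => by positivity),
      ENNReal.ofReal_sum_of_nonneg fun m _ => by positivity]
    congr 1
    refine Finset.sum_congr rfl fun m _ => ?_
    rw [ENNReal.ofReal_add (abs_nonneg _) (abs_nonneg _), ← Real.norm_eq_abs, ← Real.norm_eq_abs,
      ofReal_norm, ofReal_norm]
  calc ‖f x‖ₑ ^ p ≤ (‖f (gridPt N k)‖ₑ + ENNReal.ofReal (2 * Real.pi * d * R * b / N)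
      * ∑ m ∈ latticeBall d R, (‖c m‖ₑ + ‖s m‖ₑ)) ^ p := by gcongr
    _ ≤ 2 ^ p * (‖f (gridPt N k)‖ₑ ^ p + (ENNReal.ofReal (2 * Real.pi * d * R * b / N)
      * ∑ m ∈ latticeBall d R, (‖c m‖ₑ + ‖s m‖ₑ)) ^ p) := add_pow_le_two_pow_mul _ _ _
    _ ≤ _ := by
      gcongr 2 ^ p * (?_ + ?_)
      · exact Finset.single_le_sum (f := fun k => ‖f (gridPt N k)‖ₑ ^ p) (fun _ _ => zero_le)
          (Finset.mem_univ k)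
      · have h4 : (∑ m ∈ latticeBall d R, (‖c m‖ₑ + ‖s m‖ₑ)) ^ p
            ≤ ((latticeBall d R).card : ℝ≥0∞) ^ p
              * (2 ^ p * ∑ m ∈ latticeBall d R, (‖c m‖ₑ ^ p + ‖s m‖ₑ ^ p)) := by
          refine (sum_pow_le_card_pow_mul _ _ p hp).trans (mul_le_mul_right ?_ _)
          rw [Finset.mul_sum]
          exact Finset.sum_le_sum fun m _ => add_pow_le_two_pow_mul _ _ _
        rw [mul_pow]
        refine (mul_le_mul_right h4 _).trans (le_of_eq ?_)
        rw [mul_pow 2]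
        ring

/-! ### Continuous Fourier modes -/

section Modes

variable {Ω : Type*} [MeasurableSpace Ω]

/-- Continuous modifications of the Fourier modes of the stochastic convolution. -/
structure IsModeFamily (P : Measure Ω) (ξ : (ℝ≥0 × Torus d → ℝ) → Ω → ℝ)
    (c s : (Fin d → ℤ) → ℝ≥0 → Ω → ℝ) : Prop where
  cont_cos : ∀ m ω, Continuous fun t => c m t ω
  cont_sin : ∀ m ω, Continuous fun t => s m t ω
  ae_cos : ∀ m t, c m t =ᵐ[P] stochConv ξ t (cosChar m)
  ae_sin : ∀ m t, s m t =ᵐ[P] stochConv ξ t (sinChar m)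
  zero_cos : ∀ m ω, c m 0 ω = 0
  zero_sin : ∀ m ω, s m 0 ω = 0
  neg_cos : ∀ m t ω, c (-m) t ω = c m t ω
  neg_sin : ∀ m t ω, s (-m) t ω = -s m t ω
  meas_cos : ∀ m t, Measurable (c m t)
  meas_sin : ∀ m t, Measurable (s m t)

variable {P : Measure Ω} {ξ : (ℝ≥0 × Torus d → ℝ) → Ω → ℝ}

theorem IsSpaceTimeWhiteNoise.ae_eq_zero (hξ : IsSpaceTimeWhiteNoise P ξ)
    {h : ℝ≥0 × Torus d → ℝ} (hh : SqIntegrable h)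
    (h0 : ∀ᵐ q ∂timeMeasure, ∀ x, h (q, x) = 0) : ξ h =ᵐ[P] 0 := by
  have h1 : sqNorm h = 0 := by
    rw [sqNorm_eq hh.1, ← lintegral_zero (μ := timeMeasure)]
    refine lintegral_congr_ae ?_
    filter_upwards [h0] with q hq
    simp [hq]
  have h2 := hξ.lintegral_pow hh 1
  rw [h1, pow_one, mul_zero, lintegral_eq_zero_iff
    (((hξ.measurable h hh).enorm).pow_const _)] at h2
  filter_upwards [h2] with ω hω
  simpa using hω

theorem IsSpaceTimeWhiteNoise.stochConv_zero_ae (hξ : IsSpaceTimeWhiteNoise P ξ) (φ : TestFun d) :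
    stochConv ξ 0 (φ : Torus d → ℝ) =ᵐ[P] 0 := by
  refine hξ.ae_eq_zero (sqIntegrable_convKernel 0 φ) ?_
  filter_upwards [ae_ne_time 0] with q hq x
  exact convKernel_of_lt (pos_iff_ne_zero.2 hq) _ x

theorem IsSpaceTimeWhiteNoise.stochConv_sinChar_neg_ae (hξ : IsSpaceTimeWhiteNoise P ξ) (t : ℝ≥0)
    (m : Fin d → ℤ) : ∀ᵐ ω ∂P, stochConv ξ t (sinChar (-m)) ω = -stochConv ξ t (sinChar m) ω := by
  have h1 := sqIntegrable_convKernel_sinChar t m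
  have h2 := sqIntegrable_convKernel_sinChar t (-m)
  have h3 := hξ.ae_eq_zero ((h2.smul 1).add (h1.smul 1)) (by
    filter_upwards [ae_ne_time t] with q hq x
    simp only [Pi.add_apply, Pi.smul_apply, smul_eq_mul, convKernel_sinChar hq,
      modeKernel, eigen_neg]
    rw [sinChar_neg, Pi.neg_apply]
    ring)
  filter_upwards [h3, hξ.linear _ _ h2 h1 1 1] with ω h4 h5
  rw [h4, one_mul, one_mul, Pi.zero_apply] at h5
  exact eq_neg_of_add_eq_zero_left h5.symm

theorem IsSpaceTimeWhiteNoise.exists_isModeFamily [P.IsComplete]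
    (hξ : IsSpaceTimeWhiteNoise P ξ) : ∃ c s, IsModeFamily P ξ c s := by
  have hC : ∀ m : Fin d → ℤ, ∃ L : ℝ≥0 → Ω → ℝ, (∀ ω, Continuous fun t => L t ω) ∧
      ∀ t, L t =ᵐ[P] stochConv ξ t (cosChar m) := fun m => by
    refine exists_continuous_modification
      (fun t => hξ.measurable _ (sqIntegrable_convKernel_cosChar t m)) (p := 2 * 3) (by norm_num)
      (A := gaussConst 3 * ENNReal.ofReal (2 ^ 3)) (by have := gaussConst_ne_top 3; finiteness)
      fun s t hst hts => ?_
    simpa using hξ.lintegral_increment_le {m} (fun _ => 1) (fun _ => 0) hst hts le_rfl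
      (fun _ _ => Or.inl (le_max_left _ _)) le_rfl
  have hS : ∀ m : Fin d → ℤ, ∃ L : ℝ≥0 → Ω → ℝ, (∀ ω, Continuous fun t => L t ω) ∧
      ∀ t, L t =ᵐ[P] stochConv ξ t (sinChar m) := fun m => by
    refine exists_continuous_modification
      (fun t => hξ.measurable _ (sqIntegrable_convKernel_sinChar t m)) (p := 2 * 3) (by norm_num)
      (A := gaussConst 3 * ENNReal.ofReal (2 ^ 3)) (by have := gaussConst_ne_top 3; finiteness)
      fun s t hst hts => ?_
    simpa using hξ.lintegral_increment_le {m} (fun _ => 0) (fun _ => 1) hst hts le_rfl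
      (fun _ _ => Or.inl (le_max_left _ _)) le_rfl
  choose C hCc hCa using hC
  choose S hSc hSa using hS
  -- Subtracting the value at time zero and symmetrising in `m` turns identities that hold almost
  -- surely into identities valid for every `ω`.
  have hc : ∀ m t, (fun ω => (C m t ω - C m 0 ω + (C (-m) t ω - C (-m) 0 ω)) / 2)
      =ᵐ[P] stochConv ξ t (cosChar m) := fun m t => by
    filter_upwards [hCa m t, hCa m 0, hCa (-m) t, hCa (-m) 0,
      hξ.stochConv_zero_ae (cosTest m)] with ω h1 h2 h3 h4 h5
    rw [cosChar_neg] at h3 h4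
    change stochConv ξ 0 (cosChar m) ω = 0 at h5
    rw [h1, h2, h3, h4, h5]
    ring
  have hs : ∀ m t, (fun ω => (S m t ω - S m 0 ω - (S (-m) t ω - S (-m) 0 ω)) / 2)
      =ᵐ[P] stochConv ξ t (sinChar m) := fun m t => by
    filter_upwards [hSa m t, hSa m 0, hSa (-m) t, hSa (-m) 0,
      hξ.stochConv_zero_ae (sinTest m), hξ.stochConv_sinChar_neg_ae t m,
      hξ.stochConv_sinChar_neg_ae 0 m] with ω h1 h2 h3 h4 h5 h6 h7
    change stochConv ξ 0 (sinChar m) ω = 0 at h5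
    rw [h1, h2, h3, h4, h6, h7, h5]
    ring
  refine ⟨_, _, ?_, ?_, hc, hs, ?_, ?_, ?_, ?_, ?_, ?_⟩
  · intro m ω
    have := hCc m ω
    have := hCc (-m) ω
    fun_prop
  · intro m ω
    have := hSc m ω
    have := hSc (-m) ω
    fun_prop
  · intro m ω
    ring
  · intro m ω
    ring
  · intro m t ω
    simp only [neg_neg]
    ring
  · intro m t ω
    simp only [neg_neg]
    ring
  -- A modification agrees almost everywhere with a measurable function, hence is measurable because
  -- `P` is complete.
  · intro m t
    have h1 : AEMeasurable _ P :=
      (hξ.measurable _ (sqIntegrable_convKernel_cosChar t m)).aemeasurable.congr (hc m t).symm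
    exact h1.nullMeasurable.measurable_of_complete
  · intro m t
    have h1 : AEMeasurable _ P :=
      (hξ.measurable _ (sqIntegrable_convKernel_sinChar t m)).aemeasurable.congr (hs m t).symm
    exact h1.nullMeasurable.measurable_of_complete

/-- A trigonometric combination of Fourier modes. -/
def modeSum (c s : (Fin d → ℤ) → ℝ≥0 → Ω → ℝ) (F : Finset (Fin d → ℤ)) (u v : (Fin d → ℤ) → ℝ)
    (t : ℝ≥0) (ω : Ω) : ℝ := ∑ m ∈ F, (u m * c m t ω + v m * s m t ω)

variable {c s : (Fin d → ℤ) → ℝ≥0 → Ω → ℝ}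

theorem IsModeFamily.measurable_modeSum (h : IsModeFamily P ξ c s) (F : Finset (Fin d → ℤ))
    (u v : (Fin d → ℤ) → ℝ) (t : ℝ≥0) : Measurable (modeSum c s F u v t) :=
  Finset.measurable_sum _ fun m _ => ((h.meas_cos m t).const_mul _).add
    ((h.meas_sin m t).const_mul _)

theorem IsModeFamily.measurable_chainSum (h : IsModeFamily P ξ c s) (F : Finset (Fin d → ℤ))
    (u v : (Fin d → ℤ) → ℝ) (p U : ℕ) :
    Measurable fun ω => chainSum p U fun t => modeSum c s F u v t ω :=
  CahnHilliard.measurable_chainSum (h.measurable_modeSum F u v) p U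

theorem IsModeFamily.enorm_modeSum_pow_le (h : IsModeFamily P ξ c s) (F : Finset (Fin d → ℤ))
    (u v : (Fin d → ℤ) → ℝ) {p U : ℕ} (hp : p ≠ 0) {t : ℝ≥0} (ht : t ≤ U) (ω : Ω) :
    ‖modeSum c s F u v t ω‖ₑ ^ p
      ≤ chainConst p U * chainSum p U fun t => modeSum c s F u v t ω := by
  refine enorm_pow_le_chainSum (y := fun t => modeSum c s F u v t ω) hp ?_ ?_ ht
  · exact continuous_finsetSum _ fun m _ => (continuous_const.mul (h.cont_cos m ω)).add
      (continuous_const.mul (h.cont_sin m ω))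
  · exact Finset.sum_eq_zero fun m _ => by rw [h.zero_cos, h.zero_sin]; ring

theorem IsModeFamily.lintegral_chainSum_le (h : IsModeFamily P ξ c s)
    (hξ : IsSpaceTimeWhiteNoise P ξ) (F : Finset (Fin d → ℤ)) (u v : (Fin d → ℤ) → ℝ)
    {L : ℝ} (hL1 : 1 ≤ L) (hL : ∀ m ∈ F, L ≤ max 1 (eigen m) ∨ (u m = 0 ∧ v m = 0))
    {n : ℕ} (hn : 3 ≤ n) (U : ℕ) :
    ∫⁻ ω, chainSum (2 * n) U (fun t => modeSum c s F u v t ω) ∂P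
      ≤ 2 * U * (gaussConst n *
        ENNReal.ofReal ((2 * ∑ m ∈ F, (u m ^ 2 + v m ^ 2)) ^ n * L⁻¹ ^ (n - 3))) := by
  refine CahnHilliard.lintegral_chainSum_le (h.measurable_modeSum F u v) (fun s' t hst hts => ?_) U
  refine le_trans (le_of_eq (lintegral_congr_ae ?_))
    (hξ.lintegral_increment_le F u v hst hts hL1 hL hn)
  have hae : ∀ r : ℝ≥0, ∀ᵐ ω ∂P, modeSum c s F u v r ω
      = ∑ m ∈ F, (u m * stochConv ξ r (cosChar m) ω + v m * stochConv ξ r (sinChar m) ω) := by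
    intro r
    filter_upwards [ae_all_iff.2 fun m => h.ae_cos m r, ae_all_iff.2 fun m => h.ae_sin m r]
      with ω h1 h2
    simp only [modeSum, h1, h2]
  filter_upwards [hae s', hae t] with ω h1 h2
  rw [h1, h2]

end Modes

/-! ### Moment bounds for the Littlewood-Paley blocks -/

/-- The constant in the moment bound for a single block. -/
def levelConst (d n : ℕ) : ℝ :=
  (2 * 7 ^ d) ^ n + (12 * Real.pi * d * 7 ^ d) ^ (2 * n) * (7 ^ d * 2 ^ (n + 1))

theorem levelConst_nonneg (d n : ℕ) : 0 ≤ levelConst d n := by unfold levelConst; positivity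

/-- Here `y = 2^j`, `M` counts the frequencies of the box and `y^{d+3}` is the number of grid points
per direction. The first summand is the grid contribution, with `y^{(d+3)d}` points. The second is
the discretisation error, whose base is of order `b y · y^d / y^{d+3} = b y^{-2}`, so its `2n`-th
power already carries `y^{-4n}`. -/
theorem level_arith (d : ℕ) {n : ℕ} (hn : 3 ≤ n) {y b M : ℝ} (hy : 1 ≤ y) (hb : 0 ≤ b)
    (hM0 : 0 ≤ M) (hM : M ≤ 7 ^ d * y ^ d) :
    (y ^ (d + 3)) ^ d * ((2 * (M * b ^ 2)) ^ n * (y ^ 4)⁻¹ ^ (n - 3))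
      + (2 * Real.pi * d * (3 * y) * b / y ^ (d + 3)) ^ (2 * n) * (2 * M) ^ (2 * n)
        * (M * 2 * 2 ^ n)
      ≤ levelConst d n * b ^ (2 * n) * (y ^ ((d + 3) * d + d * n + 12) * (y ^ (4 * n))⁻¹) := by
  have hy0 : 0 < y := by linarith
  obtain ⟨k, rfl⟩ : ∃ k, n = k + 3 := ⟨n - 3, by omega⟩
  have h1 : (y ^ (d + 3)) ^ d * ((2 * (M * b ^ 2)) ^ (k + 3) * (y ^ 4)⁻¹ ^ (k + 3 - 3))
      ≤ (2 * 7 ^ d) ^ (k + 3) * b ^ (2 * (k + 3))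
        * (y ^ ((d + 3) * d + d * (k + 3) + 12) * (y ^ (4 * (k + 3)))⁻¹) := by
    calc _ ≤ (y ^ (d + 3)) ^ d * ((2 * ((7 ^ d * y ^ d) * b ^ 2)) ^ (k + 3)
          * (y ^ 4)⁻¹ ^ (k + 3 - 3)) := by gcongr
      _ = _ := by
        have e : (y ^ 4)⁻¹ ^ k = y ^ 12 * (y ^ (4 * (k + 3)))⁻¹ := by
          rw [inv_pow, ← pow_mul, eq_mul_inv_iff_mul_eq₀ (by positivity),
            inv_mul_eq_iff_eq_mul₀ (by positivity)]
          ring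
        rw [Nat.add_sub_cancel, e]
        ring
  have h2 : (2 * Real.pi * d * (3 * y) * b / y ^ (d + 3)) ^ (2 * (k + 3)) * (2 * M) ^ (2 * (k + 3))
        * (M * 2 * 2 ^ (k + 3))
      ≤ (12 * Real.pi * d * 7 ^ d) ^ (2 * (k + 3)) * (7 ^ d * 2 ^ (k + 3 + 1)) * b ^ (2 * (k + 3))
        * (y ^ ((d + 3) * d + d * (k + 3) + 12) * (y ^ (4 * (k + 3)))⁻¹) := by
    calc _ ≤ (2 * Real.pi * d * (3 * y) * b / y ^ (d + 3)) ^ (2 * (k + 3))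
          * (2 * (7 ^ d * y ^ d)) ^ (2 * (k + 3)) * ((7 ^ d * y ^ d) * 2 * 2 ^ (k + 3)) := by
          gcongr
      _ = (12 * Real.pi * d * 7 ^ d) ^ (2 * (k + 3)) * (7 ^ d * 2 ^ (k + 3 + 1)) * b ^ (2 * (k + 3))
        * (y ^ d * (y ^ (4 * (k + 3)))⁻¹) := by
          have e : 2 * Real.pi * d * (3 * y) * b / y ^ (d + 3) * (2 * (7 ^ d * y ^ d))
              = 12 * Real.pi * d * 7 ^ d * b * (y ^ 2)⁻¹ := by
            field_simp
            ring
          rw [← mul_pow, e, mul_pow _ (y ^ 2)⁻¹, mul_pow _ b, inv_pow, ← pow_mul y,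
            show 2 * (2 * (k + 3)) = 4 * (k + 3) by ring]
          ring
      _ ≤ _ := by
          gcongr
          nlinarith
  calc _ ≤ _ := add_le_add h1 h2
    _ = _ := by unfold levelConst; ring

section Modes

variable {Ω : Type*} [MeasurableSpace Ω] {P : Measure Ω}
  {ξ : (ℝ≥0 × Torus d → ℝ) → Ω → ℝ} {c s : (Fin d → ℤ) → ℝ≥0 → Ω → ℝ}

/-- The moment bound for trigonometric sums over the frequencies of a single block. -/
theorem IsModeFamily.exists_level_bound (h : IsModeFamily P ξ c s)
    (hξ : IsSpaceTimeWhiteNoise P ξ) {n : ℕ} (hn : 3 ≤ n) (U : ℕ) :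
    ∃ K : ℝ≥0, ∀ (j : ℕ) (w : (Fin d → ℤ) → ℝ) (b : ℝ≥0),
      (∀ m ∈ latticeBall d (3 * 2 ^ j), |w m| ≤ b) →
      (∀ m ∈ latticeBall d (3 * 2 ^ j), (16 : ℝ) ^ j ≤ max 1 (eigen m) ∨ w m = 0) →
      ∃ Q : Ω → ℝ≥0∞, Measurable Q ∧
        ∫⁻ ω, Q ω ∂P ≤ K * ENNReal.ofReal ((b : ℝ) ^ (2 * n)
          * (((2 : ℝ) ^ j) ^ ((d + 3) * d + d * n + 12) * (((2 : ℝ) ^ j) ^ (4 * n))⁻¹)) ∧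
        ∀ ω (t : ℝ≥0), t ≤ U → ∀ x : Torus d,
          ‖∑ m ∈ latticeBall d (3 * 2 ^ j),
            w m * (cosChar m x * c m t ω + sinChar m x * s m t ω)‖ₑ ^ (2 * n) ≤ Q ω := by
  have hp : 2 * n ≠ 0 := by omega
  set C : ℝ≥0∞ := 2 ^ (2 * n) * chainConst (2 * n) U with hC
  have hCtop : C ≠ ∞ := by finiteness
  have hGtop := gaussConst_ne_top n
  refine ⟨(C * (2 * U * gaussConst n) * ENNReal.ofReal (levelConst d n)).toNNReal,
    fun j w b hw hL => ?_⟩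
  rw [ENNReal.coe_toNNReal (by finiteness)]
  set F := latticeBall d (3 * 2 ^ j) with hF
  -- A mesh this fine gives the discretisation error the same decay `2^{-4jn}` as the main term; the
  -- cost in grid points does not depend on `n`.
  set N : ℕ := (2 ^ j) ^ (d + 3) with hN
  have hNpos : 0 < N := by positivity
  set E : ℝ≥0∞ := ENNReal.ofReal (2 * Real.pi * d * (3 * 2 ^ j : ℕ) * b / N) ^ (2 * n)
    * (2 * F.card : ℝ≥0∞) ^ (2 * n) with hE
  set Y : (Fin d → Fin N) → Ω → ℝ≥0∞ := fun k ω => chainSum (2 * n) U fun t =>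
    modeSum c s F (fun m => w m * cosChar m (gridPt N k)) (fun m => w m * sinChar m (gridPt N k)) t ω
    with hY
  set A : (Fin d → ℤ) → Ω → ℝ≥0∞ := fun m ω => chainSum (2 * n) U fun t =>
    modeSum c s {m} (fun _ => 1) (fun _ => 0) t ω with hA
  set B : (Fin d → ℤ) → Ω → ℝ≥0∞ := fun m ω => chainSum (2 * n) U fun t =>
    modeSum c s {m} (fun _ => 0) (fun _ => 1) t ω with hB
  have hYm : ∀ k, Measurable (Y k) := fun k => h.measurable_chainSum _ _ _ _ _
  have hAm : ∀ m, Measurable (A m) := fun m => h.measurable_chainSum _ _ _ _ _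
  have hBm : ∀ m, Measurable (B m) := fun m => h.measurable_chainSum _ _ _ _ _
  have hAB : ∀ m, Measurable fun ω => A m ω + B m ω := fun m => (hAm m).add (hBm m)
  have hsY : Measurable fun ω => ∑ k, Y k ω := Finset.measurable_sum _ fun k _ => hYm k
  have hsumm : Measurable fun ω => ∑ m ∈ F, (A m ω + B m ω) :=
    Finset.measurable_sum _ fun m _ => hAB m
  have hall : Measurable fun ω => ∑ k, Y k ω + E * ∑ m ∈ F, (A m ω + B m ω) :=
    hsY.add (hsumm.const_mul E)
  -- The dominating variable collects the chain sums of the block at all grid points and those of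
  -- the individual modes, which control the discretisation error.
  refine ⟨fun ω => C * (∑ k, Y k ω + E * ∑ m ∈ F, (A m ω + B m ω)), ?_, ?_, ?_⟩
  · exact hall.const_mul C
  · have hcard : (F.card : ℝ) ≤ 7 ^ d * (2 ^ j) ^ d := by
      rw [hF, card_latticeBall, ← mul_pow]
      push_cast
      gcongr
      have : (1 : ℝ) ≤ 2 ^ j := one_le_pow₀ (by norm_num)
      linarith
    have hYi : ∀ k, ∫⁻ ω, Y k ω ∂P ≤ 2 * U * (gaussConst n * ENNReal.ofReal
        ((2 * (F.card * (b : ℝ) ^ 2)) ^ n * (((2 : ℝ) ^ j) ^ 4)⁻¹ ^ (n - 3))) := by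
      intro k
      refine (h.lintegral_chainSum_le hξ F _ _ (L := 16 ^ j) (one_le_pow₀ (by norm_num))
        (fun m hm => ?_) hn U).trans ?_
      · rcases hL m hm with h1 | h1
        · exact Or.inl h1
        · right; simp [h1]
      · rw [show ((16 : ℝ) ^ j) = (2 ^ j) ^ 4 by rw [← pow_mul, mul_comm, pow_mul]; norm_num]
        gcongr 2 * U * (gaussConst n * ENNReal.ofReal ((2 * ?_) ^ n * _))
        calc ∑ m ∈ F, ((w m * cosChar m (gridPt N k)) ^ 2 + (w m * sinChar m (gridPt N k)) ^ 2)
            ≤ ∑ _m ∈ F, (b : ℝ) ^ 2 := by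
              refine Finset.sum_le_sum fun m hm => ?_
              rw [mul_pow, mul_pow, ← mul_add, cosChar_sq_add_sinChar_sq, mul_one, ← sq_abs]
              gcongr
              exact hw m hm
          _ = _ := by simp
    have hAi : ∀ m, ∫⁻ ω, A m ω ∂P ≤ 2 * U * (gaussConst n * ENNReal.ofReal (2 ^ n)) := by
      intro m
      simpa using h.lintegral_chainSum_le hξ {m} (fun _ => 1) (fun _ => 0) le_rfl
        (fun _ _ => Or.inl (le_max_left _ _)) hn U
    have hBi : ∀ m, ∫⁻ ω, B m ω ∂P ≤ 2 * U * (gaussConst n * ENNReal.ofReal (2 ^ n)) := by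
      intro m
      simpa using h.lintegral_chainSum_le hξ {m} (fun _ => 0) (fun _ => 1) le_rfl
        (fun _ _ => Or.inl (le_max_left _ _)) hn U
    beta_reduce
    rw [lintegral_const_mul _ hall, lintegral_add_right _ (hsumm.const_mul E),
      lintegral_const_mul _ hsumm, lintegral_finsetSum _ (fun k _ => hYm k),
      lintegral_finsetSum _ (fun m _ => hAB m)]
    have hs1 : ∑ k, ∫⁻ ω, Y k ω ∂P ≤ 2 * U * gaussConst n * ENNReal.ofReal
        ((((2 : ℝ) ^ j) ^ (d + 3)) ^ d * ((2 * (F.card * (b : ℝ) ^ 2)) ^ n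
          * (((2 : ℝ) ^ j) ^ 4)⁻¹ ^ (n - 3))) := by
      refine (Finset.sum_le_sum fun k _ => hYi k).trans (le_of_eq ?_)
      rw [Finset.sum_const, Finset.card_univ, nsmul_eq_mul, Fintype.card_fun, Fintype.card_fin,
        Fintype.card_fin, ENNReal.ofReal_mul (by positivity : (0 : ℝ) ≤ (((2 : ℝ) ^ j) ^ (d + 3)) ^ d)]
      rw [show ENNReal.ofReal ((((2 : ℝ) ^ j) ^ (d + 3)) ^ d) = ((N ^ d : ℕ) : ℝ≥0∞) by
        rw [← ENNReal.ofReal_natCast, hN]; push_cast; rfl]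
      ring
    have hs2 : ∑ m ∈ F, ∫⁻ ω, A m ω + B m ω ∂P ≤ 2 * U * gaussConst n * ENNReal.ofReal
        (F.card * 2 * 2 ^ n) := by
      refine (Finset.sum_le_sum fun m _ => ?_ : _ ≤ ∑ _m ∈ F,
        (2 * U * (gaussConst n * ENNReal.ofReal (2 ^ n))
          + 2 * U * (gaussConst n * ENNReal.ofReal (2 ^ n)))).trans (le_of_eq ?_)
      · rw [lintegral_add_right _ (hBm m)]
        exact add_le_add (hAi m) (hBi m)
      · rw [Finset.sum_const, nsmul_eq_mul, mul_assoc (F.card : ℝ),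
          ENNReal.ofReal_mul (Nat.cast_nonneg _), ENNReal.ofReal_natCast,
          ENNReal.ofReal_mul two_pos.le, ENNReal.ofReal_ofNat]
        ring
    have hE' : E = ENNReal.ofReal ((2 * Real.pi * d * (3 * 2 ^ j) * b
        / ((2 : ℝ) ^ j) ^ (d + 3)) ^ (2 * n) * (2 * F.card) ^ (2 * n)) := by
      rw [ENNReal.ofReal_mul (by positivity), ENNReal.ofReal_pow (by positivity),
        ENNReal.ofReal_pow (by positivity), ENNReal.ofReal_mul two_pos.le, ENNReal.ofReal_natCast,
        ENNReal.ofReal_ofNat, hE, hN]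
      push_cast
      rfl
    calc C * (∑ k, ∫⁻ ω, Y k ω ∂P + E * ∑ m ∈ F, ∫⁻ ω, A m ω + B m ω ∂P)
        ≤ C * (2 * U * gaussConst n * ENNReal.ofReal
          ((((2 : ℝ) ^ j) ^ (d + 3)) ^ d * ((2 * (F.card * (b : ℝ) ^ 2)) ^ n
          * (((2 : ℝ) ^ j) ^ 4)⁻¹ ^ (n - 3)))
          + E * (2 * U * gaussConst n * ENNReal.ofReal (F.card * 2 * 2 ^ n))) := by gcongr
      _ = C * (2 * U * gaussConst n) * ENNReal.ofReal
          ((((2 : ℝ) ^ j) ^ (d + 3)) ^ d * ((2 * (F.card * (b : ℝ) ^ 2)) ^ n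
          * (((2 : ℝ) ^ j) ^ 4)⁻¹ ^ (n - 3)) + (2 * Real.pi * d * (3 * 2 ^ j) * b
        / ((2 : ℝ) ^ j) ^ (d + 3)) ^ (2 * n) * (2 * F.card) ^ (2 * n) * (F.card * 2 * 2 ^ n)) := by
          rw [hE', ENNReal.ofReal_add (by positivity) (by positivity),
            ENNReal.ofReal_mul (q := F.card * 2 * 2 ^ n) (by positivity)]
          ring
      _ ≤ C * (2 * U * gaussConst n) * ENNReal.ofReal (levelConst d n * (b : ℝ) ^ (2 * n)
          * (((2 : ℝ) ^ j) ^ ((d + 3) * d + d * n + 12) * (((2 : ℝ) ^ j) ^ (4 * n))⁻¹)) := by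
          gcongr
          exact level_arith d hn (one_le_pow₀ (by norm_num)) b.2 (Nat.cast_nonneg _) hcard
      _ = _ := by
          rw [mul_assoc (levelConst d n), ENNReal.ofReal_mul (levelConst_nonneg d n)]
          ring
  · intro ω t ht x
    refine (enorm_trigSum_pow_le hNpos (3 * 2 ^ j) hp hw x).trans ?_
    have hk : ∀ k : Fin d → Fin N, ‖∑ m ∈ F, w m * (cosChar m (gridPt N k) * c m t ω
        + sinChar m (gridPt N k) * s m t ω)‖ₑ ^ (2 * n) ≤ chainConst (2 * n) U * Y k ω := by
      intro k
      refine le_trans (le_of_eq ?_) (h.enorm_modeSum_pow_le F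
        (fun m => w m * cosChar m (gridPt N k)) (fun m => w m * sinChar m (gridPt N k)) hp ht ω)
      congr 2
      exact Finset.sum_congr rfl fun m _ => by ring
    have hm1 : ∀ m, ‖c m t ω‖ₑ ^ (2 * n) ≤ chainConst (2 * n) U * A m ω := by
      intro m
      have := h.enorm_modeSum_pow_le {m} (fun _ => 1) (fun _ => 0) hp ht ω
      simpa [modeSum, hA] using this
    have hm2 : ∀ m, ‖s m t ω‖ₑ ^ (2 * n) ≤ chainConst (2 * n) U * B m ω := by
      intro m
      have := h.enorm_modeSum_pow_le {m} (fun _ => 0) (fun _ => 1) hp ht ω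
      simpa [modeSum, hB] using this
    calc _ ≤ 2 ^ (2 * n) * (∑ k, chainConst (2 * n) U * Y k ω
          + E * ∑ m ∈ F, (chainConst (2 * n) U * A m ω + chainConst (2 * n) U * B m ω)) := by
          gcongr with k _ m _
          · exact hk k
          · exact hm1 m
          · exact hm2 m
      _ = _ := by
          simp only [← mul_add, ← Finset.mul_sum]
          rw [hC]
          ring

/-- Comparing exponents of `2^j`, one needs `2n(2 - d/2 - θ) ≥ (d+3)d + 12 + 1`: the losses from
grid and chaining, plus one for the factor `2^{-j}`. A large `n` achieves this because `2 - d/2 - θ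
> 0`. -/
theorem exists_exponent (d : ℕ) {θ : ℝ} (hθ : θ < 2 - (d : ℝ) / 2) :
    ∃ n : ℕ, 3 ≤ n ∧ ∀ j : ℕ, (2 : ℝ) ^ (θ * ((j : ℝ) - 1) * (2 * n : ℕ))
      * (((2 : ℝ) ^ j) ^ ((d + 3) * d + d * n + 12) * (((2 : ℝ) ^ j) ^ (4 * n))⁻¹)
      ≤ 2 ^ (-θ * (2 * n : ℕ)) * (1 / 2) ^ j := by
  have hγ : 0 < 2 - (d : ℝ) / 2 - θ := by linarith
  obtain ⟨n, hn⟩ := exists_nat_ge (max 3 ((((d : ℝ) + 3) * d + 13) / (2 * (2 - (d : ℝ) / 2 - θ))))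
  have hn3 : (3 : ℝ) ≤ n := (le_max_left _ _).trans hn
  have hn2 := (le_max_right _ _).trans hn
  rw [div_le_iff₀ (by positivity)] at hn2
  refine ⟨n, by exact_mod_cast hn3, fun j => ?_⟩
  rw [← pow_mul, ← pow_mul, ← Real.rpow_natCast 2 (j * _), ← Real.rpow_natCast 2 (j * (4 * n)),
    ← Real.rpow_neg two_pos.le, ← Real.rpow_add two_pos, ← Real.rpow_add two_pos, one_div, inv_pow,
    ← Real.rpow_natCast 2 j, ← Real.rpow_neg two_pos.le, ← Real.rpow_add two_pos]
  refine Real.rpow_le_rpow_of_exponent_le (by norm_num) ?_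
  push_cast
  have hj : (0 : ℝ) ≤ j := Nat.cast_nonneg j
  nlinarith [mul_le_mul_of_nonneg_left hn2 hj]

/-- The moment bound for the Besov norm of a Fourier multiplier of the stochastic convolution. -/
theorem IsModeFamily.exists_besov_bound (h : IsModeFamily P ξ c s)
    (hξ : IsSpaceTimeWhiteNoise P ξ) (ρ : DyadicPartition d) {θ : ℝ}
    (hθ : θ < 2 - (d : ℝ) / 2) :
    ∃ n : ℕ, n ≠ 0 ∧ ∀ U : ℕ, ∃ K : ℝ≥0, ∀ (a : (Fin d → ℤ) → ℝ) (b : ℕ → ℝ≥0),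
      (∀ j, ∀ m ∈ latticeBall d (3 * 2 ^ j), |a m| ≤ b j) →
      ∃ T : Ω → ℝ≥0∞, Measurable T ∧
        ∫⁻ ω, T ω ∂P ≤ K * ∑' j, ENNReal.ofReal ((b j : ℝ) ^ n * (1 / 2) ^ j) ∧
        ∀ ω (t : ℝ≥0), t ≤ U → ∀ f : Dist d, (∀ m, pair f (cosTest m) = a m * c m t ω) →
          (∀ m, pair f (sinTest m) = a m * s m t ω) → besovNorm ρ θ f ^ n ≤ T ω := by
  obtain ⟨n, hn, hexp⟩ := exists_exponent d hθ
  have hp : 2 * n ≠ 0 := by omega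
  refine ⟨2 * n, hp, fun U => ?_⟩
  obtain ⟨K, hK⟩ := h.exists_level_bound hξ hn U
  refine ⟨K * ((2 : ℝ) ^ (-θ * (2 * n : ℕ))).toNNReal, fun a b hab => ?_⟩
  -- The combined multiplier `ρ_j a` is still bounded by `b j` and vanishes off the annulus, as the
  -- block estimate requires.
  have hlev : ∀ j, ∃ Q : Ω → ℝ≥0∞, Measurable Q ∧ _ ∧ _ := fun j =>
    hK j (fun m => ρ.fn j (latticePt m) * a m) (b j) (fun m hm => by
      rw [abs_mul, abs_of_nonneg (ρ.fn_nonneg j _)]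
      exact (mul_le_of_le_one_left (abs_nonneg _) (ρ.fn_le_one j _)).trans (hab j m hm))
      (fun m _ => by
        by_cases h0 : ρ.fn j (latticePt m) = 0
        · right; rw [h0, zero_mul]
        · exact Or.inl (ρ.pow_le_of_fn_ne_zero j h0))
  choose Q hQm hQi hQb using hlev
  set W : ℕ → ℝ≥0∞ := fun j => (2 : ℝ≥0∞) ^ (θ * ((j : ℝ) - 1)) with hW
  have hWp : ∀ j, W j ^ (2 * n) = ENNReal.ofReal ((2 : ℝ) ^ (θ * ((j : ℝ) - 1) * (2 * n : ℕ))) := by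
    intro j
    rw [hW, Real.rpow_mul two_pos.le, Real.rpow_natCast, ENNReal.ofReal_pow (by positivity),
      ← ENNReal.ofReal_rpow_of_pos two_pos, ENNReal.ofReal_ofNat]
  -- In the `2n`-th power the supremum over the blocks is dominated by their sum, which can be
  -- integrated term by term.
  refine ⟨fun ω => ∑' j, W j ^ (2 * n) * Q j ω, Measurable.tsum fun j => (hQm j).const_mul _,
    ?_, ?_⟩
  · rw [lintegral_tsum fun j => ((hQm j).const_mul _).aemeasurable, ← ENNReal.tsum_mul_left]
    refine ENNReal.tsum_le_tsum fun j => ?_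
    rw [lintegral_const_mul _ (hQm j)]
    refine (mul_le_mul_right (hQi j) _).trans ?_
    rw [hWp, mul_left_comm, ← ENNReal.ofReal_mul (by positivity), ENNReal.coe_mul, mul_assoc (K : ℝ≥0∞),
      ENNReal.ofNNReal_toNNReal, ← ENNReal.ofReal_mul (by positivity)]
    gcongr (K : ℝ≥0∞) * ENNReal.ofReal ?_
    have hb : (0 : ℝ) ≤ (b j : ℝ) ^ (2 * n) := by positivity
    calc _ = (b j : ℝ) ^ (2 * n) * ((2 : ℝ) ^ (θ * ((j : ℝ) - 1) * (2 * n : ℕ))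
      * (((2 : ℝ) ^ j) ^ ((d + 3) * d + d * n + 12) * (((2 : ℝ) ^ j) ^ (4 * n))⁻¹)) := by ring
      _ ≤ (b j : ℝ) ^ (2 * n) * (2 ^ (-θ * (2 * n : ℕ)) * (1 / 2) ^ j) := by
        exact mul_le_mul_of_nonneg_left (hexp j) hb
      _ = _ := by ring
  · intro ω t ht f hfc hfs
    have hpr : (0 : ℝ) < (2 * n : ℕ) := by positivity
    rw [← ENNReal.rpow_natCast, ← ENNReal.le_rpow_inv_iff hpr]
    refine besovNorm_le_of_block_le fun j x => ?_
    rw [ENNReal.le_rpow_inv_iff hpr, ENNReal.rpow_natCast, mul_pow]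
    refine le_trans ?_ (ENNReal.le_tsum j)
    refine mul_le_mul_right (le_trans (le_of_eq ?_) (hQb j ω t ht x)) _
    rw [block_eq_sum]
    congr 2
    refine Finset.sum_congr rfl fun m _ => ?_
    rw [hfc, hfs]
    ring

end Modes

/-! ### Limits of trigonometric polynomials in the Besov space -/

/-- High blocks of a trigonometric polynomial vanish, so there the block of `f` is that of the small
difference. This is how limits in Besov norm land in `𝒞^α` rather than merely having finite norm. -/
theorem tendsto_block_of_tendsto_trigDist {ρ : DyadicPartition d} {α : ℝ} {f : Dist d}
    {R : ℕ → ℕ} {c s : (Fin d → ℤ) → ℝ}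
    (h : Tendsto (fun n => besovNorm ρ α (f - trigDist (R n) c s)) atTop (𝓝 0)) :
    Tendsto (fun q : ℕ => (2 : ℝ≥0∞) ^ (α * (q : ℝ)) *
      eLpNorm (block ρ (q + 1) f) ∞ (torusMeasure d)) atTop (𝓝 0) := by
  rw [ENNReal.tendsto_nhds_zero] at h ⊢
  intro ε hε
  obtain ⟨n, hn⟩ := (h ε hε).exists
  obtain ⟨J, hJ⟩ := exists_fn_eq_zero_of_le ρ (R n)
  filter_upwards [eventually_ge_atTop J] with q hq
  refine le_trans ?_ hn
  refine le_iSup_of_le (q + 1) ?_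
  have e : block ρ (q + 1) (f - trigDist (R n) c s) = block ρ (q + 1) f := by
    have e1 : block ρ (q + 1) (f - trigDist (R n) c s)
        = block ρ (q + 1) f - block ρ (q + 1) (trigDist (R n) c s) := rfl
    rw [e1, block_trigDist_eq_zero (hJ (q + 1) (by omega)), sub_zero]
  rw [e]
  simp

/-- Continuous Fourier modes which are approximated by their finite parts, uniformly on compact
time intervals. -/
def IsGood (ρ : DyadicPartition d) (α : ℝ) (c s : (Fin d → ℤ) → ℝ≥0 → ℝ) : Prop :=
  ∃ (hc : ∀ t, PolyBounded fun m => c m t) (hs : ∀ t, PolyBounded fun m => s m t), ∀ U : ℕ,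
    Tendsto (fun n : ℕ => ⨆ (t : ℝ≥0) (_ : t ≤ U), besovNorm ρ α
      (coeffDist (fun m => c m t) (fun m => s m t) (hc t) (hs t)
        - trigDist (3 * 2 ^ n) (fun m => c m t) (fun m => s m t))) atTop (𝓝 0)

variable {ρ : DyadicPartition d} {α : ℝ} {c s : (Fin d → ℤ) → ℝ≥0 → ℝ}

/-- The distribution-valued path with the given Fourier modes. -/
def IsGood.path (h : IsGood ρ α c s) (t : ℝ≥0) : Dist d :=
  coeffDist (fun m => c m t) (fun m => s m t) (h.choose t) (h.choose_spec.choose t)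

theorem IsGood.exists_bound (h : IsGood ρ α c s) (U : ℕ) : ∃ e : ℕ → ℝ≥0∞,
    Tendsto e atTop (𝓝 0) ∧ ∀ n, ∀ t : ℝ≥0, t ≤ U → besovNorm ρ α
      (h.path t - trigDist (3 * 2 ^ n) (fun m => c m t) (fun m => s m t)) ≤ e n :=
  ⟨_, h.choose_spec.choose_spec U, fun _ t ht => le_iSup₂_of_le t ht le_rfl⟩

theorem IsGood.tendsto_besovNorm (h : IsGood ρ α c s) (t : ℝ≥0) :
    Tendsto (fun n : ℕ => besovNorm ρ α
      (h.path t - trigDist (3 * 2 ^ n) (fun m => c m t) (fun m => s m t))) atTop (𝓝 0) := by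
  obtain ⟨U, hU⟩ := exists_nat_ge t
  obtain ⟨e, he, hb⟩ := h.exists_bound U
  exact tendsto_of_tendsto_of_tendsto_of_le_of_le tendsto_const_nhds he (fun _ => zero_le)
    fun n => hb n t hU

/-- The path with values in `𝒞^α` with the given Fourier modes. -/
def IsGood.field (h : IsGood ρ α c s) (t : ℝ≥0) : BesovC ρ α :=
  ⟨h.path t, tendsto_block_of_tendsto_trigDist (h.tendsto_besovNorm t)⟩

theorem IsGood.pair_field_cosTest (h : IsGood ρ α c s) {t : ℝ≥0} (hc : ∀ m, c (-m) t = c m t)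
    (m : Fin d → ℤ) : pair (h.field t).toDist (cosTest m) = c m t :=
  pair_coeffDist_cosTest (h.choose t) (h.choose_spec.choose t) hc m

theorem IsGood.pair_field_sinTest (h : IsGood ρ α c s) {t : ℝ≥0} (hs : ∀ m, s (-m) t = -s m t)
    (m : Fin d → ℤ) : pair (h.field t).toDist (sinTest m) = s m t :=
  pair_coeffDist_sinTest (h.choose t) (h.choose_spec.choose t) hs m

theorem IsGood.tendsto_field (h : IsGood ρ α c s) (t : ℝ≥0) :
    Tendsto (fun n : ℕ => trigBesov ρ α (3 * 2 ^ n) (fun m => c m t, fun m => s m t)) atTop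
      (𝓝 (h.field t)) := by
  rw [tendsto_iff_edist_tendsto_0]
  refine (h.tendsto_besovNorm t).congr fun n => ?_
  rw [edist_comm]
  rfl

/-- A locally uniform limit of the continuous paths of the truncations. -/
theorem IsGood.continuous_field (h : IsGood ρ α c s) (hc : ∀ m, Continuous (c m))
    (hs : ∀ m, Continuous (s m)) : Continuous h.field := by
  rw [continuous_iff_continuousAt]
  intro t
  refine continuousAt_of_locally_uniform_approx_of_continuousAt fun u hu => ?_
  obtain ⟨ε, hε, hεu⟩ := mem_uniformity_edist.1 hu
  obtain ⟨U, hU⟩ := exists_nat_gt t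
  obtain ⟨e, he, hb⟩ := h.exists_bound U
  obtain ⟨n, hn⟩ := (he.eventually_lt_const hε).exists
  refine ⟨Set.Iio (U : ℝ≥0), Iio_mem_nhds hU,
    fun r => trigBesov ρ α (3 * 2 ^ n) (fun m => c m r, fun m => s m r), ?_, fun r hr => ?_⟩
  · exact ((continuous_trigBesov ρ α (3 * 2 ^ n)).comp
      ((continuous_pi hc).prodMk (continuous_pi hs))).continuousAt
  · exact hεu ((hb n r (le_of_lt hr)).trans_lt hn)

open scoped Classical in
/-- The process with values in `𝒞^α` with given random Fourier modes. -/
def besovField {Ω : Type*} (ρ : DyadicPartition d) (α : ℝ) (c s : (Fin d → ℤ) → ℝ≥0 → Ω → ℝ)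
    (t : ℝ≥0) (ω : Ω) : BesovC ρ α :=
  if h : IsGood ρ α (fun m t => c m t ω) (fun m t => s m t ω) then h.field t
  else trigBesov ρ α 0 0

section Field

variable {Ω : Type*} {c s : (Fin d → ℤ) → ℝ≥0 → Ω → ℝ}

theorem besovField_of_isGood {ω : Ω}
    (h : IsGood ρ α (fun m t => c m t ω) (fun m t => s m t ω)) (t : ℝ≥0) :
    besovField ρ α c s t ω = h.field t := dif_pos h

theorem continuous_besovField (hc : ∀ m ω, Continuous fun t => c m t ω)
    (hs : ∀ m ω, Continuous fun t => s m t ω) (ω : Ω) :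
    Continuous fun t => besovField ρ α c s t ω := by
  by_cases h : IsGood ρ α (fun m t => c m t ω) (fun m t => s m t ω)
  · simp only [besovField_of_isGood h]
    exact h.continuous_field (fun m => hc m ω) (fun m => hs m ω)
  · simp only [besovField, dif_neg h]
    exact continuous_const

open scoped Classical in
-- A pointwise limit of continuous functions of countably many measurable modes. The `σ`-algebra on
-- `Ω` is arbitrary, so the same argument yields adaptedness.
theorem measurable_besovField [MeasurableSpace Ω] {t : ℝ≥0} (hc : ∀ m, Measurable (c m t))
    (hs : ∀ m, Measurable (s m t))
    (hG : MeasurableSet {ω | IsGood ρ α (fun m t => c m t ω) (fun m t => s m t ω)}) :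
    Measurable (besovField ρ α c s t) := by
  refine measurable_of_tendsto_metrizable (f := fun (n : ℕ) ω =>
    if ω ∈ {ω | IsGood ρ α (fun m t => c m t ω) (fun m t => s m t ω)} then
      trigBesov ρ α (3 * 2 ^ n) (fun m => c m t ω, fun m => s m t ω) else trigBesov ρ α 0 0)
    (fun n => ?_) ?_
  · exact Measurable.ite hG ((continuous_trigBesov ρ α (3 * 2 ^ n)).measurable.comp
      ((measurable_pi_lambda _ hc).prodMk (measurable_pi_lambda _ hs))) measurable_const
  · rw [tendsto_pi_nhds]
    intro ω
    by_cases h : IsGood ρ α (fun m t => c m t ω) (fun m t => s m t ω)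
    · simp only [besovField_of_isGood h, Set.mem_ofPred_eq, if_pos h]
      exact h.tendsto_field t
    · simp only [besovField, dif_neg h, Set.mem_ofPred_eq, if_neg h]
      exact tendsto_const_nhds

end Field

/-! ### The σ-algebras of the noise -/

section Sigma

variable {Ω : Type*} [mΩ : MeasurableSpace Ω] {P : Measure Ω}
  {ξ : (ℝ≥0 × Torus d → ℝ) → Ω → ℝ}

theorem noiseSigma_le (hξ : IsSpaceTimeWhiteNoise P ξ) (r : ℝ≥0) : noiseSigma P ξ r ≤ mΩ := by
  refine (iInf₂_le (r + 1) (lt_add_of_pos_right r one_pos)).trans (sup_le ?_ (iSup₂_le ?_))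
  · exact MeasurableSpace.generateFrom_le fun J hJ => hJ.1
  · exact fun φ hφ => (hξ.measurable φ hφ.1).comap_le

theorem measurableSet_noiseSigma_of_null {J : Set Ω} (hJ : MeasurableSet J) (h0 : P J = 0)
    (r : ℝ≥0) : MeasurableSet[noiseSigma P ξ r] J := by
  simp only [MeasurableSpace.measurableSet_iInf]
  intro q _
  exact (le_sup_left : MeasurableSpace.generateFrom {J | MeasurableSet J ∧ P J = 0} ≤ _) _
    (MeasurableSpace.measurableSet_generateFrom ⟨hJ, h0⟩)

theorem measurable_noiseSigma_apply {h : ℝ≥0 × Torus d → ℝ} (hh : SqIntegrable h) {r : ℝ≥0}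
    (h0 : ∀ q x, r < q → h (q, x) = 0) : Measurable[noiseSigma P ξ r] (ξ h) := by
  intro B hB
  simp only [MeasurableSpace.measurableSet_iInf]
  intro q hq
  have hle : MeasurableSpace.comap (ξ h) inferInstance ≤
      ⨆ (φ : ℝ≥0 × Torus d → ℝ) (_ : SqIntegrable φ ∧ ∀ s x, q < s → φ (s, x) = 0),
      MeasurableSpace.comap (ξ φ) inferInstance :=
    le_iSup₂_of_le h ⟨hh, fun s x hs => h0 s x (hq.trans hs)⟩ le_rfl
  exact (hle.trans le_sup_right) _ ⟨B, hB, rfl⟩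

/-- Preimages under the two functions differ only inside a null set, and each measurable null set
belongs to `ℱ_r`. -/
theorem measurable_noiseSigma_of_ae_eq (hξ : IsSpaceTimeWhiteNoise P ξ)
    {h : ℝ≥0 × Torus d → ℝ} (hh : SqIntegrable h) {r : ℝ≥0}
    (h0 : ∀ q x, r < q → h (q, x) = 0) {f : Ω → ℝ} (hf : Measurable f) (hae : f =ᵐ[P] ξ h) :
    Measurable[noiseSigma P ξ r] f := by
  intro B hB
  have hN : MeasurableSet {ω | f ω ≠ ξ h ω} :=
    (measurableSet_eq_fun hf (hξ.measurable h hh)).compl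
  have hN0 : P {ω | f ω ≠ ξ h ω} = 0 := hae
  have e : f ⁻¹' B = (ξ h ⁻¹' B \ {ω | f ω ≠ ξ h ω}) ∪ (f ⁻¹' B ∩ {ω | f ω ≠ ξ h ω}) := by
    ext ω
    by_cases hω : f ω = ξ h ω <;> simp [hω]
  rw [e]
  refine MeasurableSet.union (MeasurableSet.diff (measurable_noiseSigma_apply hh h0 hB) ?_) ?_
  · exact measurableSet_noiseSigma_of_null hN hN0 r
  · exact measurableSet_noiseSigma_of_null ((hf hB).inter hN)
      (measure_mono_null Set.inter_subset_right hN0) r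

end Sigma

section Modes

variable {Ω : Type*} [MeasurableSpace Ω] {P : Measure Ω}
  {ξ : (ℝ≥0 × Torus d → ℝ) → Ω → ℝ} {c s : (Fin d → ℤ) → ℝ≥0 → Ω → ℝ}

/-! ### Almost sure convergence of the Fourier series -/

/-- The crude inequality `|x| ≤ 1 + |x|⁶` avoids sixth roots, as polynomial growth of any fixed
order suffices. -/
theorem le_one_add_mul_of_enorm_pow_le {x w : ℝ} {g A : ℝ≥0∞} (hw : 1 ≤ w) (hg : g ≠ ∞)
    (h : ‖x‖ₑ ^ 6 ≤ A) (hA : ENNReal.ofReal w⁻¹ * A ≤ g) : |x| ≤ (1 + g.toReal) * w := by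
  have hw0 : 0 < w := by linarith
  have h1 : ENNReal.ofReal (w⁻¹ * |x| ^ 6) ≤ g := by
    rw [ENNReal.ofReal_mul (by positivity), ENNReal.ofReal_pow (abs_nonneg _), ← Real.norm_eq_abs,
      ofReal_norm]
    exact (mul_le_mul_right h _).trans hA
  have h2 : w⁻¹ * |x| ^ 6 ≤ g.toReal := (ENNReal.ofReal_le_iff_le_toReal hg).1 h1
  rw [inv_mul_le_iff₀ hw0] at h2
  have h3 : |x| ≤ 1 + |x| ^ 6 := by
    rcases le_total |x| 1 with h4 | h4
    · have : 0 ≤ |x| ^ 6 := by positivity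
      linarith
    · have := le_self_pow₀ h4 (by norm_num : (6 : ℕ) ≠ 0)
      linarith
  nlinarith

/-- The expected chain sums of single modes are bounded uniformly in `m`, so their sum against the
summable weights `(1 + ‖m‖)^{-2d}` is almost surely finite, and it bounds every mode at once. -/
theorem IsModeFamily.ae_exists_bound (h : IsModeFamily P ξ c s)
    (hξ : IsSpaceTimeWhiteNoise P ξ) (U : ℕ) : ∀ᵐ ω ∂P, ∃ C : ℝ, ∀ m, ∀ t : ℝ≥0, t ≤ U →
      |c m t ω| ≤ C * (1 + ‖m‖) ^ (2 * d) ∧ |s m t ω| ≤ C * (1 + ‖m‖) ^ (2 * d) := by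
  set A : (Fin d → ℤ) → Ω → ℝ≥0∞ := fun m ω => chainSum (2 * 3) U fun t =>
    modeSum c s {m} (fun _ => 1) (fun _ => 0) t ω with hA
  set B : (Fin d → ℤ) → Ω → ℝ≥0∞ := fun m ω => chainSum (2 * 3) U fun t =>
    modeSum c s {m} (fun _ => 0) (fun _ => 1) t ω with hB
  set K : ℝ≥0∞ := (chainConst (2 * 3) U : ℝ≥0∞) with hK
  set κ : ℝ≥0∞ := 2 * U * (gaussConst 3 * ENNReal.ofReal (2 ^ 3)) with hκ
  have hκtop : κ ≠ ∞ := by have := gaussConst_ne_top 3; finiteness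
  have hAm : ∀ m, Measurable (A m) := fun m => h.measurable_chainSum _ _ _ _ _
  have hBm : ∀ m, Measurable (B m) := fun m => h.measurable_chainSum _ _ _ _ _
  have hAi : ∀ m, ∫⁻ ω, A m ω ∂P ≤ κ := fun m => by
    refine (h.lintegral_chainSum_le hξ {m} (fun _ => 1) (fun _ => 0) le_rfl
      (fun _ _ => Or.inl (le_max_left _ _)) le_rfl U).trans (le_of_eq ?_)
    simp [hκ]
  have hBi : ∀ m, ∫⁻ ω, B m ω ∂P ≤ κ := fun m => by
    refine (h.lintegral_chainSum_le hξ {m} (fun _ => 0) (fun _ => 1) le_rfl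
      (fun _ _ => Or.inl (le_max_left _ _)) le_rfl U).trans (le_of_eq ?_)
    simp [hκ]
  set W : (Fin d → ℤ) → Ω → ℝ≥0∞ := fun m ω =>
    ENNReal.ofReal ((1 + ‖m‖) ^ (2 * d))⁻¹ * (K * (A m ω + B m ω)) with hW
  have hABm : ∀ m, Measurable fun ω => A m ω + B m ω := fun m => (hAm m).add (hBm m)
  have hWm : ∀ m, Measurable (W m) := fun m => ((hABm m).const_mul _).const_mul _
  have hint : ∫⁻ ω, ∑' m, W m ω ∂P ≠ ∞ := by
    rw [lintegral_tsum fun m => (hWm m).aemeasurable]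
    refine ne_top_of_le_ne_top (b := (∑' m : Fin d → ℤ,
      ENNReal.ofReal ((1 + ‖m‖) ^ (2 * d))⁻¹) * (K * (κ + κ))) ?_ ?_
    · have := (summable_lattice d).tsum_ofReal_ne_top
      finiteness
    · rw [← ENNReal.tsum_mul_right]
      refine ENNReal.tsum_le_tsum fun m => ?_
      rw [hW]
      beta_reduce
      rw [lintegral_const_mul _ ((hABm m).const_mul _), lintegral_const_mul _ (hABm m),
        lintegral_add_right _ (hBm m)]
      gcongr
      · exact hAi m
      · exact hBi m
  filter_upwards [ae_lt_top (Measurable.tsum hWm) hint] with ω hω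
  refine ⟨1 + (∑' m, W m ω).toReal, fun m t ht => ?_⟩
  have hw : (1 : ℝ) ≤ (1 + ‖m‖) ^ (2 * d) := one_le_pow₀ (by linarith [norm_nonneg m])
  have hle : W m ω ≤ ∑' m, W m ω := ENNReal.le_tsum m
  constructor
  · have h1 := h.enorm_modeSum_pow_le {m} (fun _ => 1) (fun _ => 0) (p := 2 * 3) (by norm_num) ht ω
    refine le_one_add_mul_of_enorm_pow_le (A := K * (A m ω + B m ω)) hw hω.ne ?_ hle
    refine le_trans ?_ (mul_le_mul_right (le_self_add : A m ω ≤ A m ω + B m ω) K)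
    simpa [modeSum, hA] using h1
  · have h1 := h.enorm_modeSum_pow_le {m} (fun _ => 0) (fun _ => 1) (p := 2 * 3) (by norm_num) ht ω
    refine le_one_add_mul_of_enorm_pow_le (A := K * (A m ω + B m ω)) hw hω.ne ?_ hle
    refine le_trans ?_ (mul_le_mul_right (le_add_self : B m ω ≤ A m ω + B m ω) K)
    simpa [modeSum, hB] using h1

/-- Writing `1/2 = (2/3)(3/4)` extracts a factor `(2/3)^n` from the tail while leaving a convergent
series. The bound is then summable in `n`. -/
theorem tsum_tail_le (N n : ℕ) (hN : N ≠ 0) :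
    ∑' j, ENNReal.ofReal (((if j ≤ n then 0 else 1 : ℝ≥0) : ℝ) ^ N * (1 / 2) ^ j)
      ≤ ENNReal.ofReal ((2 / 3) ^ n) * ∑' j : ℕ, ENNReal.ofReal ((3 / 4) ^ j) := by
  rw [← ENNReal.tsum_mul_left]
  refine ENNReal.tsum_le_tsum fun j => ?_
  rw [← ENNReal.ofReal_mul (by positivity)]
  refine ENNReal.ofReal_le_ofReal ?_
  split_ifs with hj
  · rw [NNReal.coe_zero, zero_pow hN, zero_mul]
    positivity
  · rw [NNReal.coe_one, one_pow, one_mul, show (1 / 2 : ℝ) = 2 / 3 * (3 / 4) by norm_num, mul_pow]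
    exact mul_le_mul_of_nonneg_right
      (pow_le_pow_of_le_one (by norm_num) (by norm_num) (not_le.1 hj).le) (by positivity)

theorem summable_geometric_ofReal {r : ℝ} (h0 : 0 ≤ r) (h1 : r < 1) :
    ∑' n : ℕ, ENNReal.ofReal (r ^ n) ≠ ∞ :=
  (summable_geometric_of_lt_one h0 h1).tsum_ofReal_ne_top

theorem tendsto_zero_of_pow_le {N : ℕ} (hN : N ≠ 0) {f g : ℕ → ℝ≥0∞} (h : ∀ n, f n ^ N ≤ g n)
    (hg : Tendsto g atTop (𝓝 0)) : Tendsto f atTop (𝓝 0) := by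
  rw [ENNReal.tendsto_nhds_zero] at hg ⊢
  intro ε hε
  filter_upwards [hg (ε ^ N) (pos_iff_ne_zero.2 (pow_ne_zero N hε.ne'))] with n hn
  exact (ENNReal.pow_le_pow_left_iff hN).1 ((h n).trans hn)

/-- The moment bound is applied to the multiplier that removes the box of radius `3 · 2^n`. The
means of the dominating variables are summable in `n`, so these variables tend to zero almost
surely. -/
theorem IsModeFamily.ae_isGood (h : IsModeFamily P ξ c s) (hξ : IsSpaceTimeWhiteNoise P ξ)
    (ρ : DyadicPartition d) {θ : ℝ} (hθ : θ < 2 - (d : ℝ) / 2) :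
    ∀ᵐ ω ∂P, IsGood ρ θ (fun m t => c m t ω) (fun m t => s m t ω) := by
  obtain ⟨N, hN, hbd⟩ := h.exists_besov_bound hξ ρ hθ
  choose K hK using hbd
  have hT : ∀ U n : ℕ, ∃ T : Ω → ℝ≥0∞, Measurable T ∧ ∫⁻ ω, T ω ∂P ≤ K U *
      ∑' j, ENNReal.ofReal (((if j ≤ n then 0 else 1 : ℝ≥0) : ℝ) ^ N * (1 / 2) ^ j) ∧
      ∀ ω (t : ℝ≥0), t ≤ U → ∀ f : Dist d,
        (∀ m, pair f (cosTest m)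
          = (if m ∈ latticeBall d (3 * 2 ^ n) then 0 else 1) * c m t ω) →
        (∀ m, pair f (sinTest m)
          = (if m ∈ latticeBall d (3 * 2 ^ n) then 0 else 1) * s m t ω) →
        besovNorm ρ θ f ^ N ≤ T ω := fun U n => by
    -- The boxes are nested, so the multiplier vanishes on the frequencies of every block `j ≤ n`
    -- and is at most `1` elsewhere.
    refine hK U _ _ fun j m hm => ?_
    by_cases hj : j ≤ n
    · have : m ∈ latticeBall d (3 * 2 ^ n) :=
        latticeBall_mono (Nat.mul_le_mul_left 3 (Nat.pow_le_pow_right (by norm_num) hj)) hm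
      simp [this]
    · rw [if_neg hj]
      split_ifs <;> simp
  choose T hTm hTi hTb using hT
  have hlim : ∀ U, ∀ᵐ ω ∂P, Tendsto (fun n => T U n ω) atTop (𝓝 0) := fun U => by
    have hfin : ∫⁻ ω, ∑' n, T U n ω ∂P ≠ ∞ := by
      rw [lintegral_tsum fun n => (hTm U n).aemeasurable]
      refine ne_top_of_le_ne_top (b := (K U : ℝ≥0∞) * ((∑' n : ℕ, ENNReal.ofReal ((2 / 3) ^ n))
        * ∑' j : ℕ, ENNReal.ofReal ((3 / 4) ^ j))) ?_ ?_
      · have h1 := summable_geometric_ofReal (r := 2 / 3) (by norm_num) (by norm_num)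
        have h2 := summable_geometric_ofReal (r := 3 / 4) (by norm_num) (by norm_num)
        finiteness
      · rw [← ENNReal.tsum_mul_right, ← ENNReal.tsum_mul_left]
        exact ENNReal.tsum_le_tsum fun n =>
          (hTi U n).trans (mul_le_mul_right (tsum_tail_le N n hN) _)
    filter_upwards [ae_lt_top (Measurable.tsum (hTm U)) hfin] with ω hω
    exact ENNReal.tendsto_atTop_zero_of_tsum_ne_top hω.ne
  filter_upwards [ae_all_iff.2 hlim, ae_all_iff.2 (h.ae_exists_bound hξ)] with ω h1 h2
  have hc : ∀ t, PolyBounded fun m => c m t ω := fun t => by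
    obtain ⟨U, hU⟩ := exists_nat_ge t
    obtain ⟨C, hC⟩ := h2 U
    exact ⟨C, fun m => (hC m t hU).1⟩
  have hs : ∀ t, PolyBounded fun m => s m t ω := fun t => by
    obtain ⟨U, hU⟩ := exists_nat_ge t
    obtain ⟨C, hC⟩ := h2 U
    exact ⟨C, fun m => (hC m t hU).2⟩
  refine ⟨hc, hs, fun U => tendsto_zero_of_pow_le hN (fun n => ?_) (h1 U)⟩
  rw [← ENNReal.rpow_natCast, ← ENNReal.le_rpow_inv_iff (by positivity)]
  refine iSup₂_le fun t ht => ?_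
  rw [ENNReal.le_rpow_inv_iff (by positivity), ENNReal.rpow_natCast]
  refine hTb U n ω t ht _ (fun m => ?_) fun m => ?_
  · rw [pair_sub, pair_coeffDist_cosTest _ _ (fun m => h.neg_cos m t ω), pair_trigDist_cosTest]
    simp only [h.neg_cos]
    split_ifs <;> ring
  · rw [pair_sub, pair_coeffDist_sinTest _ _ (fun m => h.neg_sin m t ω), pair_trigDist_sinTest]
    simp only [h.neg_sin]
    split_ifs <;> ring

/-! ### The stochastic convolution as a process in the Besov space -/

theorem IsModeFamily.ae_besovField_apply (h : IsModeFamily P ξ c s)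
    (hξ : IsSpaceTimeWhiteNoise P ξ) {ρ : DyadicPartition d} {θ : ℝ}
    (hθ : θ < 2 - (d : ℝ) / 2) (r : ℝ≥0) (φ : TestFun d) :
    ∀ᵐ ω ∂P, ((besovField ρ θ c s r ω).toDist : TestFun d →ₗ[ℝ] ℝ) φ
      = stochConv ξ r (φ : Torus d → ℝ) ω := by
  have hgood := h.ae_isGood hξ ρ hθ
  have hsum : ∀ᵐ ω ∂P,
      Summable fun m => c m r ω * pair (cosDist m) φ + s m r ω * pair (sinDist m) φ := by
    filter_upwards [hgood] with ω hω
    exact summable_term (hω.choose r) (hω.choose_spec.choose r) φ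
  filter_upwards [hgood, hξ.tsum_eq_stochConv r φ (c := fun m ω => c m r ω)
    (s := fun m ω => s m r ω) (fun m => h.ae_cos m r) (fun m => h.ae_sin m r) hsum] with ω h1 h2
  rw [besovField_of_isGood h1, ← h2]
  rfl

theorem IsModeFamily.measurable_noiseSigma_besovField [P.IsComplete] (h : IsModeFamily P ξ c s)
    (hξ : IsSpaceTimeWhiteNoise P ξ) {ρ : DyadicPartition d} {θ : ℝ}
    (hθ : θ < 2 - (d : ℝ) / 2) (r : ℝ≥0) :
    Measurable[noiseSigma P ξ r] (besovField ρ θ c s r) := by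
  refine @measurable_besovField d ρ θ Ω c s (noiseSigma P ξ r) r (fun m => ?_) (fun m => ?_) ?_
  · exact measurable_noiseSigma_of_ae_eq hξ (sqIntegrable_convKernel_cosChar r m)
      (fun q x hq => convKernel_of_lt hq _ x) (h.meas_cos m r) (h.ae_cos m r)
  · exact measurable_noiseSigma_of_ae_eq hξ (sqIntegrable_convKernel_sinChar r m)
      (fun q x hq => convKernel_of_lt hq _ x) (h.meas_sin m r) (h.ae_sin m r)
  -- No direct measurability of the good event is needed: its complement is null, hence measurable
  -- by completeness, and so belongs to `ℱ_r`.
  · have h0 : P {ω | IsGood ρ θ (fun m t => c m t ω) (fun m t => s m t ω)}ᶜ = 0 :=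
      h.ae_isGood hξ ρ hθ
    rw [← compl_compl {ω | IsGood ρ θ (fun m t => c m t ω) (fun m t => s m t ω)}]
    exact MeasurableSet.compl (measurableSet_noiseSigma_of_null
      (measurableSet_of_null h0) h0 r)

/-! ### Convergence of the mollifications -/

/-- Each box is finite, so the sum of `|ζ(εm) - 1|` over it is continuous in `ε` and vanishes at
`0`, where `ζ(0) = 1` enters. Capping this sum by a constant that bounds `|ζ - 1|` provides the
domination needed to pass to the limit in the series over `j`. -/
theorem exists_multiplier_bound {ζ : EuclideanSpace ℝ (Fin d) → ℝ} (hζc : Continuous ζ)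
    (hζ : HasCompactSupport ζ) (h0 : ζ 0 = 1) {N : ℕ} (hN : N ≠ 0) :
    ∃ b : ℝ → ℕ → ℝ≥0,
      (∀ ε j, ∀ m ∈ latticeBall d (3 * 2 ^ j), |ζ (ε • latticePt m) - 1| ≤ b ε j) ∧
      Tendsto (fun ε => ∑' j, ENNReal.ofReal ((b ε j : ℝ) ^ N * (1 / 2) ^ j)) (𝓝 0) (𝓝 0) := by
  obtain ⟨C, hC⟩ := hζc.bounded_above_of_compact_support hζ
  set D : ℝ≥0 := (C + 1).toNNReal with hD
  set b : ℝ → ℕ → ℝ≥0 := fun ε j =>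
    min D (∑ m ∈ latticeBall d (3 * 2 ^ j), ‖ζ (ε • latticePt m) - 1‖₊) with hb
  refine ⟨b, fun ε j m hm => ?_, ?_⟩
  · rw [← Real.norm_eq_abs, ← coe_nnnorm, NNReal.coe_le_coe, hb]
    refine le_min ?_ (Finset.single_le_sum (f := fun m => ‖ζ (ε • latticePt m) - 1‖₊)
      (fun _ _ => zero_le) hm)
    rw [hD, ← NNReal.coe_le_coe, coe_nnnorm]
    refine (norm_sub_le _ _).trans (le_trans ?_ (Real.le_coe_toNNReal _))
    rw [norm_one]
    linarith [hC (ε • latticePt m)]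
  · have hbt : ∀ j, Tendsto (fun ε => b ε j) (𝓝 0) (𝓝 0) := fun j => by
      have hcont : Continuous fun ε => b ε j := by
        refine continuous_const.min (continuous_finsetSum _ fun m _ => ?_)
        have : Continuous fun ε : ℝ => ζ (ε • latticePt m) := hζc.comp (by fun_prop)
        exact (this.sub continuous_const).nnnorm
      have := hcont.tendsto 0
      simpa [hb, h0] using this
    have hnn : ∀ ε j, 0 ≤ (b ε j : ℝ) ^ N * (1 / 2) ^ j := fun ε j => by positivity
    have hle : ∀ ε j, (b ε j : ℝ) ^ N * (1 / 2) ^ j ≤ (D : ℝ) ^ N * (1 / 2) ^ j := fun ε j => by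
      have : (b ε j : ℝ) ≤ D := NNReal.coe_le_coe.2 (min_le_left _ _)
      gcongr
    have hsum : Summable fun j : ℕ => (D : ℝ) ^ N * (1 / 2 : ℝ) ^ j :=
      (summable_geometric_of_lt_one (by norm_num) (by norm_num)).mul_left _
    have hlim : Tendsto (fun ε => ∑' j, (b ε j : ℝ) ^ N * (1 / 2) ^ j) (𝓝 0)
        (𝓝 (∑' _j : ℕ, (0 : ℝ))) := by
      refine tendsto_tsum_of_dominated_convergence hsum (fun j => ?_) (Eventually.of_forall fun ε j => ?_)
      · have := ((NNReal.tendsto_coe.2 (hbt j)).pow N).mul_const ((1 / 2 : ℝ) ^ j)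
        simpa [hN] using this
      · rw [Real.norm_of_nonneg (hnn ε j)]
        exact hle ε j
    have h2 := ENNReal.tendsto_ofReal hlim
    rw [tsum_zero, ENNReal.ofReal_zero] at h2
    refine h2.congr fun ε => ?_
    exact ENNReal.ofReal_tsum_of_nonneg (hnn ε)
      (Summable.of_nonneg_of_le (hnn ε) (hle ε) hsum)

theorem IsModeFamily.tendsto_mollify_besovField (h : IsModeFamily P ξ c s)
    (hξ : IsSpaceTimeWhiteNoise P ξ) {ρ : DyadicPartition d} {θ : ℝ}
    (hθ : θ < 2 - (d : ℝ) / 2) {ζ : EuclideanSpace ℝ (Fin d) → ℝ} (hζc : Continuous ζ)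
    (hζ : HasCompactSupport ζ) (h0 : ζ 0 = 1) (heven : ∀ x, ζ (-x) = ζ x) (U : ℝ≥0) {σ : ℝ}
    (hσ : 0 < σ) :
    Tendsto (fun ε : ℝ => P {ω | ENNReal.ofReal σ < ⨆ r ∈ Set.Icc (0 : ℝ≥0) U, besovNorm ρ θ
      (mollify ζ ε (besovField ρ θ c s r ω).toDist - (besovField ρ θ c s r ω).toDist)})
      (𝓝[>] 0) (𝓝 0) := by
  obtain ⟨N, hN, hbd⟩ := h.exists_besov_bound hξ ρ hθ
  obtain ⟨V, hV⟩ := exists_nat_ge U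
  obtain ⟨K, hK⟩ := hbd V
  obtain ⟨b, hb, hlim⟩ := exists_multiplier_bound hζc hζ h0 hN
  have hσ0 : ENNReal.ofReal σ ^ N ≠ 0 := pow_ne_zero _ (ENNReal.ofReal_pos.2 hσ).ne'
  have hσt : ENNReal.ofReal σ ^ N ≠ ∞ := by finiteness
  have hbound : ∀ ε : ℝ, 0 < ε → P {ω | ENNReal.ofReal σ < ⨆ r ∈ Set.Icc (0 : ℝ≥0) U,
      besovNorm ρ θ (mollify ζ ε (besovField ρ θ c s r ω).toDist
        - (besovField ρ θ c s r ω).toDist)}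
      ≤ K * (∑' j, ENNReal.ofReal ((b ε j : ℝ) ^ N * (1 / 2) ^ j)) / ENNReal.ofReal σ ^ N := by
    intro ε hε
    obtain ⟨T, hTm, hTi, hTb⟩ := hK (fun m => ζ (ε • latticePt m) - 1) (b ε) (hb ε)
    calc _ ≤ P {ω | ENNReal.ofReal σ ^ N ≤ T ω} := by
          -- The event is almost surely contained in a superlevel set of the measurable variable
          -- `T`, to which Markov's inequality applies; measurability of the supremum over `r` plays
          -- no role.
          refine measure_mono_ae ?_
          filter_upwards [h.ae_isGood hξ ρ hθ] with ω hω hlt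
          change ENNReal.ofReal σ < _ at hlt
          simp only [lt_iSup_iff] at hlt
          obtain ⟨r, hr, hlt⟩ := hlt
          rw [besovField_of_isGood hω] at hlt
          refine (pow_le_pow_left₀ zero_le hlt.le N).trans
            (hTb ω r (hr.2.trans hV) _ (fun m => ?_) fun m => ?_)
          · rw [pair_sub, pair_mollify_cosTest hζ heven hε]
            rw [hω.pair_field_cosTest fun m => h.neg_cos m r ω]
            ring
          · rw [pair_sub, pair_mollify_sinTest hζ heven hε]
            rw [hω.pair_field_sinTest fun m => h.neg_sin m r ω]
            ring
      _ ≤ (∫⁻ ω, T ω ∂P) / ENNReal.ofReal σ ^ N :=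
          meas_ge_le_lintegral_div hTm.aemeasurable hσ0 hσt
      _ ≤ _ := by gcongr
  refine tendsto_of_tendsto_of_tendsto_of_le_of_le' tendsto_const_nhds ?_
    (Eventually.of_forall fun _ => zero_le)
    (eventually_nhdsWithin_of_forall fun ε hε => hbound ε hε)
  have h1 := ENNReal.Tendsto.const_mul (a := (K : ℝ≥0∞)) 
    (hlim.mono_left (nhdsWithin_le_nhds (s := Set.Ioi 0)))
    (Or.inr ENNReal.coe_ne_top)
  have h2 := ENNReal.Tendsto.div_const (b := ENNReal.ofReal σ ^ N) h1 (Or.inr hσ0)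
  simpa using h2

end Modes

end CahnHilliard

end

theorem mainTheorem6 (d : ℕ) (hd : 1 ≤ d) (ρ : CahnHilliard.DyadicPartition d)
    {Ω : Type*} [MeasurableSpace Ω] (P : Measure Ω) [IsProbabilityMeasure P] [P.IsComplete]
    (ξ : (ℝ≥0 × CahnHilliard.Torus d → ℝ) → Ω → ℝ)
    (hξ : CahnHilliard.IsSpaceTimeWhiteNoise P ξ)
    (θ : ℝ) (hθ : θ < 2 - (d : ℝ) / 2) :
    ∃ X : ℝ≥0 → Ω → CahnHilliard.BesovC ρ θ,
      (∀ r, Measurable (X r)) ∧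
      (∀ r, Measurable[CahnHilliard.noiseSigma P ξ r] (X r)) ∧
      (∀ ω, Continuous fun r => X r ω) ∧
      (∀ (r : ℝ≥0) (φ : CahnHilliard.TestFun d),
        ∀ᵐ ω ∂P, ((X r ω).toDist : CahnHilliard.TestFun d →ₗ[ℝ] ℝ) φ
          = CahnHilliard.stochConv ξ r (φ : CahnHilliard.Torus d → ℝ) ω) ∧
      ∀ ζ : EuclideanSpace ℝ (Fin d) → ℝ, ContDiff ℝ (⊤ : ℕ∞) ζ → HasCompactSupport ζ → ζ 0 = 1 →
        (∀ x, ζ (-x) = ζ x) →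
        ∀ (U : ℝ≥0) (σ : ℝ), 0 < σ →
          Tendsto (fun ε : ℝ => P {ω | ENNReal.ofReal σ < ⨆ r ∈ Set.Icc (0 : ℝ≥0) U,
              CahnHilliard.besovNorm ρ θ
                (CahnHilliard.mollify ζ ε (X r ω).toDist - (X r ω).toDist)})
            (𝓝[>] 0) (𝓝 0) := by
  obtain ⟨c, s, h⟩ := hξ.exists_isModeFamily
  have hmeas := h.measurable_noiseSigma_besovField hξ (ρ := ρ) hθ
  exact ⟨CahnHilliard.besovField ρ θ c s,
    fun r => (hmeas r).mono (CahnHilliard.noiseSigma_le hξ r) le_rfl, hmeas,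
    CahnHilliard.continuous_besovField h.cont_cos h.cont_sin,
    h.ae_besovField_apply hξ hθ,
    fun ζ hζ hsupp h0 heven U σ hσ =>
      h.tendsto_mollify_besovField hξ hθ hζ.continuous hsupp h0 heven U hσ⟩
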